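/- Let $a<b$, $\Xi=[a,b]$, and let $\xi$ be uniformly distributed on $\Xi$. Let $A:\Xi\to\mathbb R^{n_x\times n_x}$ and $B:\Xi\to\mathbb R^{n_x\times n_u}$ be real analytic, let $Q\in\mathbb R^{n_x\times n_x}$ and $R\in\mathbb R^{n_u\times n_u}$ be symmetric positive definite, and let $x_0\sim\mathcal N(0,I_{n_x})$ be independent of $\xi$. A gain $K\in\mathbb R^{n_u\times n_x}$ gives the closed-loop system $\dot x(t,\xi)=(A(\xi)-B(\xi)K)x(t,\xi)$, $x(0,\xi)=x_0$, $u=-Kx$, with costs $$\mathcal J_\xi(K)=\mathbb E_{x_0}\int_0^\infty \big(x^\top Qx+u^\top Ru\big)\,dt,\qquad \mathcal J(K)=\mathbb E_{\xi}\,\mathcal J_\xi(K).$$ Let $\varphi_i(\xi)=\sqrt{2i+1}\,P_i\big(\tfrac{2\xi-a-b}{b-a}\big)$ be the normalized Legendre polynomials on $\Xi$ ($P_i$ the classical Legendre polynomial), and $\phi_N=(\varphi_0,\dots,\varphi_N)^\top$. Put $\mathcal A_N=\mathbb E[\phi_N\phi_N^\top\otimes A(\xi)]$, $\mathcal B_N=\mathbb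 E[\phi_N\phi_N^\top\otimes B(\xi)]$, $\mathcal A_{N,c}(K)=\mathcal A_N-\mathcal B_N(I_{N+1}\otimes K)$. Let $\hat z_N$ solve $\dot{\hat z}_N=\mathcal A_{N,c}(K)\hat z_N$, $\hat z_N(0)=(x_0^\top,0,\dots,0)^\top$, let $\hat x(t,\xi)=(\phi_N(\xi)\otimes I_{n_x})^\top\hat z_N(t)$, and define the surrogate cost $$\hat{\mathcal J}_N(K)=\mathbb E_{\xi,x_0}\int_0^\infty \hat x^\top(Q+K^\top RK)\hat x\,dt .$$ Fix $\bar\xi\in\Xi$, $h>0$ and $\epsilon_1\in(0,1)$, and let $$\mathcal S(\bar\xi,h)=\{K:\ A(\bar\xi)-B(\bar\xi)K\text{ is Hurwitz and }\mathcal J_{\bar\xi}(K)\le h\}.$$ With $\|\cdot\|$ the spectral norm, $a_1=2\|B(\bar\xi)\|/\lambda_{\min}(R)$ and $a_2=\sqrt{2\|A(\bar\xi)\|/\lambda_{\min}(R)}$, assume that for all $\xi_1,\xi_2\in\Xi$ $$\|A(\xi_1)-A(\xi_2)\|\le\epsilon(h),\qquad \|B(\xi_1)-B(\xi_2)\|\le\epsilon(h),$$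 $$\epsilon(h)=\frac{\lambda_{\min}(Q)}{4h(1+a_1h+a_2\sqrt h)}\min\Big\{1,\frac{\epsilon_1}{h},\frac{\lambda_{\min}(Q)\,\epsilon_1}{h}\Big\}.$$ Then for every integer $p\ge 0$ there is a constant $C_1(h)>0$, independent of $N$ and of $K\in\mathcal S(\bar\xi,h)$, such that for all $K\in\mathcal S(\bar\xi,h)$ and all integers $N\ge1$ both costs are well defined and $$|\mathcal J(K)-\hat{\mathcal J}_N(K)|\le C_1(h)\,N^{-p}.$$ Here "well defined" means: there are $\mu,\gamma>0$ with $\|x(t,\xi)\|\le\mu e^{-\gamma t}\|x_0\|$ for all $x_0$, all $\xi\in\Xi$ and all $t\ge0$; the matrix $\mathcal A_{N,c}(K)$ is Hurwitz; and $\mathcal J(K)$ and $\hat{\mathcal J}_N(K)$ are finite. -/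

import Mathlib

open scoped Matrix Kronecker ENNReal Matrix.Norms.L2Operator

namespace PCELQR

/-! ### Linear systems and the LQR cost

A feedback gain `K : Matrix (Fin m) (Fin n) ℝ` acts as `u = -K x`; `n` is the dimension of the
state, `m` the dimension of the input. -/

/-- The smallest eigenvalue of a (nonempty) real symmetric matrix. -/
noncomputable def lambdaMin {k : ℕ} (M : Matrix (Fin k) (Fin k) ℝ) : ℝ :=
  sInf (spectrum ℝ M)

/-- A real square matrix is Hurwitz if all its complex eigenvalues have negative real part. -/
def IsHurwitz {ι : Type*} [Fintype ι] [DecidableEq ι] (M : Matrix ι ι ℝ) : Prop :=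
  ∀ z ∈ spectrum ℂ (M.map (algebraMap ℝ ℂ)), z.re < 0

/-- The closed-loop state matrix `A - B K`. -/
def closedLoop {n m : ℕ} (A : Matrix (Fin n) (Fin n) ℝ) (B : Matrix (Fin n) (Fin m) ℝ)
    (K : Matrix (Fin m) (Fin n) ℝ) : Matrix (Fin n) (Fin n) ℝ :=
  A - B * K

/-- The solution at time `t` of `x' = M x`, `x(0) = x₀`. -/
noncomputable def flow {ι : Type*} [Fintype ι] [DecidableEq ι] (M : Matrix ι ι ℝ) (t : ℝ)
    (x₀ : ι → ℝ) : ι → ℝ :=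
  NormedSpace.exp (t • M) *ᵥ x₀

/-- The LQR cost `∫₀^∞ (xᵀ Q x + uᵀ R u) dt` along the solution of `x' = A x + B u`, `u = -K x`,
`x(0) = x₀`, as an extended nonnegative number. -/
noncomputable def costFrom {n m : ℕ} (A : Matrix (Fin n) (Fin n) ℝ)
    (B : Matrix (Fin n) (Fin m) ℝ) (Q : Matrix (Fin n) (Fin n) ℝ) (R : Matrix (Fin m) (Fin m) ℝ)
    (K : Matrix (Fin m) (Fin n) ℝ) (x₀ : Fin n → ℝ) : ℝ≥0∞ :=
  ∫⁻ t in Set.Ici (0 : ℝ),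
    let x := flow (closedLoop A B K) t x₀
    let u := -(K *ᵥ x)
    ENNReal.ofReal (x ⬝ᵥ (Q *ᵥ x) + u ⬝ᵥ (R *ᵥ u))

/-- The LQR cost of `K` for one fixed system, averaged over a standard Gaussian initial state. -/
noncomputable def systemCost {n m : ℕ} (A : Matrix (Fin n) (Fin n) ℝ)
    (B : Matrix (Fin n) (Fin m) ℝ) (Q : Matrix (Fin n) (Fin n) ℝ) (R : Matrix (Fin m) (Fin m) ℝ)
    (K : Matrix (Fin m) (Fin n) ℝ) : ℝ≥0∞ :=
  ∫⁻ x₀ : EuclideanSpace ℝ (Fin n), costFrom A B Q R K x₀.ofLp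
    ∂(ProbabilityTheory.stdGaussian (EuclideanSpace ℝ (Fin n)))

/-- The sublevel set of the stabilizing gains for the system `(A, B)` whose cost is at most `h`. -/
def sublevel {n m : ℕ} (A : Matrix (Fin n) (Fin n) ℝ) (B : Matrix (Fin n) (Fin m) ℝ)
    (Q : Matrix (Fin n) (Fin n) ℝ) (R : Matrix (Fin m) (Fin m) ℝ) (h : ℝ) :
    Set (Matrix (Fin m) (Fin n) ℝ) :=
  {K | IsHurwitz (closedLoop A B K) ∧ systemCost A B Q R K ≤ ENNReal.ofReal h}

/-! ### Parametric uncertainty -/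

/-- The uniform distribution on the interval `[a, b]`. -/
noncomputable def unif (a b : ℝ) : MeasureTheory.Measure ℝ :=
  ProbabilityTheory.cond MeasureTheory.volume (Set.Icc a b)

/-- The gains `K` for which `x' = (A(ξ) - B(ξ) K) x` is uniformly exponentially stable for
`ξ ∈ [a, b]`. -/
def admissible {n m : ℕ} (a b : ℝ) (A : ℝ → Matrix (Fin n) (Fin n) ℝ)
    (B : ℝ → Matrix (Fin n) (Fin m) ℝ) : Set (Matrix (Fin m) (Fin n) ℝ) :=
  {K | ∃ μ > 0, ∃ γ > 0, ∀ x₀ : EuclideanSpace ℝ (Fin n), ∀ ξ ∈ Set.Icc a b, ∀ t : ℝ, 0 ≤ t →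
    ‖WithLp.toLp 2 (flow (closedLoop (A ξ) (B ξ) K) t x₀.ofLp)‖ ≤ μ * Real.exp (-γ * t) * ‖x₀‖}

/-- The expected LQR cost `J(K)`: the mean over the parameter `ξ`, uniform on `[a, b]`, and over
an independent standard Gaussian initial state. -/
noncomputable def expectedCost {n m : ℕ} (a b : ℝ) (A : ℝ → Matrix (Fin n) (Fin n) ℝ)
    (B : ℝ → Matrix (Fin n) (Fin m) ℝ) (Q : Matrix (Fin n) (Fin n) ℝ)
    (R : Matrix (Fin m) (Fin m) ℝ) (K : Matrix (Fin m) (Fin n) ℝ) : ℝ≥0∞ :=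
  ∫⁻ ξ, systemCost (A ξ) (B ξ) Q R K ∂(unif a b)

/-- The admissible heterogeneity level `ε(h)` of the nominal system `(A, B)`. -/
noncomputable def heterogeneityLevel {n m : ℕ} (A : Matrix (Fin n) (Fin n) ℝ)
    (B : Matrix (Fin n) (Fin m) ℝ) (Q : Matrix (Fin n) (Fin n) ℝ) (R : Matrix (Fin m) (Fin m) ℝ)
    (h ε₁ : ℝ) : ℝ :=
  let a₁ := 2 * ‖B‖ / lambdaMin R
  let a₂ := √(2 * ‖A‖ / lambdaMin R)
  lambdaMin Q / (4 * h * (1 + a₁ * h + a₂ * √h)) *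
    min 1 (min (ε₁ / h) (lambdaMin Q * ε₁ / h))

/-- All the systems `(A(ξ), B(ξ))`, `ξ ∈ [a, b]`, are within `ε(h)` of each other in spectral norm,
where `ε(h)` is computed at the nominal parameter `ξbar`. -/
def SmallHeterogeneity {n m : ℕ} (a b : ℝ) (A : ℝ → Matrix (Fin n) (Fin n) ℝ)
    (B : ℝ → Matrix (Fin n) (Fin m) ℝ) (Q : Matrix (Fin n) (Fin n) ℝ)
    (R : Matrix (Fin m) (Fin m) ℝ) (ξbar h ε₁ : ℝ) : Prop :=
  ∀ ξ₁ ∈ Set.Icc a b, ∀ ξ₂ ∈ Set.Icc a b,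
    ‖A ξ₁ - A ξ₂‖ ≤ heterogeneityLevel (A ξbar) (B ξbar) Q R h ε₁ ∧
    ‖B ξ₁ - B ξ₂‖ ≤ heterogeneityLevel (A ξbar) (B ξbar) Q R h ε₁

/-! ### The polynomial chaos surrogate -/

/-- The Legendre polynomial of degree `i`, transported affinely from `[-1, 1]` to `[a, b]` and
normalized in `L²` of the uniform distribution: `√(2i+1) Pᵢ((2ξ - a - b)/(b - a))`. The classical
`Pᵢ` satisfies `Pᵢ(2y - 1) = (-1)^i * shiftedLegendre i (y)`. -/
noncomputable def legendre (a b : ℝ) (i : ℕ) (ξ : ℝ) : ℝ :=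
  √(2 * i + 1) * (-1) ^ i *
    Polynomial.aeval ((ξ - a) / (b - a)) (Polynomial.shiftedLegendre i)

/-- The vector `φ_N(ξ)` of the first `N + 1` normalized Legendre polynomials. -/
noncomputable def phi (a b : ℝ) (N : ℕ) (ξ : ℝ) : Fin (N + 1) → ℝ :=
  fun i => legendre a b i ξ

/-- The Galerkin projection `E[φ_N(ξ) φ_N(ξ)ᵀ ⊗ M(ξ)]` (entrywise expectation); the index
`(i, k)` is the `k`-th coordinate in block `i`. -/
noncomputable def lift {n k : ℕ} (a b : ℝ) (N : ℕ) (M : ℝ → Matrix (Fin n) (Fin k) ℝ) :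
    Matrix (Fin (N + 1) × Fin n) (Fin (N + 1) × Fin k) ℝ :=
  Matrix.of fun i j =>
    ∫ ξ, (Matrix.vecMulVec (phi a b N ξ) (phi a b N ξ) ⊗ₖ M ξ) i j ∂(unif a b)

/-- The closed-loop state matrix `𝒜_N - ℬ_N (I_{N+1} ⊗ K)` of the surrogate system. -/
noncomputable def surrogateClosedLoop {n m : ℕ} (a b : ℝ) (A : ℝ → Matrix (Fin n) (Fin n) ℝ)
    (B : ℝ → Matrix (Fin n) (Fin m) ℝ) (N : ℕ) (K : Matrix (Fin m) (Fin n) ℝ) :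
    Matrix (Fin (N + 1) × Fin n) (Fin (N + 1) × Fin n) ℝ :=
  lift a b N A - lift a b N B * ((1 : Matrix (Fin (N + 1)) (Fin (N + 1)) ℝ) ⊗ₖ K)

/-- The gains that stabilize the surrogate system of order `N`. -/
def surrogateAdmissible {n m : ℕ} (a b : ℝ) (A : ℝ → Matrix (Fin n) (Fin n) ℝ)
    (B : ℝ → Matrix (Fin n) (Fin m) ℝ) (N : ℕ) : Set (Matrix (Fin m) (Fin n) ℝ) :=
  {K | IsHurwitz (surrogateClosedLoop a b A B N K)}

/-- The initial state `(x₀, 0, …, 0)` of the surrogate system. -/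
def surrogateInit {n : ℕ} (N : ℕ) (x₀ : Fin n → ℝ) : Fin (N + 1) × Fin n → ℝ :=
  fun i => if i.1 = 0 then x₀ i.2 else 0

/-- The approximate state `x̂(t, ξ) = Ẑ(t) φ_N(ξ)`, where `ẑ = vec Ẑ` is the solution of the
surrogate system. -/
noncomputable def surrogateState {n m : ℕ} (a b : ℝ) (A : ℝ → Matrix (Fin n) (Fin n) ℝ)
    (B : ℝ → Matrix (Fin n) (Fin m) ℝ) (N : ℕ) (K : Matrix (Fin m) (Fin n) ℝ) (x₀ : Fin n → ℝ)
    (t ξ : ℝ) : Fin n → ℝ :=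
  fun k => ∑ i : Fin (N + 1),
    flow (surrogateClosedLoop a b A B N K) t (surrogateInit N x₀) (i, k) * phi a b N ξ i

/-- The quadratic cost `∫₀^∞ x̂(t, ξ)ᵀ (Q + Kᵀ R K) x̂(t, ξ) dt` of the approximate state. -/
noncomputable def surrogateCostFrom {n m : ℕ} (a b : ℝ) (A : ℝ → Matrix (Fin n) (Fin n) ℝ)
    (B : ℝ → Matrix (Fin n) (Fin m) ℝ) (Q : Matrix (Fin n) (Fin n) ℝ)
    (R : Matrix (Fin m) (Fin m) ℝ) (N : ℕ) (K : Matrix (Fin m) (Fin n) ℝ) (x₀ : Fin n → ℝ)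
    (ξ : ℝ) : ℝ≥0∞ :=
  ∫⁻ t in Set.Ici (0 : ℝ),
    let x := surrogateState a b A B N K x₀ t ξ
    ENNReal.ofReal (x ⬝ᵥ ((Q + Kᵀ * R * K) *ᵥ x))

/-- The surrogate cost `Ĵ_N(K) = E ∫₀^∞ x̂ᵀ (Q + Kᵀ R K) x̂ dt`, where the expectation is over
`ξ`, uniform on `[a, b]`, and over an independent standard Gaussian `x₀`. -/
noncomputable def surrogateCost {n m : ℕ} (a b : ℝ) (A : ℝ → Matrix (Fin n) (Fin n) ℝ)
    (B : ℝ → Matrix (Fin n) (Fin m) ℝ) (Q : Matrix (Fin n) (Fin n) ℝ)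
    (R : Matrix (Fin m) (Fin m) ℝ) (N : ℕ) (K : Matrix (Fin m) (Fin n) ℝ) : ℝ≥0∞ :=
  ∫⁻ ξ, ∫⁻ x₀, surrogateCostFrom a b A B Q R N K x₀.ofLp ξ
    ∂(ProbabilityTheory.stdGaussian (EuclideanSpace ℝ (Fin n))) ∂(unif a b)

end PCELQR

namespace PCELQR

/-! ### Polynomial approximation of smooth functions -/

section Approximation

open Real Polynomial MeasureTheory

/-! Let `M` be the nominal closed loop of a gain `K` in the sublevel set. The Gramian P = ∫ exp(tM)ᵀ
(Q + KᵀRK) exp(tM) dt is a Lyapunov matrix whose trace is the cost, so P ≤ h. The Lyapunov equation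
bounds ‖K‖ by a₁h + a₂√h and bounds P from below, both uniformly in `K`. Since ε(h)(1 + a₁h + a₂√h)
≤ λ_min(Q)/(4h), the same P serves every parameter, and even data that deviate from the nominal ones
by 3ε/2. Writing P = TᵀT, this says that for one step size η all Euler matrices S(ξ) = T(1 +
ηM(ξ))T⁻¹ have norm at most q < 1, where η, q and the bounds on T, T⁻¹ do not depend on `K`
(`exists_contraction`).

The Galerkin projection is the compression of a multiplication operator to polynomials of degree at
most N. Hence it does not increase the supremum of the spectral norm (`norm_lift_le`), and it
respects multiplication by constant matrices. In the coordinates 1 ⊗ T the Euler matrix of the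
surrogate is therefore a q-contraction for every N, which makes the surrogate stable.

For the rate, write exp(tM) = exp(-t/η) T⁻¹ exp((t/η)S) T. Replacing S by a polynomial S' of degree
d within δ and cutting the exponential series after the power s costs C(δ + r^s) exp((t/η)r) with q
≤ r < 1 (`exists_norm_exp_sub_expPart_le`), still integrable in t after the factor exp(-t/η). The
same estimate holds for the projections of S and S'. If sd ≤ N, the truncated series of the
projection of S', applied to the constant initial state, reproduces that of S'(ξ) exactly
(`expand_lift_pow`). The truncated series cancel, and the state error is a difference of two
remainders (`exists_state_error`).

Smooth data are approximated by polynomials faster than any power of d (`exists_polynomial_approx`),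
so s = d = ⌊√N⌋ gives state errors O(N⁻ᵖ). Gaussian averaging turns both costs into sums over basis
vectors; Young's inequality and Parseval's identity then carry the rate over to the costs
(`cost_error`). -/

theorem norm_fourierCoeffOn_le {a b : ℝ} (hab : a < b) {g : ℝ → ℂ} {C : ℝ}
    (hg : ∀ x, ‖g x‖ ≤ C) (n : ℤ) : ‖fourierCoeffOn hab g n‖ ≤ C := by
  have hC : 0 ≤ C := (norm_nonneg _).trans (hg 0)
  have hba : 0 < b - a := sub_pos.2 hab
  rw [fourierCoeffOn_eq_integral, norm_smul]
  have : ‖∫ x in a..b, fourier (-n) (x : AddCircle (b - a)) • g x‖ ≤ C * |b - a| := by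
    refine intervalIntegral.norm_integral_le_of_norm_le_const fun x _ => ?_
    have h1 : ‖fourier (-n) (x : AddCircle (b - a))‖ = 1 := by
      rw [fourier_apply]; exact Circle.norm_coe _
    rw [norm_smul, h1, one_mul]
    exact hg x
  calc ‖1 / (b - a)‖ * _ ≤ ‖1 / (b - a)‖ * (C * |b - a|) := by gcongr
    _ = C := by
      rw [norm_div, norm_one, Real.norm_eq_abs]
      have : |b - a| ≠ 0 := (abs_pos.2 hba.ne').ne'
      field_simp

/-- The Fourier coefficients of a smooth periodic function decay faster than every power. -/
theorem exists_fourierCoeffOn_le {T : ℝ} (hT : (0 : ℝ) < 0 + T) (k : ℕ) :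
    ∀ g : ℝ → ℂ, ContDiff ℝ (⊤ : ℕ∞) g → Function.Periodic g T →
      ∃ C : ℝ, 0 ≤ C ∧ ∀ n : ℤ, n ≠ 0 → ‖fourierCoeffOn hT g n‖ * |(n : ℝ)| ^ k ≤ C := by
  induction k with
  | zero =>
    intro g hg hper
    obtain ⟨C, hC⟩ := (Function.Periodic.compact_of_continuous hper (by simpa using hT.ne')
      hg.continuous).isBounded.exists_norm_le
    replace hC : ∀ x, ‖g x‖ ≤ C := fun x => hC _ ⟨x, rfl⟩
    exact ⟨C, (norm_nonneg _).trans (hC 0), fun n _ => by simpa using norm_fourierCoeffOn_le hT hC n⟩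
  | succ k ih =>
    intro g hg hper
    have hg' : ContDiff ℝ (⊤ : ℕ∞) (deriv g) := ((contDiff_infty_iff_deriv (𝕜 := ℝ)).1 hg).2
    have hper' : Function.Periodic (deriv g) T := by
      intro x
      have : (fun y => g (y + T)) = g := funext hper
      rw [← deriv_comp_add_const, this]
    obtain ⟨C, hC0, hC⟩ := ih _ hg' hper'
    refine ⟨T / (2 * π) * C, by have := hT; simp at this; positivity, fun n hn => ?_⟩
    have hn' : 0 < |(n : ℝ)| := abs_pos.2 (by exact_mod_cast hn)
    have hd : ∀ x, HasDerivAt g (deriv g x) x := fun x =>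
      (hg.differentiable (by simp)).differentiableAt.hasDerivAt
    -- One integration by parts gains a factor 1/n; periodicity kills the boundary term.
    have key := fourierCoeffOn_of_hasDerivAt hT hn (fun x _ => hd x)
      (hg'.continuous.intervalIntegrable _ _)
    have h0 : g (0 + T) - g 0 = 0 := by rw [hper 0, sub_self]
    have hT' : 0 < T := by simpa using hT
    have hn2 : ‖(n : ℂ)‖ = |(n : ℝ)| := by simp
    rw [key, h0, mul_zero, zero_sub, norm_mul, norm_neg, norm_mul, norm_div, norm_mul, norm_mul,
      norm_mul, norm_neg, hn2]
    have e1 : ‖((0 + T : ℝ) : ℂ) - ((0 : ℝ) : ℂ)‖ = T := by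
      simp [abs_of_pos hT']
    rw [e1]
    simp only [norm_one, Complex.norm_ofNat, Complex.norm_real, Complex.norm_I, Real.norm_eq_abs,
      abs_of_pos pi_pos, mul_one]
    calc 1 / (2 * π * |(n : ℝ)|) * (T * ‖fourierCoeffOn hT (deriv g) n‖) * |(n : ℝ)| ^ (k + 1)
        = T / (2 * π) * (‖fourierCoeffOn hT (deriv g) n‖ * |(n : ℝ)| ^ k) := by
          field_simp
          ring
      _ ≤ T / (2 * π) * C := by gcongr; exact hC n hn

/-- An even smooth `2π`-periodic function is a cosine series with rapidly decaying coefficients. -/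
theorem exists_cosine_series {g : ℝ → ℝ} (hg : ContDiff ℝ (⊤ : ℕ∞) g)
    (hper : Function.Periodic g (2 * π)) (heven : ∀ θ, g (-θ) = g θ) (k : ℕ) :
    ∃ c : ℤ → ℝ, ∃ C : ℝ, 0 ≤ C ∧ (∀ n : ℤ, n ≠ 0 → |c n| * |(n : ℝ)| ^ k ≤ C) ∧
      ∀ θ, HasSum (fun n : ℤ => c n * cos (n * θ)) (g θ) := by
  -- The unsimplified endpoint matches the interval [a, a + T] in `fourierCoeff_liftIco_eq`.
  have hT : (0 : ℝ) < 0 + 2 * π := by have := pi_pos; linarith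
  have : Fact (0 < 2 * π) := ⟨by have := pi_pos; linarith⟩
  set G : ℝ → ℂ := fun θ => (g θ : ℂ)
  have hG : ContDiff ℝ (⊤ : ℕ∞) G := Complex.ofRealCLM.contDiff.comp hg
  have hGper : Function.Periodic G (2 * π) := fun x => by simp only [G, hper x]
  let F : C(AddCircle (2 * π), ℂ) := ⟨hGper.lift, by
    rw [continuous_coinduced_dom]; exact hG.continuous⟩
  have hF : ∀ n, fourierCoeff F n = fourierCoeffOn hT G n := by
    intro n
    rw [← fourierCoeff_liftIco_eq]
    congr 1
    funext x
    induction x using QuotientAddGroup.induction_on with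
    | H x =>
      obtain ⟨y, hy, hxy⟩ : ∃ y ∈ Set.Ico (0 : ℝ) (0 + 2 * π),
          (x : AddCircle (2 * π)) = (y : AddCircle (2 * π)) := by
        have := (AddCircle.equivIco (2 * π) 0).symm_apply_apply (x : AddCircle (2 * π))
        exact ⟨_, (AddCircle.equivIco (2 * π) 0 x).2, this.symm⟩
      have e : (QuotientAddGroup.mk x : AddCircle (2 * π)) = (y : AddCircle (2 * π)) := hxy
      rw [e, AddCircle.liftIco_coe_apply hy]
      rfl
  obtain ⟨C₀, hC₀, h₀⟩ := exists_fourierCoeffOn_le hT k G hG hGper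
  -- Quadratic decay is used only for absolute summability, hence for pointwise convergence.
  obtain ⟨C₂, hC₂, h₂⟩ := exists_fourierCoeffOn_le hT 2 G hG hGper
  have hsum : Summable (fourierCoeff F) := by
    have hs : Summable fun n : ℤ => C₂ * (1 / (n : ℝ) ^ 2) :=
      (Real.summable_one_div_int_pow.2 (by norm_num)).mul_left _
    refine Summable.of_norm_bounded_eventually hs ?_
    have : ∀ᶠ n : ℤ in Filter.cofinite, n ≠ 0 := by
      rw [Filter.eventually_cofinite]; simp
    filter_upwards [this] with n hn
    have hn' : (0 : ℝ) < (n : ℝ) ^ 2 := by positivity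
    rw [hF, mul_one_div, le_div_iff₀ hn', ← sq_abs]
    exact h₂ n hn
  have hser : ∀ θ : ℝ, HasSum (fun n : ℤ => fourierCoeffOn hT G n * Complex.exp (n * θ * Complex.I))
      (G θ) := by
    intro θ
    have := has_pointwise_sum_fourier_series_of_summable hsum (θ : AddCircle (2 * π))
    convert! this using 2 with n
    rw [hF, smul_eq_mul, fourier_coe_apply]
    congr 2
    have : (π : ℂ) ≠ 0 := by exact_mod_cast pi_ne_zero
    push_cast
    field_simp
  refine ⟨fun n => (fourierCoeffOn hT G n).re, C₀, hC₀, fun n hn => ?_, fun θ => ?_⟩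
  · refine le_trans ?_ (h₀ n hn)
    gcongr
    exact Complex.abs_re_le_norm _
  -- Averaging the series at θ and -θ turns exponentials into cosines and, by evenness, keeps the
  -- sum.
  · have h1 := ((hser θ).add (hser (-θ))).div_const 2
    have h3 : (G θ + G (-θ)) / 2 = G θ := by simp only [G, heven]; ring
    rw [h3] at h1
    have h2 := Complex.hasSum_re h1
    convert! h2 using 2 with n
    rw [show (fourierCoeffOn hT G n * Complex.exp (n * θ * Complex.I) +
        fourierCoeffOn hT G n * Complex.exp (n * (-θ : ℝ) * Complex.I)) / 2 =
        fourierCoeffOn hT G n * ((cos (n * θ) : ℝ) : ℂ) by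
      push_cast [Complex.cos]
      ring_nf]
    rw [Complex.re_mul_ofReal]

theorem natDegree_chebyshevT_le (n : ℤ) : (Chebyshev.T ℝ n).natDegree ≤ n.natAbs := by
  rw [Chebyshev.natDegree_T]

/-- Superalgebraic polynomial approximation of a smooth function on a compact interval. -/
theorem exists_polynomial_approx {a b : ℝ} (hab : a < b) {f : ℝ → ℝ}
    (hf : ContDiffOn ℝ (⊤ : ℕ∞) f (Set.Icc a b)) (p : ℕ) :
    ∃ C : ℝ, 0 ≤ C ∧ ∀ d : ℕ, 1 ≤ d → ∃ P : ℝ[X], P.natDegree ≤ d ∧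
      ∀ x ∈ Set.Icc a b, |f x - P.eval x| ≤ C / (d : ℝ) ^ p := by
  set μ := (a + b) / 2 with hμ
  set ρ := (b - a) / 2 with hρ
  have hρ0 : 0 < ρ := by rw [hρ]; linarith
  have hmaps : ∀ θ, μ + ρ * cos θ ∈ Set.Icc a b := by
    intro θ
    have h1 := neg_one_le_cos θ
    have h2 := cos_le_one θ
    constructor <;> nlinarith
  -- The substitution x = μ + ρ cos θ gives a function that is smooth, even and periodic on the
  -- whole line, and cos(nθ) = Tₙ(cos θ) turns its partial sums into polynomials in x.
  have hg : ContDiff ℝ (⊤ : ℕ∞) fun θ => f (μ + ρ * cos θ) :=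
    contDiffOn_univ.1 (hf.comp (f := fun θ => μ + ρ * cos θ)
      (contDiff_const.add (contDiff_const.mul contDiff_cos)).contDiffOn fun θ _ => hmaps θ)
  -- Two powers beyond p are spent on the convergence of ∑ 1/n² in the tail.
  obtain ⟨c, C, hC, hc, hs⟩ := exists_cosine_series hg (fun θ => by simp)
    (fun θ => by simp) (p + 2)
  have hsum2 : Summable fun n : ℤ => 1 / (n : ℝ) ^ 2 := Real.summable_one_div_int_pow.2 (by norm_num)
  refine ⟨C * ∑' n : ℤ, 1 / (n : ℝ) ^ 2, mul_nonneg hC (tsum_nonneg fun n => by positivity),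
    fun d hd => ?_⟩
  let S := Finset.Icc (-(d : ℤ)) d
  refine ⟨(∑ n ∈ S, Polynomial.C (c n) * Chebyshev.T ℝ n).comp
    (Polynomial.C ρ⁻¹ * X - Polynomial.C (ρ⁻¹ * μ)), ?_, fun x hx => ?_⟩
  · refine natDegree_comp_le.trans ?_
    have h1 : (∑ n ∈ S, Polynomial.C (c n) * Chebyshev.T ℝ n).natDegree ≤ d := by
      refine natDegree_sum_le_of_forall_le _ _ fun n hn => ?_
      refine natDegree_C_mul_le _ _ |>.trans ((natDegree_chebyshevT_le n).trans ?_)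
      rw [Finset.mem_Icc] at hn
      omega
    have h2 : (Polynomial.C ρ⁻¹ * X - Polynomial.C (ρ⁻¹ * μ)).natDegree ≤ 1 := by
      compute_degree
    calc _ ≤ d * 1 := Nat.mul_le_mul h1 h2
      _ = d := mul_one d
  · set y := ρ⁻¹ * (x - μ) with hy
    have hyx : μ + ρ * y = x := by rw [hy]; field_simp; ring
    have hy1 : -1 ≤ y ∧ y ≤ 1 := by
      constructor
      · by_contra h
        push Not at h
        have := hx.1
        nlinarith
      · by_contra h
        push Not at h
        have := hx.2
        nlinarith
    set θ := arccos y
    have hcos : cos θ = y := cos_arccos hy1.1 hy1.2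
    have hev : ((∑ n ∈ S, Polynomial.C (c n) * Chebyshev.T ℝ n).comp
        (Polynomial.C ρ⁻¹ * X - Polynomial.C (ρ⁻¹ * μ))).eval x = ∑ n ∈ S, c n * cos (n * θ) := by
      rw [eval_comp, eval_finsetSum]
      refine Finset.sum_congr rfl fun n _ => ?_
      have : (Polynomial.C ρ⁻¹ * X - Polynomial.C (ρ⁻¹ * μ)).eval x = cos θ := by
        simp [hcos, hy]; ring
      rw [this, eval_mul, eval_C, Chebyshev.T_real_cos]
    have h1 := hs θ
    rw [hcos, hyx] at h1
    have h2 : HasSum (fun n => if n ∈ S then c n * cos (n * θ) else 0)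
        (∑ n ∈ S, c n * cos (n * θ)) := by
      have h := hasSum_sum_of_ne_finset_zero (s := S) (L := SummationFilter.unconditional ℤ)
        (f := fun n => if n ∈ S then c n * cos (n * θ) else 0) (fun n hn => by simp [hn])
      rwa [Finset.sum_congr rfl fun n hn => if_pos hn] at h
    have h3 := h1.sub h2
    rw [hev, ← Real.norm_eq_abs]
    have hd0 : (0 : ℝ) < d := by exact_mod_cast hd
    have h4 : HasSum (fun n : ℤ => C / (d : ℝ) ^ p * (1 / (n : ℝ) ^ 2))
        (C / (d : ℝ) ^ p * ∑' n : ℤ, 1 / (n : ℝ) ^ 2) := hsum2.hasSum.mul_left _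
    refine (h3.norm_le_of_bounded h4 fun n => ?_).trans_eq (by ring)
    by_cases hn : n ∈ S
    · simp only [hn, if_true, sub_self, norm_zero]; positivity
    · simp only [hn, if_false, sub_zero]
      have hnd : (d : ℝ) ≤ |(n : ℝ)| := by
        have : (d : ℤ) ≤ |n| := by
          rw [Finset.mem_Icc] at hn
          by_contra h
          push Not at h
          rw [abs_lt] at h
          exact hn ⟨h.1.le, h.2.le⟩
        exact_mod_cast this
      have hn0 : n ≠ 0 := by
        rintro rfl
        simp at hnd
        linarith
      have hnpos : 0 < |(n : ℝ)| := hd0.trans_le hnd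
      rw [norm_mul, Real.norm_eq_abs, Real.norm_eq_abs, ← sq_abs (n : ℝ)]
      calc |c n| * |cos (n * θ)| ≤ |c n| * 1 := by gcongr; exact abs_cos_le_one _
        _ ≤ C / |(n : ℝ)| ^ (p + 2) := by
          rw [mul_one, le_div_iff₀ (by positivity)]; exact hc n hn0
        _ = C / |(n : ℝ)| ^ p * (1 / |(n : ℝ)| ^ 2) := by rw [pow_add]; field_simp
        _ ≤ C / (d : ℝ) ^ p * (1 / |(n : ℝ)| ^ 2) := by gcongr

end Approximation

end PCELQR

namespace PCELQR

/-! ### Integration against the uniform distribution -/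

section Uniform

open MeasureTheory

theorem unif_eq (a b : ℝ) :
    unif a b = (volume (Set.Icc a b))⁻¹ • volume.restrict (Set.Icc a b) := rfl

theorem isProbabilityMeasure_unif {a b : ℝ} (hab : a < b) : IsProbabilityMeasure (unif a b) := by
  refine ProbabilityTheory.cond_isProbabilityMeasure_of_finite ?_ ?_
  · simp [hab]
  · simp

theorem integral_unif {a b : ℝ} (hab : a < b) (f : ℝ → ℝ) :
    ∫ ξ, f ξ ∂(unif a b) = (b - a)⁻¹ * ∫ ξ in a..b, f ξ := by
  rw [unif_eq, integral_smul_measure, intervalIntegral.integral_of_le hab.le,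
    integral_Icc_eq_integral_Ioc, Real.volume_Icc, ENNReal.toReal_inv,
    ENNReal.toReal_ofReal (sub_pos.2 hab).le, smul_eq_mul]

theorem integrable_unif {a b : ℝ} (hab : a < b) {E : Type*} [NormedAddCommGroup E]
    {f : ℝ → E} (hf : ContinuousOn f (Set.Icc a b)) : Integrable f (unif a b) := by
  rw [unif_eq]
  refine Integrable.smul_measure (hf.integrableOn_Icc) ?_
  simp [hab]

theorem ae_unif_mem (a b : ℝ) : ∀ᵐ ξ ∂(unif a b), ξ ∈ Set.Icc a b := by
  rw [unif_eq]
  exact Measure.ae_smul_measure (ae_restrict_mem measurableSet_Icc) _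

theorem integral_unif_comp {a b : ℝ} (hab : a < b) (g : ℝ → ℝ) :
    ∫ ξ, g ((ξ - a) / (b - a)) ∂(unif a b) = ∫ x in (0 : ℝ)..1, g x := by
  have h0 : b - a ≠ 0 := (sub_pos.2 hab).ne'
  rw [integral_unif hab]
  simp_rw [sub_div]
  rw [intervalIntegral.integral_comp_div_sub _ h0, smul_eq_mul, ← mul_assoc, inv_mul_cancel₀ h0,
    one_mul, ← sub_div, ← sub_div, sub_self, zero_div, div_self h0]

end Uniform

/-! ### Legendre polynomials -/

section Legendre

open MeasureTheory Polynomial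

/-- The shifted Legendre polynomial with real coefficients. -/
noncomputable def realShiftedLegendre (n : ℕ) : ℝ[X] :=
  (shiftedLegendre n).map (Int.castRingHom ℝ)

theorem eval_realShiftedLegendre (n : ℕ) (x : ℝ) :
    (realShiftedLegendre n).eval x = aeval x (shiftedLegendre n) := by
  rw [realShiftedLegendre, eval_map, aeval_def]
  rfl

theorem natDegree_realShiftedLegendre (n : ℕ) : (realShiftedLegendre n).natDegree = n := by
  rw [realShiftedLegendre, natDegree_map_eq_of_injective (RingHom.injective_int _),
    natDegree_shiftedLegendre]

theorem realShiftedLegendre_rodrigues (n : ℕ) :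
    (n.factorial : ℝ[X]) * realShiftedLegendre n =
      derivative^[n] (X ^ n * (1 - (X : ℝ[X])) ^ n) := by
  have := congrArg (Polynomial.map (Int.castRingHom ℝ)) (factorial_mul_shiftedLegendre_eq n)
  rw [← iterate_derivative_map] at this
  simpa [realShiftedLegendre] using this

/-- A derivative removes at most one factor X(1 - X) from the n-th power. These values are the
boundary terms when Rodrigues' formula is integrated by parts. -/
theorem eval_iterate_derivative_eq_zero {n j : ℕ} (hj : j < n) {x : ℝ} (hx : x = 0 ∨ x = 1) :
    (derivative^[j] (X ^ n * (1 - (X : ℝ[X])) ^ n)).eval x = 0 := by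
  have h : (X * (1 - X : ℝ[X])) ^ (n - j) ∣ derivative^[j] (X ^ n * (1 - (X : ℝ[X])) ^ n) := by
    rw [← mul_pow]
    exact pow_sub_dvd_iterate_derivative_pow _ _ _
  obtain ⟨u, hu⟩ := h
  have h0 : n - j ≠ 0 := by omega
  rw [hu]
  rcases hx with rfl | rfl <;> simp [h0]

theorem integral_polynomial_parts (p q : ℝ[X]) :
    ∫ x in (0 : ℝ)..1, (derivative p).eval x * q.eval x =
      p.eval 1 * q.eval 1 - p.eval 0 * q.eval 0 -
        ∫ x in (0 : ℝ)..1, p.eval x * (derivative q).eval x := by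
  have h := intervalIntegral.integral_mul_deriv_eq_deriv_mul (a := 0) (b := 1)
    (fun x _ => q.hasDerivAt x) (fun x _ => p.hasDerivAt x)
    ((derivative q).continuous.intervalIntegrable _ _)
    ((derivative p).continuous.intervalIntegrable _ _)
  simp_rw [mul_comm ((derivative p).eval _), mul_comm (p.eval _)]
  exact h

/-- By Rodrigues' formula, n integrations by parts move all derivatives onto `q`, which they
annihilate. -/
theorem integral_realShiftedLegendre_mul_eq_zero {n : ℕ} {q : ℝ[X]} (hq : q.degree < n) :
    ∫ x in (0 : ℝ)..1, (realShiftedLegendre n).eval x * q.eval x = 0 := by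
  have key : ∀ j ≤ n, ∫ x in (0 : ℝ)..1,
      (derivative^[n] (X ^ n * (1 - (X : ℝ[X])) ^ n)).eval x * q.eval x =
      (-1) ^ j * ∫ x in (0 : ℝ)..1,
        (derivative^[n - j] (X ^ n * (1 - (X : ℝ[X])) ^ n)).eval x *
          (derivative^[j] q).eval x := by
    intro j
    induction j with
    | zero => simp
    | succ j ih =>
      intro hj
      rw [ih (by omega), show n - j = (n - (j + 1)) + 1 by omega, Function.iterate_succ_apply',
        integral_polynomial_parts, eval_iterate_derivative_eq_zero (by omega) (Or.inl rfl),
        eval_iterate_derivative_eq_zero (by omega) (Or.inr rfl), Function.iterate_succ_apply']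
      ring
  have h1 := key n le_rfl
  have h2 : derivative^[n] q = 0 := by
    by_cases h0 : q = 0
    · rw [h0, iterate_derivative_zero]
    · exact iterate_derivative_eq_zero ((natDegree_lt_iff_degree_lt h0).2 hq)
  rw [h2, ← realShiftedLegendre_rodrigues] at h1
  have h3 : (n.factorial : ℝ) ≠ 0 := by positivity
  simp only [eval_mul, eval_natCast, mul_assoc, eval_zero, mul_zero,
    intervalIntegral.integral_zero, intervalIntegral.integral_const_mul, mul_eq_zero, h3,
    false_or] at h1
  exact h1

/-- The polynomial Xp' - np has degree below n, so orthogonality gives ∫ p·Xp' = n∫p². Integrating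
p'·(Xp) by parts, with p(1)² = 1, gives 2∫ p·Xp' = 1 - ∫p². -/
theorem integral_realShiftedLegendre_sq (n : ℕ) :
    ∫ x in (0 : ℝ)..1, (realShiftedLegendre n).eval x * (realShiftedLegendre n).eval x =
      1 / (2 * n + 1) := by
  set p := realShiftedLegendre n with hp
  have h1 := integral_polynomial_parts p (X * p)
  have hdeg : (X * derivative p - (n : ℝ[X]) * p).degree < (n : WithBot ℕ) := by
    rw [degree_lt_iff_coeff_zero]
    intro k hk
    rcases k with _ | k
    · have : n = 0 := by omega
      simp [this]
    · rw [coeff_sub, coeff_X_mul, coeff_derivative, ← C_eq_natCast, coeff_C_mul]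
      rcases hk.eq_or_lt with h | h
      · rw [h]; push_cast; ring
      · rw [coeff_eq_zero_of_natDegree_lt (by rw [hp, natDegree_realShiftedLegendre]; exact h)]
        ring
  have h2 := integral_realShiftedLegendre_mul_eq_zero hdeg
  rw [← hp] at h2
  have hi : ∀ q : ℝ[X], IntervalIntegrable (fun x => q.eval x) volume 0 1 :=
    fun q => q.continuous.intervalIntegrable _ _
  have e1 : ∀ x, p.eval x * (X * derivative p - (n : ℝ[X]) * p).eval x =
      (p * (X * derivative p)).eval x - n * (p * p).eval x := by
    intro x; simp; ring
  have e2 : ∀ x, (derivative p).eval x * (X * p).eval x = (p * (X * derivative p)).eval x := by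
    intro x; simp; ring
  have e3 : ∀ x, p.eval x * (derivative (X * p)).eval x =
      (p * p).eval x + (p * (X * derivative p)).eval x := by
    intro x; simp; ring
  simp_rw [e1] at h2
  simp_rw [e2, e3] at h1
  rw [intervalIntegral.integral_sub (hi _) ((hi _).const_mul _),
    intervalIntegral.integral_const_mul] at h2
  rw [intervalIntegral.integral_add (hi _) (hi _)] at h1
  have h0 : p.eval 1 * p.eval 1 = 1 := by
    have h3 : p.eval 0 = 1 := by
      rw [hp, ← coeff_zero_eq_eval_zero, realShiftedLegendre, coeff_map, coeff_shiftedLegendre]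
      simp
    have h4 : p.eval 1 = (-1) ^ n := by
      have := shiftedLegendre_eval_symm n (1 : ℝ)
      rw [sub_self, ← eval_realShiftedLegendre, ← eval_realShiftedLegendre, ← hp, h3] at this
      simpa using this
    rw [h4, ← mul_pow]; simp
  have h5 : ∀ x, p.eval x * p.eval x = (p * p).eval x := fun x => by simp
  simp_rw [h5]
  simp only [eval_mul, eval_X] at h0 h1 h2 ⊢
  rw [eq_div_iff (by positivity)]
  linarith

/-! ### Normalized Legendre polynomials on [a, b]. -/

theorem legendre_eq (a b : ℝ) (i : ℕ) (ξ : ℝ) :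
    legendre a b i ξ =
      √(2 * i + 1) * (-1) ^ i * (realShiftedLegendre i).eval ((ξ - a) / (b - a)) := by
  rw [legendre, eval_realShiftedLegendre]

theorem continuous_legendre (a b : ℝ) (i : ℕ) : Continuous (legendre a b i) := by
  have : legendre a b i = fun ξ =>
      √(2 * i + 1) * (-1) ^ i * (realShiftedLegendre i).eval ((ξ - a) / (b - a)) :=
    funext fun ξ => legendre_eq a b i ξ
  rw [this]
  exact continuous_const.mul ((realShiftedLegendre i).continuous.comp
    ((continuous_id.sub continuous_const).div_const _))

theorem integral_realShiftedLegendre_mul_of_ne {i j : ℕ} (hij : i ≠ j) :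
    ∫ x in (0 : ℝ)..1, (realShiftedLegendre i).eval x * (realShiftedLegendre j).eval x = 0 := by
  have hdeg : ∀ {i j : ℕ}, i < j → (realShiftedLegendre i).degree < j := fun {i j} h =>
    degree_le_natDegree.trans_lt (by rw [natDegree_realShiftedLegendre]; exact_mod_cast h)
  rcases hij.lt_or_gt with h | h
  · simp_rw [mul_comm ((realShiftedLegendre i).eval _)]
    exact integral_realShiftedLegendre_mul_eq_zero (hdeg h)
  · exact integral_realShiftedLegendre_mul_eq_zero (hdeg h)

/-- The normalized Legendre polynomials are orthonormal for the uniform distribution. -/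
theorem integral_legendre_mul {a b : ℝ} (hab : a < b) (i j : ℕ) :
    ∫ ξ, legendre a b i ξ * legendre a b j ξ ∂(unif a b) = if i = j then 1 else 0 := by
  simp_rw [legendre_eq]
  rw [integral_unif_comp hab fun x => √(2 * i + 1) * (-1) ^ i * (realShiftedLegendre i).eval x *
    (√(2 * j + 1) * (-1) ^ j * (realShiftedLegendre j).eval x)]
  have : ∀ x, √(2 * i + 1) * (-1) ^ i * (realShiftedLegendre i).eval x *
      (√(2 * j + 1) * (-1) ^ j * (realShiftedLegendre j).eval x) =
      (√(2 * i + 1) * (-1) ^ i * (√(2 * j + 1) * (-1) ^ j)) *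
        ((realShiftedLegendre i).eval x * (realShiftedLegendre j).eval x) := fun x => by ring
  simp_rw [this]
  rw [intervalIntegral.integral_const_mul]
  split_ifs with h
  · subst h
    rw [integral_realShiftedLegendre_sq]
    have h1 : √(2 * (i : ℝ) + 1) * √(2 * i + 1) = 2 * i + 1 :=
      Real.mul_self_sqrt (by positivity)
    have h2 : (-1 : ℝ) ^ i * (-1) ^ i = 1 := by rw [← mul_pow]; simp
    have h3 : (2 * (i : ℝ) + 1) ≠ 0 := by positivity
    rw [mul_mul_mul_comm, h1, h2, mul_one, mul_one_div, div_self h3]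
  · rw [integral_realShiftedLegendre_mul_of_ne h, mul_zero]

/-- The normalized Legendre polynomial on `[a, b]` as a polynomial. -/
noncomputable def legendrePoly (a b : ℝ) (i : ℕ) : ℝ[X] :=
  C (√(2 * i + 1) * (-1) ^ i) *
    (realShiftedLegendre i).comp (C (b - a)⁻¹ * X + C (-(b - a)⁻¹ * a))

theorem eval_legendrePoly (a b : ℝ) (i : ℕ) (ξ : ℝ) :
    (legendrePoly a b i).eval ξ = legendre a b i ξ := by
  rw [legendre_eq, legendrePoly, eval_mul, eval_C, eval_comp]
  congr 2
  simp
  ring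

theorem natDegree_legendrePoly {a b : ℝ} (hab : a < b) (i : ℕ) :
    (legendrePoly a b i).natDegree = i := by
  have h0 : (b - a)⁻¹ ≠ 0 := inv_ne_zero (sub_pos.2 hab).ne'
  have h1 : √(2 * (i : ℝ) + 1) * (-1) ^ i ≠ 0 :=
    mul_ne_zero (Real.sqrt_pos.2 (by positivity)).ne' (by simp)
  rw [legendrePoly, natDegree_C_mul h1, natDegree_comp, natDegree_realShiftedLegendre,
    natDegree_linear h0, mul_one]

theorem exists_legendre_expansion {a b : ℝ} (hab : a < b) (N : ℕ) :
    ∀ P : ℝ[X], P.natDegree ≤ N → ∃ c : ℕ → ℝ, ∀ ξ,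
      P.eval ξ = ∑ i ∈ Finset.range (N + 1), c i * legendre a b i ξ := by
  induction N with
  | zero =>
    intro P hP
    refine ⟨fun _ => P.coeff 0, fun ξ => ?_⟩
    rw [eq_C_of_natDegree_le_zero hP]
    simp [legendre, shiftedLegendre]
  | succ N ih =>
    intro P hP
    set L := legendrePoly a b (N + 1)
    have hL : L.natDegree = N + 1 := natDegree_legendrePoly hab _
    have hL0 : L.coeff (N + 1) ≠ 0 := by
      rw [← hL]
      exact leadingCoeff_ne_zero.2 fun h => by rw [h] at hL; simp at hL
    set t := P.coeff (N + 1) / L.coeff (N + 1)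
    have hdeg : (P - C t * L).natDegree ≤ N := by
      rw [natDegree_le_iff_coeff_eq_zero]
      intro k hk
      rw [coeff_sub, coeff_C_mul]
      rcases (Nat.succ_le_of_lt hk).eq_or_lt with h | h
      · rw [← h, Nat.succ_eq_add_one, div_mul_cancel₀ _ hL0, sub_self]
      · rw [coeff_eq_zero_of_natDegree_lt (hP.trans_lt h),
          coeff_eq_zero_of_natDegree_lt (hL.le.trans_lt h), mul_zero, sub_zero]
    obtain ⟨c, hc⟩ := ih _ hdeg
    refine ⟨fun i => if i = N + 1 then t else c i, fun ξ => ?_⟩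
    have := hc ξ
    rw [eval_sub, eval_mul, eval_C, eval_legendrePoly, sub_eq_iff_eq_add] at this
    rw [this, Finset.sum_range_succ _ (N + 1)]
    simp only [if_true]
    congr 1
    refine Finset.sum_congr rfl fun i hi => ?_
    rw [Finset.mem_range] at hi
    rw [if_neg (by omega)]

/-- A polynomial of degree at most `N` is its own truncated Legendre series. -/
theorem legendre_series_eq {a b : ℝ} (hab : a < b) {N : ℕ} {P : ℝ[X]} (hP : P.natDegree ≤ N)
    (ξ : ℝ) : ∑ i : Fin (N + 1), phi a b N ξ i * ∫ y, phi a b N y i * P.eval y ∂(unif a b) =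
      P.eval ξ := by
  obtain ⟨c, hc⟩ := exists_legendre_expansion hab N P hP
  have key : ∀ i : ℕ, i < N + 1 → ∫ y, legendre a b i y * P.eval y ∂(unif a b) = c i := by
    intro i hi
    simp_rw [hc, Finset.mul_sum]
    rw [integral_finsetSum]
    · have : ∀ j y, legendre a b i y * (c j * legendre a b j y) =
          c j * (legendre a b i y * legendre a b j y) := fun j y => by ring
      simp_rw [this, integral_const_mul, integral_legendre_mul hab]
      simp [hi]
    · intro j _
      exact integrable_unif hab ((continuous_legendre a b i).mul
        (continuous_const.mul (continuous_legendre a b j))).continuousOn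
  rw [hc ξ, ← Fin.sum_univ_eq_sum_range (fun i => c i * legendre a b i ξ) (N + 1)]
  refine Finset.sum_congr rfl fun i _ => ?_
  simp only [phi]
  rw [key i i.2, mul_comm]

end Legendre

end PCELQR

namespace PCELQR

/-! ### Euclidean norms of coordinate vectors -/

section Eucl

variable {ι κ : Type*} [Fintype ι] [Fintype κ]

/-- The Euclidean norm of a coordinate vector. -/
noncomputable def eucl (v : ι → ℝ) : ℝ := ‖WithLp.toLp 2 v‖

theorem eucl_nonneg (v : ι → ℝ) : 0 ≤ eucl v := norm_nonneg _

theorem eucl_sq (v : ι → ℝ) : eucl v ^ 2 = v ⬝ᵥ v := by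
  rw [eucl, EuclideanSpace.norm_sq_eq]
  simp [dotProduct, sq]

theorem eucl_sq_eq_sum (v : ι → ℝ) : eucl v ^ 2 = ∑ i, v i ^ 2 := by
  rw [eucl_sq]; simp [dotProduct, sq]

theorem eucl_sub_le (v w : ι → ℝ) : eucl (v - w) ≤ eucl v + eucl w := by
  simpa [eucl] using norm_sub_le (WithLp.toLp 2 v) (WithLp.toLp 2 w)

theorem eucl_smul (c : ℝ) (v : ι → ℝ) : eucl (c • v) = |c| * eucl v := by
  simp [eucl, norm_smul]

theorem eucl_eq_zero {v : ι → ℝ} : eucl v = 0 ↔ v = 0 := by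
  simp [eucl]

theorem eucl_pos {v : ι → ℝ} (hv : v ≠ 0) : 0 < eucl v :=
  lt_of_le_of_ne (eucl_nonneg v) fun h => hv (eucl_eq_zero.1 h.symm)

theorem abs_dotProduct_le (v w : ι → ℝ) : |v ⬝ᵥ w| ≤ eucl v * eucl w := by
  have h := abs_real_inner_le_norm (WithLp.toLp 2 w) (WithLp.toLp 2 v)
  rw [EuclideanSpace.inner_toLp_toLp] at h
  rw [mul_comm]
  simpa [eucl] using h

theorem dotProduct_le (v w : ι → ℝ) : v ⬝ᵥ w ≤ eucl v * eucl w :=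
  (le_abs_self _).trans (abs_dotProduct_le v w)

variable [DecidableEq ι]

theorem eucl_mulVec_le (M : Matrix κ ι ℝ) (v : ι → ℝ) : eucl (M *ᵥ v) ≤ ‖M‖ * eucl v :=
  Matrix.l2_opNorm_mulVec M (WithLp.toLp 2 v)

theorem opNorm_le_of_eucl {M : Matrix κ ι ℝ} {c : ℝ} (hc : 0 ≤ c)
    (h : ∀ v, eucl (M *ᵥ v) ≤ c * eucl v) : ‖M‖ ≤ c := by
  rw [Matrix.l2_opNorm_def]
  refine ContinuousLinearMap.opNorm_le_bound _ hc fun x => ?_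
  exact h x.ofLp

theorem norm_one_le : ‖(1 : Matrix ι ι ℝ)‖ ≤ 1 :=
  opNorm_le_of_eucl zero_le_one fun v => by simp

theorem norm_pow_le_pow {M : Matrix ι ι ℝ} {q : ℝ} (hM : ‖M‖ ≤ q) (k : ℕ) : ‖M ^ k‖ ≤ q ^ k := by
  have hq : 0 ≤ q := (norm_nonneg _).trans hM
  induction k with
  | zero => simpa using norm_one_le
  | succ k ih =>
    rw [pow_succ, pow_succ]
    exact (Matrix.l2_opNorm_mul _ _).trans (by gcongr)

/-- A bilinear form bound implies an operator norm bound. -/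
theorem opNorm_le_of_dotProduct {M : Matrix ι ι ℝ} {c : ℝ} (hc : 0 ≤ c)
    (h : ∀ w v, w ⬝ᵥ (M *ᵥ v) ≤ c / 2 * (eucl w ^ 2 + eucl v ^ 2)) : ‖M‖ ≤ c := by
  refine opNorm_le_of_eucl hc fun v => ?_
  by_cases hu : M *ᵥ v = 0
  · rw [hu, eucl_eq_zero.2 rfl]
    exact mul_nonneg hc (eucl_nonneg v)
  · have hpos := eucl_pos hu
    -- Rescaling M v to the length of v makes the arithmetic mean of the squares equal to the
    -- product of the lengths.
    have h1 := h ((eucl v / eucl (M *ᵥ v)) • (M *ᵥ v)) v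
    rw [smul_dotProduct, smul_eq_mul, ← eucl_sq, eucl_smul,
      abs_of_nonneg (div_nonneg (eucl_nonneg v) hpos.le), div_mul_cancel₀ _ hpos.ne'] at h1
    by_cases hv : eucl v = 0
    · rw [eucl_eq_zero.1 hv, Matrix.mulVec_zero] at hu
      exact absurd rfl hu
    · have hv' : 0 < eucl v := lt_of_le_of_ne (eucl_nonneg v) (Ne.symm hv)
      have h2 : eucl v / eucl (M *ᵥ v) * eucl (M *ᵥ v) ^ 2 = eucl v * eucl (M *ᵥ v) := by
        field_simp
      rw [h2] at h1
      refine le_of_mul_le_mul_left ?_ hv'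
      linarith

end Eucl

/-! ### The Galerkin projection -/

section Galerkin

open MeasureTheory

variable {n k l : ℕ} {a b : ℝ}

theorem continuous_phi (a b : ℝ) (N : ℕ) (i : Fin (N + 1)) : Continuous fun ξ => phi a b N ξ i :=
  continuous_legendre a b i

/-- The function of the parameter with block coefficients `z` in the Legendre basis. -/
noncomputable def expand (a b : ℝ) (N : ℕ) (z : Fin (N + 1) × Fin n → ℝ) (ξ : ℝ) : Fin n → ℝ :=
  fun j => ∑ i : Fin (N + 1), z (i, j) * phi a b N ξ i

theorem continuous_expand (a b : ℝ) (N : ℕ) (z : Fin (N + 1) × Fin n → ℝ) :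
    Continuous (expand a b N z) := by
  refine continuous_pi fun j => ?_
  exact continuous_finsetSum _ fun i _ => continuous_const.mul (continuous_phi a b N i)

theorem integral_expand_dotProduct (hab : a < b) (N : ℕ) (w : Fin (N + 1) × Fin n → ℝ)
    {g : ℝ → Fin n → ℝ} (hg : ContinuousOn g (Set.Icc a b)) :
    ∫ ξ, expand a b N w ξ ⬝ᵥ g ξ ∂(unif a b) =
      ∑ i, w i * ∫ ξ, phi a b N ξ i.1 * g ξ i.2 ∂(unif a b) := by
  have hint : ∀ i : Fin (N + 1) × Fin n,
      Integrable (fun ξ => w i * (phi a b N ξ i.1 * g ξ i.2)) (unif a b) := fun i =>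
    (integrable_unif hab ((continuous_phi a b N i.1).continuousOn.mul
      ((continuous_apply i.2).comp_continuousOn hg))).const_mul _
  simp_rw [← integral_const_mul]
  rw [← integral_finsetSum _ fun i _ => hint i]
  refine integral_congr_ae (Filter.Eventually.of_forall fun ξ => ?_)
  simp only [dotProduct, expand, Finset.sum_mul]
  rw [Fintype.sum_prod_type_right]
  exact Finset.sum_congr rfl fun j _ => Finset.sum_congr rfl fun i _ => by ring

theorem integral_phi_mul_expand (hab : a < b) (N : ℕ) (z : Fin (N + 1) × Fin n → ℝ)
    (i : Fin (N + 1)) (j : Fin n) :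
    ∫ ξ, phi a b N ξ i * expand a b N z ξ j ∂(unif a b) = z (i, j) := by
  simp_rw [expand, Finset.mul_sum]
  rw [integral_finsetSum]
  · have : ∀ (i' : Fin (N + 1)) ξ, phi a b N ξ i * (z (i', j) * phi a b N ξ i') =
        z (i', j) * (legendre a b i ξ * legendre a b i' ξ) := fun i' ξ => by
      simp only [phi]; ring
    simp_rw [this, integral_const_mul, integral_legendre_mul hab]
    simp [Fin.val_inj]
  · intro i' _
    exact integrable_unif hab ((continuous_phi a b N i).mul
      (continuous_const.mul (continuous_phi a b N i'))).continuousOn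

/-- Parseval's identity for the truncated Legendre expansion. -/
theorem integral_eucl_expand_sq (hab : a < b) (N : ℕ) (z : Fin (N + 1) × Fin n → ℝ) :
    ∫ ξ, eucl (expand a b N z ξ) ^ 2 ∂(unif a b) = eucl z ^ 2 := by
  simp_rw [eucl_sq]
  rw [integral_expand_dotProduct hab N z (continuous_expand a b N z).continuousOn]
  simp_rw [integral_phi_mul_expand hab]
  rfl

theorem continuous_eucl {ι : Type*} [Fintype ι] : Continuous (eucl : (ι → ℝ) → ℝ) :=
  continuous_norm.comp (PiLp.continuous_toLp 2 _)

theorem lift_apply (N : ℕ) (F : ℝ → Matrix (Fin n) (Fin k) ℝ) (i : Fin (N + 1) × Fin n)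
    (j : Fin (N + 1) × Fin k) :
    lift a b N F i j = ∫ ξ, phi a b N ξ i.1 * phi a b N ξ j.1 * F ξ i.2 j.2 ∂(unif a b) := rfl

theorem continuousOn_entry {F : ℝ → Matrix (Fin n) (Fin k) ℝ} {s : Set ℝ}
    (hF : ContinuousOn F s) (i : Fin n) (j : Fin k) : ContinuousOn (fun ξ => F ξ i j) s :=
  (continuous_id.matrix_elem i j).comp_continuousOn hF

theorem continuousOn_mulVec {F : ℝ → Matrix (Fin n) (Fin k) ℝ} {g : ℝ → Fin k → ℝ} {s : Set ℝ}
    (hF : ContinuousOn F s) (hg : ContinuousOn g s) : ContinuousOn (fun ξ => F ξ *ᵥ g ξ) s :=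
  (Continuous.matrix_mulVec (A := fun p : Matrix (Fin n) (Fin k) ℝ × (Fin k → ℝ) => p.1)
    continuous_fst continuous_snd).comp_continuousOn (hF.prodMk hg)

theorem integrable_lift_entry (hab : a < b) (N : ℕ) {F : ℝ → Matrix (Fin n) (Fin k) ℝ}
    (hF : ContinuousOn F (Set.Icc a b)) (i j : Fin (N + 1)) (p : Fin n) (q : Fin k) :
    Integrable (fun ξ => phi a b N ξ i * phi a b N ξ j * F ξ p q) (unif a b) :=
  integrable_unif hab (((continuous_phi a b N i).mul (continuous_phi a b N j)).continuousOn.mul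
    (continuousOn_entry hF p q))

theorem lift_mulVec (hab : a < b) (N : ℕ) {F : ℝ → Matrix (Fin n) (Fin k) ℝ}
    (hF : ContinuousOn F (Set.Icc a b)) (z : Fin (N + 1) × Fin k → ℝ) (i : Fin (N + 1) × Fin n) :
    (lift a b N F *ᵥ z) i =
      ∫ ξ, phi a b N ξ i.1 * (F ξ *ᵥ expand a b N z ξ) i.2 ∂(unif a b) := by
  simp only [Matrix.mulVec, dotProduct, lift_apply, expand]
  simp_rw [← integral_mul_const]
  rw [← integral_finsetSum _ fun j _ => (integrable_lift_entry hab N hF _ _ _ _).mul_const _]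
  refine integral_congr_ae (Filter.Eventually.of_forall fun ξ => ?_)
  simp only [Finset.mul_sum]
  rw [Fintype.sum_prod_type_right]
  exact Finset.sum_congr rfl fun j _ => Finset.sum_congr rfl fun i _ => by ring

/-- In the orthonormal Legendre basis, the lift is the compression of multiplication by F to
polynomials of degree at most N; its norm is estimated through this form. -/
theorem dotProduct_lift_mulVec (hab : a < b) (N : ℕ) {F : ℝ → Matrix (Fin n) (Fin k) ℝ}
    (hF : ContinuousOn F (Set.Icc a b)) (w : Fin (N + 1) × Fin n → ℝ)
    (z : Fin (N + 1) × Fin k → ℝ) :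
    w ⬝ᵥ (lift a b N F *ᵥ z) =
      ∫ ξ, expand a b N w ξ ⬝ᵥ (F ξ *ᵥ expand a b N z ξ) ∂(unif a b) := by
  rw [integral_expand_dotProduct hab N w
    (continuousOn_mulVec hF (continuous_expand a b N z).continuousOn)]
  exact Finset.sum_congr rfl fun i _ => by rw [lift_mulVec hab N hF]

/-- The Galerkin projection does not increase the supremum of the spectral norm. -/
theorem norm_lift_le (hab : a < b) (N : ℕ) {F : ℝ → Matrix (Fin n) (Fin n) ℝ}
    (hF : ContinuousOn F (Set.Icc a b)) {c : ℝ} (hc : ∀ ξ ∈ Set.Icc a b, ‖F ξ‖ ≤ c) :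
    ‖lift a b N F‖ ≤ c := by
  have hc0 : 0 ≤ c := (norm_nonneg _).trans (hc a ⟨le_rfl, hab.le⟩)
  refine opNorm_le_of_dotProduct hc0 fun w z => ?_
  rw [dotProduct_lift_mulVec hab N hF]
  have hi : ∀ v : Fin (N + 1) × Fin n → ℝ,
      Integrable (fun ξ => eucl (expand a b N v ξ) ^ 2) (unif a b) := fun v =>
    integrable_unif hab ((continuous_eucl.comp (continuous_expand a b N v)).pow 2).continuousOn
  -- The product of norms is split pointwise into squares, so that Parseval evaluates each mean
  -- exactly and no Cauchy–Schwarz inequality in L² is needed.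
  have hle : ∫ ξ, expand a b N w ξ ⬝ᵥ (F ξ *ᵥ expand a b N z ξ) ∂(unif a b) ≤
      ∫ ξ, c / 2 * (eucl (expand a b N w ξ) ^ 2 + eucl (expand a b N z ξ) ^ 2) ∂(unif a b) := by
    refine integral_mono_ae ?_ (((hi w).add (hi z)).const_mul _) ?_
    · refine integrable_unif hab ?_
      exact (Continuous.dotProduct (A := fun p : (Fin n → ℝ) × (Fin n → ℝ) => p.1)
        continuous_fst continuous_snd).comp_continuousOn
        ((continuous_expand a b N w).continuousOn.prodMk
        (continuousOn_mulVec hF (continuous_expand a b N z).continuousOn))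
    · filter_upwards [ae_unif_mem a b] with ξ hξ
      have h1 := dotProduct_le (expand a b N w ξ) (F ξ *ᵥ expand a b N z ξ)
      have h2 : eucl (F ξ *ᵥ expand a b N z ξ) ≤ c * eucl (expand a b N z ξ) :=
        (eucl_mulVec_le _ _).trans (mul_le_mul_of_nonneg_right (hc ξ hξ) (eucl_nonneg _))
      have h3 := mul_le_mul_of_nonneg_left h2 (eucl_nonneg (expand a b N w ξ))
      nlinarith [mul_nonneg hc0 (sq_nonneg (eucl (expand a b N w ξ) - eucl (expand a b N z ξ)))]
  refine hle.trans_eq ?_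
  rw [integral_const_mul, integral_add (hi w) (hi z), integral_eucl_expand_sq hab,
    integral_eucl_expand_sq hab]

theorem lift_sub (hab : a < b) (N : ℕ) {F G : ℝ → Matrix (Fin n) (Fin k) ℝ}
    (hF : ContinuousOn F (Set.Icc a b)) (hG : ContinuousOn G (Set.Icc a b)) :
    lift a b N (fun ξ => F ξ - G ξ) = lift a b N F - lift a b N G := by
  ext i j
  rw [Matrix.sub_apply, lift_apply, lift_apply, lift_apply,
    ← integral_sub (integrable_lift_entry hab N hF _ _ _ _)
      (integrable_lift_entry hab N hG _ _ _ _)]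
  simp only [Matrix.sub_apply, mul_sub]

theorem lift_add (hab : a < b) (N : ℕ) {F G : ℝ → Matrix (Fin n) (Fin k) ℝ}
    (hF : ContinuousOn F (Set.Icc a b)) (hG : ContinuousOn G (Set.Icc a b)) :
    lift a b N (fun ξ => F ξ + G ξ) = lift a b N F + lift a b N G := by
  ext i j
  rw [Matrix.add_apply, lift_apply, lift_apply, lift_apply,
    ← integral_add (integrable_lift_entry hab N hF _ _ _ _)
      (integrable_lift_entry hab N hG _ _ _ _)]
  simp only [Matrix.add_apply, mul_add]

theorem lift_smul (N : ℕ) (c : ℝ) (F : ℝ → Matrix (Fin n) (Fin k) ℝ) :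
    lift a b N (fun ξ => c • F ξ) = c • lift a b N F := by
  ext i j
  rw [Matrix.smul_apply, lift_apply, lift_apply, smul_eq_mul, ← integral_const_mul]
  simp only [Matrix.smul_apply, smul_eq_mul, mul_left_comm]

theorem lift_one (hab : a < b) (N : ℕ) :
    lift a b N (fun _ => (1 : Matrix (Fin n) (Fin n) ℝ)) = 1 := by
  ext i j
  rw [lift_apply]
  simp only [phi]
  rw [integral_mul_const, integral_legendre_mul hab, Matrix.one_apply, Matrix.one_apply]
  by_cases h1 : i.1 = j.1 <;> by_cases h2 : i.2 = j.2 <;> simp [h1, h2, Fin.val_inj, Prod.ext_iff]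

/-- Compression is not multiplicative in general, but a constant factor preserves the polynomial
subspace and acts blockwise. This and its left-hand analogue let one constant T conjugate the whole
surrogate. -/
theorem lift_mul_const (hab : a < b) (N : ℕ) {F : ℝ → Matrix (Fin n) (Fin k) ℝ}
    (hF : ContinuousOn F (Set.Icc a b)) (K : Matrix (Fin k) (Fin l) ℝ) :
    lift a b N (fun ξ => F ξ * K) =
      lift a b N F * ((1 : Matrix (Fin (N + 1)) (Fin (N + 1)) ℝ) ⊗ₖ K) := by
  ext i j
  rw [Matrix.mul_apply, Fintype.sum_prod_type]
  simp only [lift_apply, Matrix.kroneckerMap_apply, Matrix.one_apply, ite_mul, one_mul, zero_mul,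
    mul_ite, mul_zero]
  rw [Finset.sum_comm]
  simp only [Finset.sum_ite_eq', Finset.mem_univ, if_true, Matrix.mul_apply, Finset.mul_sum]
  rw [integral_finsetSum]
  · exact Finset.sum_congr rfl fun p _ => by rw [← integral_mul_const]; simp only [mul_assoc]
  · intro p _
    simpa only [mul_assoc] using (integrable_lift_entry hab N hF i.1 j.1 i.2 p).mul_const (K p j.2)

theorem lift_const_mul (hab : a < b) (N : ℕ) {F : ℝ → Matrix (Fin n) (Fin k) ℝ}
    (hF : ContinuousOn F (Set.Icc a b)) (K : Matrix (Fin l) (Fin n) ℝ) :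
    lift a b N (fun ξ => K * F ξ) =
      ((1 : Matrix (Fin (N + 1)) (Fin (N + 1)) ℝ) ⊗ₖ K) * lift a b N F := by
  ext i j
  rw [Matrix.mul_apply, Fintype.sum_prod_type]
  simp only [lift_apply, Matrix.kroneckerMap_apply, Matrix.one_apply, ite_mul, one_mul, zero_mul]
  rw [Finset.sum_comm]
  simp only [Finset.sum_ite_eq, Finset.mem_univ, if_true, Matrix.mul_apply, Finset.mul_sum]
  rw [integral_finsetSum]
  · exact Finset.sum_congr rfl fun p _ => by
      rw [← integral_const_mul]; simp only [mul_left_comm]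
  · intro p _
    simpa only [mul_left_comm] using
      (integrable_lift_entry hab N hF i.1 j.1 p j.2).const_mul (K i.2 p)

theorem surrogateClosedLoop_eq_lift {m : ℕ} (hab : a < b) (N : ℕ)
    {A : ℝ → Matrix (Fin n) (Fin n) ℝ} {B : ℝ → Matrix (Fin n) (Fin m) ℝ}
    (hA : ContinuousOn A (Set.Icc a b)) (hB : ContinuousOn B (Set.Icc a b))
    (K : Matrix (Fin m) (Fin n) ℝ) :
    surrogateClosedLoop a b A B N K = lift a b N fun ξ => closedLoop (A ξ) (B ξ) K := by
  simp only [surrogateClosedLoop, closedLoop]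
  rw [← lift_mul_const hab N hB, ← lift_sub hab N hA]
  exact (continuous_id.matrix_mul continuous_const).comp_continuousOn hB

/-! ### Polynomial data -/

/-- A function that is a polynomial of degree at most `d`. -/
def IsPolyLE (d : ℕ) (f : ℝ → ℝ) : Prop :=
  ∃ P : Polynomial ℝ, P.natDegree ≤ d ∧ ∀ ξ, f ξ = P.eval ξ

theorem IsPolyLE.const (c : ℝ) (d : ℕ) : IsPolyLE d fun _ => c :=
  ⟨Polynomial.C c, by simp, fun ξ => by simp⟩

theorem IsPolyLE.mul {d e : ℕ} {f g : ℝ → ℝ} (hf : IsPolyLE d f) (hg : IsPolyLE e g) :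
    IsPolyLE (d + e) fun ξ => f ξ * g ξ := by
  obtain ⟨P, hP, hf⟩ := hf
  obtain ⟨Q, hQ, hg⟩ := hg
  exact ⟨P * Q, Polynomial.natDegree_mul_le_of_le hP hQ, fun ξ => by simp [hf, hg]⟩

theorem IsPolyLE.sum {ι : Type*} (s : Finset ι) {d : ℕ} {f : ι → ℝ → ℝ}
    (hf : ∀ i, IsPolyLE d (f i)) : IsPolyLE d fun ξ => ∑ i ∈ s, f i ξ := by
  choose P hP hf using hf
  exact ⟨∑ i ∈ s, P i, Polynomial.natDegree_sum_le_of_forall_le _ _ fun i _ => hP i,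
    fun ξ => by simp [hf, Polynomial.eval_finsetSum]⟩

theorem IsPolyLE.continuous {d : ℕ} {f : ℝ → ℝ} (hf : IsPolyLE d f) : Continuous f := by
  obtain ⟨P, -, hf⟩ := hf
  rw [funext hf]
  exact P.continuous

theorem expand_eq_of_isPolyLE (hab : a < b) {N : ℕ} {g : ℝ → Fin n → ℝ}
    (hg : ∀ j, IsPolyLE N fun ξ => g ξ j) {z : Fin (N + 1) × Fin n → ℝ}
    (hz : ∀ i, z i = ∫ ξ, phi a b N ξ i.1 * g ξ i.2 ∂(unif a b)) (ξ : ℝ) :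
    expand a b N z ξ = g ξ := by
  funext j
  obtain ⟨P, hP, hgP⟩ := hg j
  simp only [expand, hz, hgP]
  rw [← legendre_series_eq hab hP]
  exact Finset.sum_congr rfl fun i _ => mul_comm _ _

theorem phi_zero (N : ℕ) (ξ : ℝ) : phi a b N ξ 0 = 1 := by
  simp [phi, legendre, Polynomial.shiftedLegendre]

theorem expand_surrogateInit (N : ℕ) (v : Fin n → ℝ) (ξ : ℝ) :
    expand a b N (surrogateInit N v) ξ = v := by
  funext j
  simp [expand, surrogateInit, phi_zero]

theorem isPolyLE_pow_mulVec {d : ℕ} {F : ℝ → Matrix (Fin n) (Fin n) ℝ}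
    (hF : ∀ p q, IsPolyLE d fun ξ => F ξ p q) (v : Fin n → ℝ) (r : ℕ) :
    ∀ j, IsPolyLE (r * d) fun ξ => (F ξ ^ r *ᵥ v) j := by
  induction r with
  | zero => intro j; simpa using IsPolyLE.const (v j) 0
  | succ r ih =>
    intro j
    have : (fun ξ => (F ξ ^ (r + 1) *ᵥ v) j) =
        fun ξ => ∑ p, F ξ j p * (F ξ ^ r *ᵥ v) p := by
      funext ξ
      rw [pow_succ', ← Matrix.mulVec_mulVec]
      rfl
    rw [this, show (r + 1) * d = d + r * d by ring]
    exact IsPolyLE.sum _ fun p => (hF j p).mul (ih p)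

theorem continuous_of_isPolyLE {d : ℕ} {F : ℝ → Matrix (Fin n) (Fin k) ℝ}
    (hF : ∀ p q, IsPolyLE d fun ξ => F ξ p q) : Continuous F :=
  continuous_matrix fun p q => (hF p q).continuous

/-- For polynomial data the Galerkin iterates are exact as long as their degree is at most `N`. -/
theorem expand_lift_pow (hab : a < b) {N d : ℕ} {F : ℝ → Matrix (Fin n) (Fin n) ℝ}
    (hF : ∀ p q, IsPolyLE d fun ξ => F ξ p q) (v : Fin n → ℝ) (r : ℕ) (hr : r * d ≤ N) (ξ : ℝ) :
    expand a b N (lift a b N F ^ r *ᵥ surrogateInit N v) ξ = F ξ ^ r *ᵥ v := by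
  induction r generalizing ξ with
  | zero => simpa using expand_surrogateInit N v ξ
  | succ r ih =>
    have hr' : r * d ≤ N := le_trans (by gcongr; omega) hr
    refine expand_eq_of_isPolyLE hab (g := fun ξ => F ξ ^ (r + 1) *ᵥ v) (fun j => ?_) (fun i => ?_) ξ
    · obtain ⟨P, hP, h⟩ := isPolyLE_pow_mulVec hF v (r + 1) j
      exact ⟨P, hP.trans hr, h⟩
    · rw [pow_succ', ← Matrix.mulVec_mulVec,
        lift_mulVec hab N (continuous_of_isPolyLE hF).continuousOn]
      refine integral_congr_ae (Filter.Eventually.of_forall fun y => ?_)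
      simp only [ih hr', Matrix.mulVec_mulVec, ← pow_succ']

end Galerkin

end PCELQR

namespace PCELQR

/-! ### Exponentials of contractions -/

section Exponential

variable {ι : Type*} [Fintype ι] [DecidableEq ι]

theorem hasSum_exp_matrix (X : Matrix ι ι ℝ) :
    HasSum (fun k : ℕ => (k.factorial : ℝ)⁻¹ • X ^ k) (NormedSpace.exp X) :=
  NormedSpace.exp_series_hasSum_exp' (𝕂 := ℝ) X

/-- The part of the exponential series of `τ S` with powers in `s`. -/
noncomputable def expPart (s : Finset ℕ) (τ : ℝ) (S : Matrix ι ι ℝ) : Matrix ι ι ℝ :=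
  ∑ k ∈ s, (τ ^ k / k.factorial) • S ^ k

/-- The series are compared term by term: powers in `s` against those of S', the others against
zero. The majorant c(τr)^k/k! sums to c exp(τr), which for r < 1 is beaten by the factor exp(-τ) of
the Euler representation. -/
theorem norm_exp_sub_expPart_le {S S' : Matrix ι ι ℝ} {s : Finset ℕ} {c r τ : ℝ} (hτ : 0 ≤ τ)
    (h₁ : ∀ k ∈ s, ‖S ^ k - S' ^ k‖ ≤ c * r ^ k) (h₂ : ∀ k ∉ s, ‖S ^ k‖ ≤ c * r ^ k) :
    ‖NormedSpace.exp (τ • S) - expPart s τ S'‖ ≤ c * Real.exp (τ * r) := by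
  have hs := hasSum_exp_matrix (τ • S)
  have hp : HasSum (fun k => if k ∈ s then (τ ^ k / k.factorial : ℝ) • S' ^ k else 0)
      (expPart s τ S') := by
    have h := hasSum_sum_of_ne_finset_zero (s := s) (L := SummationFilter.unconditional ℕ)
      (f := fun k => if k ∈ s then (τ ^ k / k.factorial : ℝ) • S' ^ k else 0)
      (fun k hk => by simp [hk])
    rwa [Finset.sum_congr rfl fun k hk => if_pos hk] at h
  have he : HasSum (fun k : ℕ => c * ((τ * r) ^ k / k.factorial)) (c * Real.exp (τ * r)) := by
    rw [Real.exp_eq_exp_ℝ]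
    exact (NormedSpace.expSeries_div_hasSum_exp (τ * r)).mul_left c
  refine (hs.sub hp).norm_le_of_bounded he fun k => ?_
  have e1 : ((k.factorial : ℝ)⁻¹ • (τ • S) ^ k) = (τ ^ k / k.factorial : ℝ) • S ^ k := by
    rw [smul_pow, smul_smul]; ring_nf
  have h0 : 0 ≤ τ ^ k / k.factorial := by positivity
  have e2 : c * ((τ * r) ^ k / k.factorial) = τ ^ k / k.factorial * (c * r ^ k) := by
    rw [mul_pow]; ring
  rw [e1, e2]
  split_ifs with hk
  · rw [← smul_sub, norm_smul, Real.norm_of_nonneg h0]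
    exact mul_le_mul_of_nonneg_left (h₁ k hk) h0
  · rw [sub_zero, norm_smul, Real.norm_of_nonneg h0]
    exact mul_le_mul_of_nonneg_left (h₂ k hk) h0

theorem norm_exp_smul_le {S : Matrix ι ι ℝ} {q τ : ℝ} (hτ : 0 ≤ τ) (hS : ‖S‖ ≤ q) :
    ‖NormedSpace.exp (τ • S)‖ ≤ Real.exp (τ * q) := by
  have := norm_exp_sub_expPart_le (S := S) (S' := S) (s := ∅) (c := 1) (r := q) hτ (by simp)
    (fun k _ => by simpa using norm_pow_le_pow hS k)
  simpa [expPart] using this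

/-- Telescoping would give k q^(k-1) δ; the extra factor q on the left avoids the exponent k - 1. -/
theorem norm_pow_sub_pow_le {S S' : Matrix ι ι ℝ} {q δ : ℝ} (hS : ‖S‖ ≤ q) (hS' : ‖S'‖ ≤ q)
    (hδ : ‖S - S'‖ ≤ δ) (k : ℕ) : q * ‖S ^ k - S' ^ k‖ ≤ k * q ^ k * δ := by
  have hq : 0 ≤ q := (norm_nonneg _).trans hS
  have hδ0 : 0 ≤ δ := (norm_nonneg _).trans hδ
  induction k with
  | zero => simp
  | succ k ih =>
    have e : S ^ (k + 1) - S' ^ (k + 1) = S * (S ^ k - S' ^ k) + (S - S') * S' ^ k := by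
      rw [pow_succ', pow_succ', mul_sub, sub_mul]; abel
    have h1 : ‖S * (S ^ k - S' ^ k)‖ ≤ q * ‖S ^ k - S' ^ k‖ :=
      (Matrix.l2_opNorm_mul _ _).trans (by gcongr)
    have h2 : ‖(S - S') * S' ^ k‖ ≤ δ * q ^ k :=
      (Matrix.l2_opNorm_mul _ _).trans (mul_le_mul hδ (norm_pow_le_pow hS' k) (norm_nonneg _) hδ0)
    calc q * ‖S ^ (k + 1) - S' ^ (k + 1)‖
        ≤ q * (q * ‖S ^ k - S' ^ k‖ + δ * q ^ k) := by
          rw [e]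
          exact mul_le_mul_of_nonneg_left ((norm_add_le _ _).trans (add_le_add h1 h2)) hq
      _ ≤ q * (k * q ^ k * δ + δ * q ^ k) := by gcongr
      _ = ((k + 1 : ℕ) : ℝ) * q ^ (k + 1) * δ := by push_cast; ring

/-- Exponentials of uniform contractions are approximated by truncated exponential series of
nearby contractions, with an error that decays relative to `exp τ`. -/
theorem exists_norm_exp_sub_expPart_le {q : ℝ} (hq0 : 0 < q) (hq1 : q < 1) :
    ∃ r : ℝ, q ≤ r ∧ r < 1 ∧ ∃ C : ℝ, 0 ≤ C ∧
      ∀ {ι : Type} [Fintype ι] [DecidableEq ι] {S S' : Matrix ι ι ℝ} {δ τ : ℝ} (m : ℕ),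
        0 ≤ τ → ‖S‖ ≤ q → ‖S'‖ ≤ q → ‖S - S'‖ ≤ δ →
        ‖NormedSpace.exp (τ • S) - expPart (Finset.range (m + 1)) τ S'‖ ≤
          C * (δ + r ^ m) * Real.exp (τ * r) := by
  -- With q^k = r^k · r^k, one factor absorbs the multiplier k of the retained terms, or yields r^m
  -- in the discarded ones; the other stays as the geometric majorant.
  set r := √q
  have hr0 : 0 < r := Real.sqrt_pos.2 hq0
  have hrr : r * r = q := Real.mul_self_sqrt hq0.le
  have hr1 : r < 1 := by rw [Real.sqrt_lt' one_pos]; simpa using hq1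
  have hqr : q ≤ r := by rw [← hrr]; exact mul_le_of_le_one_left hr0.le hr1.le
  obtain ⟨C, hC⟩ := (tendsto_self_mul_const_pow_of_lt_one hr0.le hr1).bddAbove_range
  have hC' : ∀ k : ℕ, (k : ℝ) * r ^ k ≤ C := fun k => hC ⟨k, rfl⟩
  have hC0 : 0 ≤ C := by simpa using hC' 0
  refine ⟨r, hqr, hr1, C / q + 1, by positivity, fun {ι} _ _ S S' δ τ m hτ hS hS' hδ => ?_⟩
  have hδ0 : 0 ≤ δ := (norm_nonneg _).trans hδ
  have hqk : ∀ k : ℕ, q ^ k = r ^ k * r ^ k := fun k => by rw [← mul_pow, hrr]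
  refine norm_exp_sub_expPart_le hτ (fun k _ => ?_) (fun k hk => ?_)
  · have h1 := norm_pow_sub_pow_le hS hS' hδ k
    have h2 : q * ‖S ^ k - S' ^ k‖ ≤ C * r ^ k * δ := by
      refine h1.trans ?_
      rw [hqk, ← mul_assoc]
      gcongr
      exact hC' k
    have h3 : ‖S ^ k - S' ^ k‖ ≤ C / q * δ * r ^ k := by
      rw [← mul_le_mul_iff_right₀ hq0]
      refine h2.trans_eq ?_
      field_simp
    refine h3.trans ?_
    gcongr
    · linarith
    · have := pow_pos hr0 m; linarith
  · rw [Finset.mem_range, not_lt] at hk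
    refine (norm_pow_le_pow hS k).trans ?_
    rw [hqk]
    have h1 : r ^ k ≤ r ^ m := pow_le_pow_of_le_one hr0.le hr1.le (by omega)
    have h2 : r ^ m ≤ (C / q + 1) * (δ + r ^ m) := by
      have := pow_pos hr0 m
      have h3 : 0 ≤ C / q := by positivity
      nlinarith [mul_nonneg h3 (add_nonneg hδ0 this.le)]
    exact mul_le_mul_of_nonneg_right (h1.trans h2) (pow_nonneg hr0.le k)

/-- The exponential of `t M` in terms of the conjugated Euler step `T (1 + η M) T⁻¹`. -/
theorem exp_smul_eq {M T Ti : Matrix ι ι ℝ} (h₁ : T * Ti = 1) (h₂ : Ti * T = 1) {η : ℝ}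
    (hη : η ≠ 0) (t : ℝ) :
    NormedSpace.exp (t • M) = Real.exp (-(t / η)) •
      (Ti * NormedSpace.exp ((t / η) • (T * (1 + η • M) * Ti)) * T) := by
  let U : (Matrix ι ι ℝ)ˣ := ⟨T, Ti, h₁, h₂⟩
  have e1 : (t / η) • (T * (1 + η • M) * Ti) =
      (U : Matrix ι ι ℝ) * ((t / η) • (1 : Matrix ι ι ℝ) + t • M) * ((U⁻¹ : (Matrix ι ι ℝ)ˣ) : Matrix ι ι ℝ) := by
    change _ = T * ((t / η) • (1 : Matrix ι ι ℝ) + t • M) * Ti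
    have : (t / η) • (1 : Matrix ι ι ℝ) + t • M = (t / η) • (1 + η • M) := by
      rw [smul_add, smul_smul, div_mul_cancel₀ _ hη]
    rw [this, Matrix.mul_smul, Matrix.smul_mul]
  have hone : NormedSpace.exp ((t / η) • (1 : Matrix ι ι ℝ)) = Real.exp (t / η) • 1 := by
    have := NormedSpace.algebraMap_exp_comm (𝕂 := ℝ) (𝔸 := Matrix ι ι ℝ) (t / η)
    rw [← Real.exp_eq_exp_ℝ, Algebra.algebraMap_eq_smul_one, Algebra.algebraMap_eq_smul_one] at this
    exact this.symm
  rw [e1, Matrix.exp_units_conj,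
    Matrix.exp_add_of_commute _ _ ((Commute.one_left _).smul_left _), hone]
  change _ = Real.exp (-(t / η)) • (Ti * (T * (Real.exp (t / η) • 1 * NormedSpace.exp (t • M)) * Ti) * T)
  have e2 : Ti * (T * (Real.exp (t / η) • (1 : Matrix ι ι ℝ) * NormedSpace.exp (t • M)) * Ti) * T =
      Real.exp (t / η) • NormedSpace.exp (t • M) := by
    rw [Matrix.smul_mul, one_mul, ← mul_assoc, ← mul_assoc, h₂, one_mul, mul_assoc, h₂, mul_one]
  rw [e2, smul_smul, ← Real.exp_add, neg_add_cancel, Real.exp_zero, one_smul]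

theorem continuous_exp_smul (M : Matrix ι ι ℝ) :
    Continuous fun t : ℝ => NormedSpace.exp (t • M) :=
  continuous_iff_continuousAt.2 fun t => (hasDerivAt_exp_smul_const (𝕂 := ℝ) M t).continuousAt

/-- The factors exp(-t/η) and exp(qt/η) combine, so the contraction factor q of the Euler step
becomes the decay rate (1 - q)/η. -/
theorem eucl_flow_le {M T Ti : Matrix ι ι ℝ} (h₁ : T * Ti = 1) (h₂ : Ti * T = 1) {η q : ℝ}
    (hη : 0 < η) (hq : ‖T * (1 + η • M) * Ti‖ ≤ q) {t : ℝ} (ht : 0 ≤ t) (v : ι → ℝ) :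
    eucl (flow M t v) ≤ ‖Ti‖ * ‖T‖ * Real.exp (-((1 - q) / η) * t) * eucl v := by
  rw [flow, exp_smul_eq h₁ h₂ hη.ne']
  refine (eucl_mulVec_le _ _).trans ?_
  have h0 : 0 ≤ t / η := div_nonneg ht hη.le
  refine mul_le_mul_of_nonneg_right ?_ (eucl_nonneg v)
  rw [norm_smul, Real.norm_of_nonneg (Real.exp_pos _).le]
  have h3 : ‖Ti * NormedSpace.exp ((t / η) • (T * (1 + η • M) * Ti)) * T‖ ≤
      ‖Ti‖ * Real.exp (t / η * q) * ‖T‖ := by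
    refine (Matrix.l2_opNorm_mul _ _).trans ?_
    gcongr
    refine (Matrix.l2_opNorm_mul _ _).trans ?_
    gcongr
    exact norm_exp_smul_le h0 hq
  calc _ ≤ Real.exp (-(t / η)) * (‖Ti‖ * Real.exp (t / η * q) * ‖T‖) := by gcongr
    _ = ‖Ti‖ * ‖T‖ * (Real.exp (-(t / η)) * Real.exp (t / η * q)) := by ring
    _ = _ := by
      rw [← Real.exp_add]
      congr 2
      field_simp
      ring

/-- A matrix whose Euler step is similar to a strict contraction is Hurwitz. -/
theorem isHurwitz_of_norm_lt_one {M T Ti : Matrix ι ι ℝ} (h₂ : Ti * T = 1)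
    {η q : ℝ} (hη : 0 < η) (hq1 : q < 1) (hq : ‖T * (1 + η • M) * Ti‖ ≤ q) : IsHurwitz M := by
  intro z hz
  have hq0 : 0 ≤ q := (norm_nonneg _).trans hq
  rw [← Matrix.spectrum_toLin', ← Module.End.hasEigenvalue_iff_mem_spectrum] at hz
  obtain ⟨v, hv⟩ := hz.exists_hasEigenvector
  have hv1 : M.map (algebraMap ℝ ℂ) *ᵥ v = z • v := by simpa using hv.apply_eq_smul
  -- On the real and imaginary parts of an eigenvector the Euler step acts as multiplication by 1 +
  -- ηz. Adding the two squared norms cancels the cross terms and gives |1 + ηz| ≤ q < 1, which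
  -- excludes Re z ≥ 0.
  set x : ι → ℝ := fun i => (v i).re
  set y : ι → ℝ := fun i => (v i).im
  have hx : M *ᵥ x = z.re • x - z.im • y := by
    funext i
    have := congrArg Complex.re (congrFun hv1 i)
    simpa [Matrix.mulVec, dotProduct, Complex.re_sum, x, y] using this
  have hy : M *ᵥ y = z.im • x + z.re • y := by
    funext i
    have := congrArg Complex.im (congrFun hv1 i)
    simp [Matrix.mulVec, dotProduct, Complex.im_sum] at this
    simp [Matrix.mulVec, dotProduct, x, y, this]
    ring
  have hstep : ∀ u : ι → ℝ, eucl (T *ᵥ (u + η • (M *ᵥ u))) ≤ q * eucl (T *ᵥ u) := by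
    intro u
    have e : T *ᵥ (u + η • (M *ᵥ u)) = (T * (1 + η • M) * Ti) *ᵥ (T *ᵥ u) := by
      rw [Matrix.mulVec_mulVec, mul_assoc _ Ti, h₂, mul_one, ← Matrix.mulVec_mulVec,
        Matrix.add_mulVec, Matrix.one_mulVec, Matrix.smul_mulVec]
    rw [e]
    exact (eucl_mulVec_le _ _).trans (mul_le_mul_of_nonneg_right hq (eucl_nonneg _))
  set X := T *ᵥ x
  set Y := T *ᵥ y
  have e1 : T *ᵥ (x + η • (M *ᵥ x)) = (1 + η * z.re) • X - (η * z.im) • Y := by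
    rw [hx]
    simp only [Matrix.mulVec_add, Matrix.mulVec_sub, Matrix.mulVec_smul, X, Y]
    module
  have e2 : T *ᵥ (y + η • (M *ᵥ y)) = (η * z.im) • X + (1 + η * z.re) • Y := by
    rw [hy]
    simp only [Matrix.mulVec_add, Matrix.mulVec_smul, X, Y]
    module
  have s1 := pow_le_pow_left₀ (eucl_nonneg _) (hstep x) 2
  have s2 := pow_le_pow_left₀ (eucl_nonneg _) (hstep y) 2
  rw [e1, mul_pow, eucl_sq, eucl_sq] at s1
  rw [e2, mul_pow, eucl_sq, eucl_sq] at s2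
  simp only [sub_dotProduct, dotProduct_sub, add_dotProduct, dotProduct_add, smul_dotProduct,
    dotProduct_smul, smul_eq_mul, dotProduct_comm Y X] at s1 s2
  have hpos : 0 < X ⬝ᵥ X + Y ⬝ᵥ Y := by
    by_contra hneg
    have hX0 : X ⬝ᵥ X = 0 := by
      have h1 := sq_nonneg (eucl X); have h2 := sq_nonneg (eucl Y)
      rw [eucl_sq] at h1 h2; linarith
    have hY0 : Y ⬝ᵥ Y = 0 := by
      have h1 := sq_nonneg (eucl X); have h2 := sq_nonneg (eucl Y)
      rw [eucl_sq] at h1 h2; linarith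
    have hT : ∀ u, T *ᵥ u = 0 → u = 0 := fun u hu => by
      rw [← Matrix.one_mulVec u, ← h₂, ← Matrix.mulVec_mulVec, hu, Matrix.mulVec_zero]
    have hx0 : x = 0 := hT x (dotProduct_self_eq_zero.1 hX0)
    have hy0 : y = 0 := hT y (dotProduct_self_eq_zero.1 hY0)
    refine hv.2 (funext fun i => Complex.ext ?_ ?_)
    · exact congrFun hx0 i
    · exact congrFun hy0 i
  have hsum : ((1 + η * z.re) ^ 2 + (η * z.im) ^ 2 - q ^ 2) * (X ⬝ᵥ X + Y ⬝ᵥ Y) ≤ 0 := by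
    nlinarith
  have h5 : (1 + η * z.re) ^ 2 + (η * z.im) ^ 2 - q ^ 2 ≤ 0 := by
    by_contra hc
    push Not at hc
    nlinarith [mul_pos hc hpos]
  by_contra hre
  push Not at hre
  nlinarith [mul_nonneg hη.le hre, sq_nonneg (η * z.im), sq_nonneg (η * z.re)]

end Exponential

end PCELQR

namespace PCELQR

/-! ### Quadratic forms of Gaussian vectors and the costs -/

section Gaussian

open MeasureTheory ProbabilityTheory

variable {n m : ℕ}

theorem memLp_id_stdGaussian :
    MemLp id 2 (stdGaussian (EuclideanSpace ℝ (Fin n))) := IsGaussian.memLp_two_id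

theorem integrable_coord_mul_stdGaussian (i j : Fin n) :
    Integrable (fun x : EuclideanSpace ℝ (Fin n) => x i * x j)
      (stdGaussian (EuclideanSpace ℝ (Fin n))) := by
  have h : ∀ i : Fin n, MemLp (fun x : EuclideanSpace ℝ (Fin n) => x i) 2
      (stdGaussian (EuclideanSpace ℝ (Fin n))) := fun i =>
    memLp_id_stdGaussian.continuousLinearMap_comp (EuclideanSpace.proj (𝕜 := ℝ) i)
  exact (h i).integrable_mul (h j)

theorem integral_coord_mul_stdGaussian (i j : Fin n) :
    ∫ x : EuclideanSpace ℝ (Fin n), x i * x j ∂(stdGaussian (EuclideanSpace ℝ (Fin n))) =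
      if i = j then 1 else 0 := by
  have h := covarianceBilin_apply (memLp_id_stdGaussian (n := n))
    (EuclideanSpace.single i 1) (EuclideanSpace.single j 1)
  rw [covarianceBilin_stdGaussian] at h
  have h0 : ∫ x, id x ∂(stdGaussian (EuclideanSpace ℝ (Fin n))) = 0 := integral_id_stdGaussian
  rw [h0, innerSL_apply_apply] at h
  simp [EuclideanSpace.inner_single_left] at h
  rw [← h]

/-- The quadratic form of a matrix. -/
def quadForm {ι : Type*} [Fintype ι] (W : Matrix ι ι ℝ) (v : ι → ℝ) : ℝ := v ⬝ᵥ (W *ᵥ v)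

theorem quadForm_sum {ι : Type*} [Fintype ι] (W : Matrix ι ι ℝ) (c : Fin n → ℝ)
    (u : Fin n → ι → ℝ) :
    quadForm W (∑ j, c j • u j) = ∑ i, ∑ j, (c i * c j) * (u i ⬝ᵥ (W *ᵥ u j)) := by
  simp only [quadForm, Matrix.mulVec_sum, Matrix.mulVec_smul, sum_dotProduct, dotProduct_sum,
    smul_dotProduct, dotProduct_smul, smul_eq_mul, Finset.mul_sum]
  rw [Finset.sum_comm]
  exact Finset.sum_congr rfl fun i _ => Finset.sum_congr rfl fun j _ => by ring

theorem continuous_quadForm {ι : Type*} [Fintype ι] (W : Matrix ι ι ℝ) :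
    Continuous (quadForm W) :=
  continuous_id.dotProduct (continuous_const.matrix_mulVec continuous_id)

/-- The mean of a quadratic form of a linear image of a standard Gaussian vector. -/
theorem lintegral_quadForm_stdGaussian {ι : Type*} [Fintype ι] {W : Matrix ι ι ℝ}
    (hW : ∀ v, 0 ≤ quadForm W v) (u : Fin n → ι → ℝ) :
    ∫⁻ x : EuclideanSpace ℝ (Fin n), ENNReal.ofReal (quadForm W (∑ j, x j • u j))
      ∂(stdGaussian (EuclideanSpace ℝ (Fin n))) = ENNReal.ofReal (∑ j, quadForm W (u j)) := by
  have hint : ∀ i j, Integrable (fun x : EuclideanSpace ℝ (Fin n) =>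
      (x i * x j) * (u i ⬝ᵥ (W *ᵥ u j))) (stdGaussian (EuclideanSpace ℝ (Fin n))) := fun i j =>
    (integrable_coord_mul_stdGaussian i j).mul_const _
  have hint' : Integrable (fun x : EuclideanSpace ℝ (Fin n) => quadForm W (∑ j, x j • u j))
      (stdGaussian (EuclideanSpace ℝ (Fin n))) := by
    simp only [quadForm_sum]
    exact integrable_finsetSum _ fun i _ => integrable_finsetSum _ fun j _ => hint i j
  rw [← ofReal_integral_eq_lintegral_ofReal hint' (Filter.Eventually.of_forall fun x => hW _)]
  congr 1
  simp only [quadForm_sum]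
  rw [integral_finsetSum _ fun i _ => integrable_finsetSum _ fun j _ => hint i j]
  refine Finset.sum_congr rfl fun i _ => ?_
  rw [integral_finsetSum _ fun j _ => hint i j]
  simp [integral_mul_const, integral_coord_mul_stdGaussian, quadForm]

/-- The Gaussian mean of a quadratic cost along linear trajectories. -/
theorem lintegral_lintegral_quadForm {ι : Type*} [Fintype ι] {W : Matrix ι ι ℝ}
    (hW : ∀ v, 0 ≤ quadForm W v) {f : ℝ → (Fin n → ℝ) → ι → ℝ}
    (hlin : ∀ t v, f t v = ∑ j, v j • f t (Pi.single j 1))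
    (hf : ∀ j, Continuous fun t => f t (Pi.single j 1)) :
    ∫⁻ x : EuclideanSpace ℝ (Fin n), (∫⁻ t in Set.Ici (0 : ℝ),
        ENNReal.ofReal (quadForm W (f t x.ofLp))) ∂(stdGaussian (EuclideanSpace ℝ (Fin n))) =
      ∫⁻ t in Set.Ici (0 : ℝ), ENNReal.ofReal (∑ j, quadForm W (f t (Pi.single j 1))) := by
  have hcont : Continuous fun p : EuclideanSpace ℝ (Fin n) × ℝ =>
      ENNReal.ofReal (quadForm W (f p.2 p.1.ofLp)) := by
    refine ENNReal.continuous_ofReal.comp ((continuous_quadForm W).comp ?_)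
    simp_rw [fun p : EuclideanSpace ℝ (Fin n) × ℝ => hlin p.2 p.1.ofLp]
    exact continuous_finsetSum _ fun j _ =>
      ((EuclideanSpace.proj (𝕜 := ℝ) j).continuous.comp continuous_fst).smul
        ((hf j).comp continuous_snd)
  rw [lintegral_lintegral_swap hcont.measurable.aemeasurable]
  refine lintegral_congr fun t => ?_
  refine (lintegral_congr fun x => ?_).trans
    (lintegral_quadForm_stdGaussian hW fun j => f t (Pi.single j 1))
  rw [← hlin]

/-- The state weight `Q + Kᵀ R K` of the closed loop. -/
def stateWeight (Q : Matrix (Fin n) (Fin n) ℝ) (R : Matrix (Fin m) (Fin m) ℝ)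
    (K : Matrix (Fin m) (Fin n) ℝ) : Matrix (Fin n) (Fin n) ℝ := Q + Kᵀ * R * K

theorem quadForm_stateWeight (Q : Matrix (Fin n) (Fin n) ℝ) (R : Matrix (Fin m) (Fin m) ℝ)
    (K : Matrix (Fin m) (Fin n) ℝ) (v : Fin n → ℝ) :
    quadForm (stateWeight Q R K) v = quadForm Q v + quadForm R (K *ᵥ v) := by
  simp only [quadForm, stateWeight, Matrix.add_mulVec, dotProduct_add]
  congr 1
  rw [← Matrix.mulVec_mulVec, ← Matrix.mulVec_mulVec, Matrix.dotProduct_mulVec,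
    Matrix.vecMul_transpose]

theorem quadForm_nonneg_of_posDef {ι : Type*} [Fintype ι] {Q : Matrix ι ι ℝ} (hQ : Q.PosDef)
    (v : ι → ℝ) : 0 ≤ quadForm Q v := by
  simpa [quadForm] using hQ.posSemidef.dotProduct_mulVec_nonneg v

theorem quadForm_stateWeight_nonneg {Q : Matrix (Fin n) (Fin n) ℝ} {R : Matrix (Fin m) (Fin m) ℝ}
    (hQ : Q.PosDef) (hR : R.PosDef) (K : Matrix (Fin m) (Fin n) ℝ) (v : Fin n → ℝ) :
    0 ≤ quadForm (stateWeight Q R K) v := by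
  rw [quadForm_stateWeight]
  exact add_nonneg (quadForm_nonneg_of_posDef hQ _) (quadForm_nonneg_of_posDef hR _)

theorem sum_smul_single {ι : Type*} [Fintype ι] [DecidableEq ι] (v : ι → ℝ) :
    v = ∑ j, v j • (Pi.single j 1 : ι → ℝ) := by
  funext i
  simp [Finset.sum_apply, Pi.single_apply]

theorem flow_eq_sum (M : Matrix (Fin n) (Fin n) ℝ) (t : ℝ) (v : Fin n → ℝ) :
    flow M t v = ∑ j, v j • flow M t (Pi.single j 1) := by
  conv_lhs => rw [sum_smul_single v]
  simp only [flow, Matrix.mulVec_sum, Matrix.mulVec_smul]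

theorem continuous_flow {ι : Type*} [Fintype ι] [DecidableEq ι] (M : Matrix ι ι ℝ) (v : ι → ℝ) :
    Continuous fun t => flow M t v :=
  (continuous_exp_smul M).matrix_mulVec continuous_const

/-- By Tonelli and the identity covariance of x₀, the Gaussian mean is a trace, written as a sum
over basis vectors; substituting u = -Kx merges the two weights into one. -/
theorem systemCost_eq {Q : Matrix (Fin n) (Fin n) ℝ} {R : Matrix (Fin m) (Fin m) ℝ}
    (hQ : Q.PosDef) (hR : R.PosDef) (A : Matrix (Fin n) (Fin n) ℝ) (B : Matrix (Fin n) (Fin m) ℝ)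
    (K : Matrix (Fin m) (Fin n) ℝ) :
    systemCost A B Q R K = ∫⁻ t in Set.Ici (0 : ℝ), ENNReal.ofReal
      (∑ j, quadForm (stateWeight Q R K) (flow (closedLoop A B K) t (Pi.single j 1))) := by
  rw [← lintegral_lintegral_quadForm (quadForm_stateWeight_nonneg hQ hR K)
    (flow_eq_sum (closedLoop A B K)) (fun j => continuous_flow _ _)]
  refine lintegral_congr fun x => lintegral_congr fun t => ?_
  rw [quadForm_stateWeight]
  simp only [quadForm, neg_dotProduct, Matrix.mulVec_neg, dotProduct_neg, neg_neg]

theorem surrogateInit_eq_sum (N : ℕ) (v : Fin n → ℝ) :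
    surrogateInit N v = ∑ j, v j • surrogateInit N (Pi.single j 1) := by
  funext i
  conv_lhs => rw [sum_smul_single v]
  by_cases h : i.1 = 0 <;> simp [surrogateInit, h, Finset.sum_apply]

theorem expand_sum {ι : Type*} (s : Finset ι) (a b : ℝ) (N : ℕ) (c : ι → ℝ)
    (z : ι → Fin (N + 1) × Fin n → ℝ) (ξ : ℝ) :
    expand a b N (∑ j ∈ s, c j • z j) ξ = ∑ j ∈ s, c j • expand a b N (z j) ξ := by
  funext k
  simp only [expand, Finset.sum_apply, Pi.smul_apply, smul_eq_mul, Finset.sum_mul, Finset.mul_sum]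
  rw [Finset.sum_comm]
  exact Finset.sum_congr rfl fun i _ => Finset.sum_congr rfl fun j _ => by ring

theorem continuous_expand_comp (a b : ℝ) (N : ℕ) {X : Type*} [TopologicalSpace X]
    {z : X → Fin (N + 1) × Fin n → ℝ} {g : X → ℝ} (hz : Continuous z) (hg : Continuous g) :
    Continuous fun x => expand a b N (z x) (g x) :=
  continuous_pi fun j => continuous_finsetSum _ fun i _ =>
    ((continuous_apply (i, j)).comp hz).mul ((continuous_phi a b N i).comp hg)

theorem surrogateCost_eq {Q : Matrix (Fin n) (Fin n) ℝ} {R : Matrix (Fin m) (Fin m) ℝ}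
    (hQ : Q.PosDef) (hR : R.PosDef) (a b : ℝ) (A : ℝ → Matrix (Fin n) (Fin n) ℝ)
    (B : ℝ → Matrix (Fin n) (Fin m) ℝ) (N : ℕ) (K : Matrix (Fin m) (Fin n) ℝ) :
    surrogateCost a b A B Q R N K = ∫⁻ ξ, (∫⁻ t in Set.Ici (0 : ℝ), ENNReal.ofReal
      (∑ j, quadForm (stateWeight Q R K) (expand a b N (flow (surrogateClosedLoop a b A B N K) t
        (surrogateInit N (Pi.single j 1))) ξ))) ∂(unif a b) := by
  refine lintegral_congr fun ξ => ?_
  rw [← lintegral_lintegral_quadForm (quadForm_stateWeight_nonneg hQ hR K)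
    (f := fun t v => expand a b N (flow (surrogateClosedLoop a b A B N K) t
        (surrogateInit N v)) ξ) ?_ ?_]
  · rfl
  · intro t v
    rw [← expand_sum]
    congr 1
    conv_lhs => rw [surrogateInit_eq_sum]
    simp only [flow, Matrix.mulVec_sum, Matrix.mulVec_smul]
  · exact fun j => continuous_expand_comp a b N (continuous_flow _ _) continuous_const

end Gaussian

end PCELQR

namespace PCELQR

/-! ### The Lyapunov equation of a gain with finite cost -/

section Lyapunov

open MeasureTheory

variable {n m : ℕ}

/-! ### Gram factors and smallest eigenvalues. -/

section
open scoped MatrixOrder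

theorem exists_gram_eq {ι : Type*} [Fintype ι] [DecidableEq ι] {P : Matrix ι ι ℝ}
    (hP : P.PosSemidef) : ∃ T : Matrix ι ι ℝ, Tᵀ * T = P := by
  have h0 : 0 ≤ P := Matrix.nonneg_iff_posSemidef.2 hP
  refine ⟨CFC.sqrt P, ?_⟩
  have h1 : (CFC.sqrt P).PosSemidef := Matrix.nonneg_iff_posSemidef.1 (CFC.sqrt_nonneg P)
  have h2 : (CFC.sqrt P)ᵀ = CFC.sqrt P := by
    simpa [Matrix.IsHermitian, Matrix.conjTranspose_eq_transpose_of_trivial] using h1.1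
  rw [h2]
  exact CFC.sqrt_mul_sqrt_self P h0

theorem lambdaMin_mul_eucl_sq_le {k : ℕ} {Q : Matrix (Fin k) (Fin k) ℝ} (hQ : Q.PosDef)
    (v : Fin k → ℝ) : lambdaMin Q * eucl v ^ 2 ≤ quadForm Q v := by
  have hfin : (spectrum ℝ Q).Finite := by
    rw [hQ.1.spectrum_real_eq_range_eigenvalues]
    exact Set.finite_range _
  have hle : algebraMap ℝ (Matrix (Fin k) (Fin k) ℝ) (lambdaMin Q) ≤ Q := by
    rw [algebraMap_le_iff_le_spectrum (ha := hQ.1)]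
    exact fun x hx => csInf_le hfin.bddBelow hx
  have h := (Matrix.le_iff.1 hle).dotProduct_mulVec_nonneg v
  rw [Matrix.sub_mulVec, Algebra.algebraMap_eq_smul_one, Matrix.smul_mulVec, Matrix.one_mulVec,
    dotProduct_sub, dotProduct_smul, smul_eq_mul, star_trivial] at h
  rw [eucl_sq, quadForm]
  linarith

theorem lambdaMin_pos {k : ℕ} (hk : 0 < k) {Q : Matrix (Fin k) (Fin k) ℝ} (hQ : Q.PosDef) :
    0 < lambdaMin Q := by
  have : Nonempty (Fin k) := ⟨⟨0, hk⟩⟩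
  have h : sInf (spectrum ℝ Q) ∈ spectrum ℝ Q := by
    rw [hQ.1.spectrum_real_eq_range_eigenvalues]
    exact (Set.range_nonempty _).csInf_mem (Set.finite_range _)
  rw [hQ.1.spectrum_real_eq_range_eigenvalues] at h
  obtain ⟨i, hi⟩ := h
  rw [lambdaMin, hQ.1.spectrum_real_eq_range_eigenvalues, ← hi]
  exact hQ.eigenvalues_pos i

end

/-- The infimum of the empty spectrum takes the default value 0. With no inputs, the quotients by
`lambdaMin R` are then 0 as well, so the bounds keep their form. -/
theorem lambdaMin_of_isEmpty (Q : Matrix (Fin 0) (Fin 0) ℝ) : lambdaMin Q = 0 := by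
  rw [lambdaMin, spectrum.of_subsingleton, Real.sInf_empty]

theorem dotProduct_gram {ι κ : Type*} [Fintype ι] [Fintype κ] (L : Matrix κ ι ℝ) (v w : ι → ℝ) :
    v ⬝ᵥ ((Lᵀ * L) *ᵥ w) = (L *ᵥ v) ⬝ᵥ (L *ᵥ w) := by
  rw [← Matrix.mulVec_mulVec, Matrix.dotProduct_mulVec, Matrix.vecMul_transpose]

/-- The operator norm is at most the Frobenius norm, by Cauchy–Schwarz in each row. The cost
controls only a trace; this turns it into a bound in every direction. -/
theorem eucl_mulVec_sq_le_sum {ι κ : Type*} [Fintype ι] [DecidableEq ι] [Fintype κ]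
    (N : Matrix κ ι ℝ) (v : ι → ℝ) :
    eucl (N *ᵥ v) ^ 2 ≤ (∑ j, eucl (N *ᵥ Pi.single j 1) ^ 2) * eucl v ^ 2 := by
  have h1 : ∑ j, eucl (N *ᵥ Pi.single j 1) ^ 2 = ∑ i, ∑ j, N i j ^ 2 := by
    rw [Finset.sum_comm]
    refine Finset.sum_congr rfl fun j _ => ?_
    rw [eucl_sq_eq_sum]
    simp
  rw [h1, eucl_sq_eq_sum, eucl_sq_eq_sum, Finset.sum_mul]
  exact Finset.sum_le_sum fun i _ => Finset.sum_mul_sq_le_sq_mul_sq _ _ _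

theorem hasDerivAt_mulVec_flow (L M : Matrix (Fin n) (Fin n) ℝ) (v : Fin n → ℝ) (t : ℝ) :
    HasDerivAt (fun s => L *ᵥ flow M s v) (L *ᵥ flow M t (M *ᵥ v)) t := by
  let ℓ : Matrix (Fin n) (Fin n) ℝ →ₗ[ℝ] (Fin n → ℝ) :=
    { toFun := fun N => L *ᵥ (N *ᵥ v)
      map_add' := fun N N' => by rw [Matrix.add_mulVec, Matrix.mulVec_add]
      map_smul' := fun c N => by rw [Matrix.smul_mulVec, Matrix.mulVec_smul]; rfl }
  have h : HasDerivAt (fun s => L *ᵥ flow M s v)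
      (L *ᵥ ((NormedSpace.exp (t • M) * M) *ᵥ v)) t :=
    (LinearMap.toContinuousLinearMap ℓ).hasFDerivAt.comp_hasDerivAt t
      (hasDerivAt_exp_smul_const (𝕂 := ℝ) M t)
  rwa [← Matrix.mulVec_mulVec v] at h

/-- A closed loop with cost at most `h` has a Lyapunov function `v ↦ ‖T v‖²` bounded by `h ‖v‖²`. -/
theorem exists_lyapunov {M W : Matrix (Fin n) (Fin n) ℝ} (hW : W.PosSemidef) {h : ℝ} (hh : 0 ≤ h)
    (hcost : ∫⁻ t in Set.Ici (0 : ℝ), ENNReal.ofReal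
      (∑ j, quadForm W (flow M t (Pi.single j 1))) ≤ ENNReal.ofReal h) :
    ∃ T : Matrix (Fin n) (Fin n) ℝ, (∀ v, eucl (T *ᵥ v) ^ 2 ≤ h * eucl v ^ 2) ∧
      ∀ v, (T *ᵥ v) ⬝ᵥ (T *ᵥ (M *ᵥ v)) = -(1 / 2) * quadForm W v := by
  obtain ⟨L, hL⟩ := exists_gram_eq hW
  have hq : ∀ u, quadForm W u = eucl (L *ᵥ u) ^ 2 := fun u => by
    rw [quadForm, ← hL, dotProduct_gram, eucl_sq]
  set F : ℝ → ℝ := fun t => ∑ j, quadForm W (flow M t (Pi.single j 1))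
  have hFc : Continuous F :=
    continuous_finsetSum _ fun j _ => (continuous_quadForm W).comp (continuous_flow M _)
  have hF0 : ∀ t, 0 ≤ F t := fun t => Finset.sum_nonneg fun j _ => by rw [hq]; positivity
  have hFi : IntegrableOn F (Set.Ici 0) :=
    (lintegral_ofReal_ne_top_iff_integrable hFc.aestronglyMeasurable
      (Filter.Eventually.of_forall hF0)).1 (hcost.trans_lt ENNReal.ofReal_lt_top).ne
  have hFI : ∫ t in Set.Ioi (0 : ℝ), F t ≤ h := by
    rw [← integral_Ici_eq_integral_Ioi, integral_eq_lintegral_of_nonneg_ae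
      (Filter.Eventually.of_forall hF0) hFc.aestronglyMeasurable]
    exact ENNReal.toReal_le_of_le_ofReal hh hcost
  replace hFi : IntegrableOn F (Set.Ioi 0) := hFi.mono_set Set.Ioi_subset_Ici_self
  set φ : (Fin n → ℝ) → (Fin n → ℝ) → ℝ → ℝ :=
    fun v w t => (L *ᵥ flow M t v) ⬝ᵥ (L *ᵥ flow M t w) with hφ
  have hLc : ∀ v, Continuous fun t => L *ᵥ flow M t v := fun v =>
    continuous_const.matrix_mulVec (continuous_flow M v)
  have hφc : ∀ v w, Continuous (φ v w) := fun v w => (hLc v).dotProduct (hLc w)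
  have hle : ∀ v t, eucl (L *ᵥ flow M t v) ^ 2 ≤ F t * eucl v ^ 2 := by
    intro v t
    have := eucl_mulVec_sq_le_sum (L * NormedSpace.exp (t • M)) v
    simpa only [F, hq, flow, Matrix.mulVec_mulVec] using this
  have hφi : ∀ v w, IntegrableOn (φ v w) (Set.Ioi 0) := by
    intro v w
    refine Integrable.mono' (hFi.mul_const (eucl v ^ 2 / 2 + eucl w ^ 2 / 2))
      (hφc v w).aestronglyMeasurable (Filter.Eventually.of_forall fun t => ?_)
    have h1 := abs_dotProduct_le (L *ᵥ flow M t v) (L *ᵥ flow M t w)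
    rw [Real.norm_eq_abs]
    nlinarith [hle v t, hle w t, sq_nonneg (eucl (L *ᵥ flow M t v) - eucl (L *ᵥ flow M t w))]
  -- The Gramian ∫ exp(tM)ᵀ W exp(tM) dt, with W = LᵀL.
  set P : Matrix (Fin n) (Fin n) ℝ :=
    Matrix.of fun i j => ∫ t in Set.Ioi (0 : ℝ), φ (Pi.single i 1) (Pi.single j 1) t with hPdef
  have hP : ∀ v w, v ⬝ᵥ (P *ᵥ w) = ∫ t in Set.Ioi (0 : ℝ), φ v w t := by
    intro v w
    have e : ∀ t, φ v w t = ∑ i, ∑ j, v i * (φ (Pi.single i 1) (Pi.single j 1) t * w j) := by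
      intro t
      simp only [hφ]
      rw [flow_eq_sum M t v, flow_eq_sum M t w]
      simp only [Matrix.mulVec_sum, Matrix.mulVec_smul, sum_dotProduct, dotProduct_sum,
        smul_dotProduct, dotProduct_smul, smul_eq_mul, Finset.mul_sum]
      rw [Finset.sum_comm]
      exact Finset.sum_congr rfl fun i _ => Finset.sum_congr rfl fun j _ => by ring
    have hi : ∀ i j, Integrable (fun t => v i * (φ (Pi.single i 1) (Pi.single j 1) t * w j))
        (volume.restrict (Set.Ioi 0)) := fun i j => ((hφi _ _).mul_const _).const_mul _
    simp_rw [e]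
    rw [integral_finsetSum _ fun i _ => integrable_finsetSum _ fun j _ => hi i j]
    simp only [dotProduct, Matrix.mulVec, Finset.mul_sum]
    refine Finset.sum_congr rfl fun i _ => ?_
    rw [integral_finsetSum _ fun j _ => hi i j]
    refine Finset.sum_congr rfl fun j _ => ?_
    rw [integral_const_mul, integral_mul_const, hPdef, Matrix.of_apply]
  have hPsd : P.PosSemidef := by
    refine Matrix.PosSemidef.of_dotProduct_mulVec_nonneg ?_ fun v => ?_
    · ext i j
      simp only [Matrix.conjTranspose_apply, star_trivial, hPdef, Matrix.of_apply, hφ]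
      simp_rw [dotProduct_comm (L *ᵥ flow M _ (Pi.single j 1))]
    · rw [star_trivial, hP]
      exact integral_nonneg fun t => by simp only [hφ]; rw [← eucl_sq]; positivity
  obtain ⟨T, hT⟩ := exists_gram_eq hPsd
  have hTd : ∀ v w, (T *ᵥ v) ⬝ᵥ (T *ᵥ w) = ∫ t in Set.Ioi (0 : ℝ), φ v w t := fun v w => by
    rw [← dotProduct_gram, hT, hP]
  refine ⟨T, fun v => ?_, fun v => ?_⟩
  · rw [eucl_sq, hTd]
    calc ∫ t in Set.Ioi (0 : ℝ), φ v v t ≤ ∫ t in Set.Ioi (0 : ℝ), F t * eucl v ^ 2 := by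
          refine integral_mono (hφi v v) (hFi.mul_const _) fun t => ?_
          simp only [hφ]
          rw [← eucl_sq]
          exact hle v t
      _ ≤ h * eucl v ^ 2 := by
          rw [integral_mul_const]
          gcongr
  -- The derivative of vᵀ exp(tM)ᵀ W exp(tM) v integrates to minus its value at 0, which is the
  -- Lyapunov equation. The limit at infinity is 0 because the function and its derivative are both
  -- integrable.
  · have hd : ∀ t, HasDerivAt (φ v v) (2 * φ v (M *ᵥ v) t) t := by
      intro t
      have hi := hasDerivAt_pi.1 (hasDerivAt_mulVec_flow L M v t)
      have hs := HasDerivAt.fun_sum (u := Finset.univ) fun i _ => (hi i).mul (hi i)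
      refine HasDerivAt.congr_deriv (f := φ v v) hs ?_
      simp only [hφ, dotProduct, Finset.mul_sum]
      exact Finset.sum_congr rfl fun i _ => by ring
    have hi2 : IntegrableOn (fun t => 2 * φ v (M *ᵥ v) t) (Set.Ioi 0) :=
      (hφi v (M *ᵥ v)).const_mul 2
    have hlim := tendsto_zero_of_hasDerivAt_of_integrableOn_Ioi (a := 0)
      (fun t _ => hd t) hi2 (hφi v v)
    have hI := integral_Ioi_of_hasDerivAt_of_tendsto (hφc v v).continuousWithinAt
      (fun t _ => hd t) hi2 hlim
    rw [integral_const_mul, ← hTd] at hI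
    have h0 : φ v v 0 = quadForm W v := by
      simp only [hφ]
      rw [hq, eucl_sq]
      simp [flow]
    rw [h0] at hI
    linarith

end Lyapunov

end PCELQR

namespace PCELQR

/-! ### Uniform contraction of the Euler step over the sublevel set -/

section Contraction

variable {n m : ℕ}

theorem eucl_mulVec_le_sqrt {T : Matrix (Fin n) (Fin n) ℝ} {h : ℝ} (hh : 0 ≤ h)
    (hT : ∀ v, eucl (T *ᵥ v) ^ 2 ≤ h * eucl v ^ 2) (v : Fin n → ℝ) :
    eucl (T *ᵥ v) ≤ √h * eucl v := by
  rw [← Real.sqrt_sq (eucl_nonneg v), ← Real.sqrt_mul hh]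
  exact Real.le_sqrt_of_sq_le (hT v)

/-- A priori bound for the gain in terms of the Lyapunov function. -/
theorem norm_gain_le {A : Matrix (Fin n) (Fin n) ℝ} {B : Matrix (Fin n) (Fin m) ℝ}
    {Q : Matrix (Fin n) (Fin n) ℝ} {R : Matrix (Fin m) (Fin m) ℝ} (hQ : Q.PosDef) (hR : R.PosDef)
    {h : ℝ} (hh : 0 < h) {K : Matrix (Fin m) (Fin n) ℝ} {T : Matrix (Fin n) (Fin n) ℝ}
    (hT : ∀ v, eucl (T *ᵥ v) ^ 2 ≤ h * eucl v ^ 2)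
    (hlyap : ∀ v, (T *ᵥ v) ⬝ᵥ (T *ᵥ (closedLoop A B K *ᵥ v)) =
      -(1 / 2) * quadForm (stateWeight Q R K) v) :
    ‖K‖ ≤ 2 * ‖B‖ / lambdaMin R * h + √(2 * ‖A‖ / lambdaMin R) * √h := by
  have hr : 0 ≤ lambdaMin R := by
    rcases Nat.eq_zero_or_pos m with rfl | hm
    · rw [lambdaMin_of_isEmpty]
    · exact (lambdaMin_pos hm hR).le
  refine opNorm_le_of_eucl (by positivity) fun v => ?_
  rcases Nat.eq_zero_or_pos m with rfl | hm
  · rw [Subsingleton.elim (K *ᵥ v) 0, eucl_eq_zero.2 rfl]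
    exact mul_nonneg (by positivity) (eucl_nonneg v)
  replace hr := lambdaMin_pos hm hR
  set r := lambdaMin R
  have hTn := eucl_mulVec_le_sqrt hh.le hT
  have hss : √h * √h = h := Real.mul_self_sqrt hh.le
  set s := eucl v
  set k := eucl (K *ᵥ v)
  have hs0 : 0 ≤ s := eucl_nonneg v
  have hk0 : 0 ≤ k := eucl_nonneg _
  -- The Lyapunov identity bounds r‖Kv‖² by 2‖Tv‖‖TMv‖, where M contains K only linearly, so a
  -- quadratic inequality for ‖Kv‖ results.
  have h1 : r * k ^ 2 ≤ quadForm (stateWeight Q R K) v := by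
    rw [quadForm_stateWeight]
    have := lambdaMin_mul_eucl_sq_le hR (K *ᵥ v)
    have := quadForm_nonneg_of_posDef hQ v
    linarith
  have h2 : quadForm (stateWeight Q R K) v ≤
      2 * (eucl (T *ᵥ v) * eucl (T *ᵥ (closedLoop A B K *ᵥ v))) := by
    have h3 := abs_dotProduct_le (T *ᵥ v) (T *ᵥ (closedLoop A B K *ᵥ v))
    rw [hlyap v] at h3
    have h4 := neg_abs_le (-(1 / 2) * quadForm (stateWeight Q R K) v)
    linarith
  have h3 : eucl (closedLoop A B K *ᵥ v) ≤ ‖A‖ * s + ‖B‖ * k := by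
    rw [closedLoop, Matrix.sub_mulVec, ← Matrix.mulVec_mulVec]
    exact (eucl_sub_le _ _).trans (add_le_add (eucl_mulVec_le _ _) (eucl_mulVec_le _ _))
  have h4 : eucl (T *ᵥ v) * eucl (T *ᵥ (closedLoop A B K *ᵥ v)) ≤
      (√h * s) * (√h * (‖A‖ * s + ‖B‖ * k)) := by
    refine mul_le_mul (hTn v) ((hTn _).trans ?_) (eucl_nonneg _) (by positivity)
    gcongr
  have h5 : r * k ^ 2 ≤ 2 * h * s * (‖A‖ * s + ‖B‖ * k) := by
    calc r * k ^ 2 ≤ 2 * ((√h * s) * (√h * (‖A‖ * s + ‖B‖ * k))) := by linarith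
      _ = 2 * (√h * √h) * s * (‖A‖ * s + ‖B‖ * k) := by ring
      _ = _ := by rw [hss]
  set x := 2 * ‖B‖ / r * h with hx
  set y := √(2 * ‖A‖ / r) * √h with hy
  have hx0 : 0 ≤ x := by positivity
  have hy0 : 0 ≤ y := by positivity
  have hyy : y ^ 2 = 2 * ‖A‖ / r * h := by
    rw [hy, mul_pow, Real.sq_sqrt (by positivity), Real.sq_sqrt hh.le]
  have h6 : k ^ 2 ≤ y ^ 2 * s ^ 2 + x * s * k := by
    rw [hyy, hx, ← mul_le_mul_iff_right₀ hr]
    refine h5.trans_eq ?_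
    field_simp
  -- If k > (x + y)s, then k(k - xs) > (ys)², contradicting the quadratic inequality.
  by_contra hc
  push Not at hc
  have h7 : y * s < k - x * s := by linarith
  have h8 : y * s < k := by linarith [mul_nonneg hx0 hs0]
  have h9 : 0 ≤ y * s := mul_nonneg hy0 hs0
  nlinarith [mul_lt_mul'' h7 h8 h9 h9]

/-- The upper bound uses only that the minimum is at most 1; ε₁ matters here through positivity. -/
theorem heterogeneityLevel_le {A : Matrix (Fin n) (Fin n) ℝ} {B : Matrix (Fin n) (Fin m) ℝ}
    {Q : Matrix (Fin n) (Fin n) ℝ} {R : Matrix (Fin m) (Fin m) ℝ} (hn : 0 < n) (hQ : Q.PosDef)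
    (hR : R.PosDef) {h ε₁ : ℝ} (hh : 0 < h) (hε₁ : 0 < ε₁) :
    0 < heterogeneityLevel A B Q R h ε₁ ∧
    heterogeneityLevel A B Q R h ε₁ * (4 * h * (1 + 2 * ‖B‖ / lambdaMin R * h +
      √(2 * ‖A‖ / lambdaMin R) * √h)) ≤ lambdaMin Q := by
  have hr : 0 ≤ lambdaMin R := by
    rcases Nat.eq_zero_or_pos m with rfl | hm
    · rw [lambdaMin_of_isEmpty]
    · exact (lambdaMin_pos hm hR).le
  have hq := lambdaMin_pos hn hQ
  have hden : 0 < 4 * h * (1 + 2 * ‖B‖ / lambdaMin R * h + √(2 * ‖A‖ / lambdaMin R) * √h) := by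
    positivity
  simp only [heterogeneityLevel]
  constructor
  · refine mul_pos (div_pos hq hden) (lt_min one_pos (lt_min ?_ ?_)) <;> positivity
  · rw [mul_right_comm, div_mul_cancel₀ _ hden.ne']
    exact mul_le_of_le_one_right hq.le (min_le_left _ _)

/-- The Lyapunov identity gives λ‖v‖² ≤ 2‖Tv‖‖TMv‖ ≤ 2‖Tv‖·√h μ‖v‖. Cancelling ‖v‖ bounds T from
below, which yields invertibility and a uniform bound on T⁻¹. -/
theorem eucl_le_of_lyapunov {M T W : Matrix (Fin n) (Fin n) ℝ} {h lam μ : ℝ} (hh : 0 ≤ h)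
    (hμ0 : 0 ≤ μ) (hT : ∀ v, eucl (T *ᵥ v) ^ 2 ≤ h * eucl v ^ 2)
    (hlyap : ∀ v, (T *ᵥ v) ⬝ᵥ (T *ᵥ (M *ᵥ v)) = -(1 / 2) * quadForm W v)
    (hWlow : ∀ v, lam * eucl v ^ 2 ≤ quadForm W v) (hMμ : ‖M‖ ≤ μ) (v : Fin n → ℝ) :
    lam * eucl v ≤ 2 * √h * μ * eucl (T *ᵥ v) := by
  by_cases hv : v = 0
  · rw [hv, eucl_eq_zero.2 rfl, mul_zero]
    exact mul_nonneg (by positivity) (eucl_nonneg _)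
  have hv0 := eucl_pos hv
  refine le_of_mul_le_mul_right ?_ hv0
  have h1 := abs_dotProduct_le (T *ᵥ v) (T *ᵥ (M *ᵥ v))
  rw [hlyap v] at h1
  have h2 := neg_abs_le (-(1 / 2) * quadForm W v)
  have h3 : eucl (T *ᵥ (M *ᵥ v)) ≤ √h * (μ * eucl v) := by
    refine (eucl_mulVec_le_sqrt hh hT _).trans ?_
    have := (eucl_mulVec_le M v).trans (mul_le_mul_of_nonneg_right hMμ hv0.le)
    gcongr
  have h4 := mul_le_mul_of_nonneg_left h3 (eucl_nonneg (T *ᵥ v))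
  have h5 := hWlow v
  linarith

/-- A Lyapunov function of `M` decreases along the Euler step of a nearby matrix `M'`. -/
theorem eucl_euler_step_sq_le {M M' T W : Matrix (Fin n) (Fin n) ℝ} {h lam μ η : ℝ} (hh : 0 < h)
    (hlam : 0 < lam) (hη : 0 < η) (hηle : η * (h * μ ^ 2) ≤ lam / 8)
    (hT : ∀ v, eucl (T *ᵥ v) ^ 2 ≤ h * eucl v ^ 2)
    (hlyap : ∀ v, (T *ᵥ v) ⬝ᵥ (T *ᵥ (M *ᵥ v)) = -(1 / 2) * quadForm W v)
    (hWlow : ∀ v, lam * eucl v ^ 2 ≤ quadForm W v)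
    (hdiff : ‖M' - M‖ ≤ 3 * lam / (8 * h)) (hM'μ : ‖M'‖ ≤ μ) (v : Fin n → ℝ) :
    eucl (T *ᵥ (v + η • (M' *ᵥ v))) ^ 2 ≤ (1 - η * lam / (8 * h)) * eucl (T *ᵥ v) ^ 2 := by
  have hv0 := eucl_nonneg v
  -- The nominal decrease λ/2 loses √h·√h·3λ/(8h) = 3λ/8 to the perturbation, which leaves λ/8.
  have h1 : (T *ᵥ v) ⬝ᵥ (T *ᵥ (M' *ᵥ v)) ≤ -(lam / 8) * eucl v ^ 2 := by
    have e : M' *ᵥ v = M *ᵥ v + (M' - M) *ᵥ v := by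
      rw [← Matrix.add_mulVec, add_sub_cancel]
    rw [e, Matrix.mulVec_add, dotProduct_add, hlyap v]
    have h2 := dotProduct_le (T *ᵥ v) (T *ᵥ ((M' - M) *ᵥ v))
    have h3 : eucl (T *ᵥ ((M' - M) *ᵥ v)) ≤ √h * (3 * lam / (8 * h) * eucl v) := by
      refine (eucl_mulVec_le_sqrt hh.le hT _).trans ?_
      have := (eucl_mulVec_le (M' - M) v).trans (mul_le_mul_of_nonneg_right hdiff hv0)
      gcongr
    have h4 := mul_le_mul (eucl_mulVec_le_sqrt hh.le hT v) h3 (eucl_nonneg _) (by positivity)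
    have h5 : √h * eucl v * (√h * (3 * lam / (8 * h) * eucl v)) =
        3 * lam / 8 * eucl v ^ 2 := by
      calc _ = (√h * √h) * (3 * lam / (8 * h)) * eucl v ^ 2 := by ring
        _ = _ := by rw [Real.mul_self_sqrt hh.le]; field_simp
    have h6 := hWlow v
    linarith
  have h2 : eucl (T *ᵥ (M' *ᵥ v)) ^ 2 ≤ h * μ ^ 2 * eucl v ^ 2 := by
    refine (hT _).trans ?_
    have := (eucl_mulVec_le M' v).trans (mul_le_mul_of_nonneg_right hM'μ hv0)
    calc h * eucl (M' *ᵥ v) ^ 2 ≤ h * (μ * eucl v) ^ 2 := by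
          have := eucl_nonneg (M' *ᵥ v)
          gcongr
      _ = _ := by ring
  have h3 : eucl (T *ᵥ (v + η • (M' *ᵥ v))) ^ 2 = eucl (T *ᵥ v) ^ 2 +
      2 * η * ((T *ᵥ v) ⬝ᵥ (T *ᵥ (M' *ᵥ v))) + η ^ 2 * eucl (T *ᵥ (M' *ᵥ v)) ^ 2 := by
    rw [Matrix.mulVec_add, Matrix.mulVec_smul]
    simp only [eucl_sq, add_dotProduct, dotProduct_add, smul_dotProduct, dotProduct_smul,
      smul_eq_mul, dotProduct_comm (T *ᵥ (M' *ᵥ v)) (T *ᵥ v)]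
    ring
  -- The second-order term eats half of the first-order decrease 2η·λ/8. The other half dominates
  -- ηλ/(8h)·‖Tv‖² because ‖Tv‖² ≤ h‖v‖².
  have h4 : η ^ 2 * eucl (T *ᵥ (M' *ᵥ v)) ^ 2 ≤ η * (lam / 8) * eucl v ^ 2 := by
    calc η ^ 2 * eucl (T *ᵥ (M' *ᵥ v)) ^ 2 ≤ η ^ 2 * (h * μ ^ 2 * eucl v ^ 2) := by gcongr
      _ = η * (η * (h * μ ^ 2)) * eucl v ^ 2 := by ring
      _ ≤ η * (lam / 8) * eucl v ^ 2 := by gcongr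
  have h5 : η * lam / (8 * h) * eucl (T *ᵥ v) ^ 2 ≤ η * (lam / 8) * eucl v ^ 2 := by
    calc η * lam / (8 * h) * eucl (T *ᵥ v) ^ 2 ≤ η * lam / (8 * h) * (h * eucl v ^ 2) := by
          have := hT v
          gcongr
      _ = _ := by field_simp
  have h6 := mul_le_mul_of_nonneg_left h1 (by positivity : 0 ≤ 2 * η)
  rw [h3]
  linarith

theorem norm_conj_euler_step_le {M T Ti : Matrix (Fin n) (Fin n) ℝ} {η c q : ℝ} (hTTi : T * Ti = 1)
    (hq : 0 ≤ q) (hqc : c ≤ q ^ 2)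
    (hstep : ∀ v, eucl (T *ᵥ (v + η • (M *ᵥ v))) ^ 2 ≤ c * eucl (T *ᵥ v) ^ 2) :
    ‖T * (1 + η • M) * Ti‖ ≤ q := by
  refine opNorm_le_of_eucl hq fun w => ?_
  have hw : T *ᵥ (Ti *ᵥ w) = w := by rw [Matrix.mulVec_mulVec, hTTi, Matrix.one_mulVec]
  have e : (T * (1 + η • M) * Ti) *ᵥ w = T *ᵥ (Ti *ᵥ w + η • (M *ᵥ (Ti *ᵥ w))) := by
    rw [← Matrix.mulVec_mulVec, ← Matrix.mulVec_mulVec, Matrix.add_mulVec,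
      Matrix.one_mulVec, Matrix.smul_mulVec]
  rw [e]
  refine (sq_le_sq₀ (eucl_nonneg _) (mul_nonneg hq (eucl_nonneg w))).1 ?_
  rw [mul_pow]
  refine (hstep _).trans ?_
  rw [hw]
  gcongr

theorem closedLoop_sub_closedLoop (A A' : Matrix (Fin n) (Fin n) ℝ)
    (B B' : Matrix (Fin n) (Fin m) ℝ) (K : Matrix (Fin m) (Fin n) ℝ) :
    closedLoop A' B' K - closedLoop A B K = (A' - A) - (B' - B) * K := by
  rw [closedLoop, closedLoop, Matrix.sub_mul]
  abel

/-- Over the sublevel set there are uniformly bounded coordinates in which the Euler steps of all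
closed loops with sufficiently similar data are uniform contractions. -/
theorem exists_contraction {A : Matrix (Fin n) (Fin n) ℝ} {B : Matrix (Fin n) (Fin m) ℝ}
    {Q : Matrix (Fin n) (Fin n) ℝ} {R : Matrix (Fin m) (Fin m) ℝ} (hn : 0 < n) (hQ : Q.PosDef)
    (hR : R.PosDef) {h ε : ℝ} (hh : 0 < h) (hε : 0 < ε)
    (hε' : ε * (4 * h * (1 + 2 * ‖B‖ / lambdaMin R * h +
      √(2 * ‖A‖ / lambdaMin R) * √h)) ≤ lambdaMin Q) :
    ∃ κ τ η q : ℝ, 0 ≤ κ ∧ 0 < τ ∧ 0 < η ∧ 0 < q ∧ q < 1 ∧ ∀ K ∈ sublevel A B Q R h,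
      ‖K‖ ≤ κ ∧ ∃ T Ti : Matrix (Fin n) (Fin n) ℝ, T * Ti = 1 ∧ Ti * T = 1 ∧ ‖T‖ ≤ τ ∧ ‖Ti‖ ≤ τ ∧
        ∀ (A' : Matrix (Fin n) (Fin n) ℝ) (B' : Matrix (Fin n) (Fin m) ℝ),
          ‖A' - A‖ ≤ 3 / 2 * ε → ‖B' - B‖ ≤ 3 / 2 * ε →
          ‖T * (1 + η • closedLoop A' B' K) * Ti‖ ≤ q := by
  set lam := lambdaMin Q with hlam
  have hlam0 : 0 < lam := lambdaMin_pos hn hQ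
  set κ := 2 * ‖B‖ / lambdaMin R * h + √(2 * ‖A‖ / lambdaMin R) * √h with hκ
  have hκ0 : 0 ≤ κ := by
    have hr : 0 ≤ lambdaMin R := by
      rcases Nat.eq_zero_or_pos m with rfl | hm
      · rw [lambdaMin_of_isEmpty]
      · exact (lambdaMin_pos hm hR).le
    positivity
  have hε4 : ε * (1 + κ) ≤ lam / (4 * h) := by
    rw [le_div_iff₀ (by positivity)]
    calc _ = ε * (4 * h * (1 + 2 * ‖B‖ / lambdaMin R * h +
      √(2 * ‖A‖ / lambdaMin R) * √h)) := by rw [hκ]; ring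
      _ ≤ lam := hε'
  set μ := ‖A‖ + ‖B‖ * κ with hμ
  have hμ0 : 0 ≤ μ := by positivity
  -- A norm bound for all perturbed closed loops; η is then small enough that ηhμ'² ≤ λ/8.
  set μ' := μ + 3 * lam / (8 * h) with hμ'
  have hμ'0 : 0 ≤ μ' := by positivity
  set η := lam / (8 * h * (μ' ^ 2 + 1)) with hη
  have hη0 : 0 < η := by positivity
  have hηle : η * (h * μ' ^ 2) ≤ lam / 8 := by
    have h1 : η * (h * (μ' ^ 2 + 1)) = lam / 8 := by rw [hη]; field_simp
    have h2 : 0 ≤ η * h := by positivity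
    nlinarith
  set c := η * lam / (8 * h) with hc
  have hc0 : 0 < c := by positivity
  -- The entries of the first maximum bound T and T⁻¹. The contraction factor comes from 1 - c ≤ (1
  -- - c/2)², and the entry 1/2 keeps it positive.
  refine ⟨κ, max (√h) (2 * √h * μ / lam), η, max (1 / 2) (1 - c / 2), hκ0,
    lt_max_of_lt_left (Real.sqrt_pos.2 hh), hη0, lt_max_of_lt_left (by norm_num),
    max_lt (by norm_num) (by linarith), fun K hK => ?_⟩
  set M := closedLoop A B K with hM
  set W := stateWeight Q R K with hW
  have hWpsd : W.PosSemidef := by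
    have h1 := hR.posSemidef.conjTranspose_mul_mul_same K
    rw [Matrix.conjTranspose_eq_transpose_of_trivial] at h1
    exact hQ.posSemidef.add h1
  obtain ⟨T, hT, hlyap⟩ := exists_lyapunov (M := M) hWpsd hh.le (by
    rw [← systemCost_eq hQ hR]; exact hK.2)
  have hKκ : ‖K‖ ≤ κ := norm_gain_le hQ hR hh hT hlyap
  refine ⟨hKκ, ?_⟩
  have hMμ : ‖M‖ ≤ μ := by
    rw [hM, closedLoop, hμ]
    refine (norm_sub_le _ _).trans ?_
    gcongr
    exact (Matrix.l2_opNorm_mul _ _).trans (by gcongr)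
  have hWlow : ∀ v, lam * eucl v ^ 2 ≤ quadForm W v := fun v => by
    rw [hW, quadForm_stateWeight]
    have := lambdaMin_mul_eucl_sq_le hQ v
    have := quadForm_nonneg_of_posDef hR (K *ᵥ v)
    linarith
  have hlow := eucl_le_of_lyapunov hh.le hμ0 hT hlyap hWlow hMμ
  have hinj : Function.Injective T.mulVec := by
    intro u v huv
    have h1 := hlow (u - v)
    have h2 : T *ᵥ (u - v) = 0 := by rw [Matrix.mulVec_sub]; exact sub_eq_zero.2 huv
    rw [h2, eucl_eq_zero.2 rfl, mul_zero] at h1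
    have h3 : eucl (u - v) = 0 :=
      le_antisymm (nonpos_of_mul_nonpos_right h1 hlam0) (eucl_nonneg _)
    exact sub_eq_zero.1 (eucl_eq_zero.1 h3)
  obtain ⟨U, hU⟩ := Matrix.mulVec_injective_iff_isUnit.1 hinj
  have hTTi : T * (U⁻¹ : (Matrix (Fin n) (Fin n) ℝ)ˣ) = 1 := by rw [← hU]; exact U.mul_inv
  have hTiT : (U⁻¹ : (Matrix (Fin n) (Fin n) ℝ)ˣ) * T = 1 := by rw [← hU]; exact U.inv_mul
  refine ⟨T, (U⁻¹ : (Matrix (Fin n) (Fin n) ℝ)ˣ), hTTi, hTiT, ?_, ?_, ?_⟩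
  · exact le_max_of_le_left (opNorm_le_of_eucl (Real.sqrt_nonneg h)
      (eucl_mulVec_le_sqrt hh.le hT))
  · refine le_max_of_le_right (opNorm_le_of_eucl (by positivity) fun v => ?_)
    have h1 := hlow ((U⁻¹ : (Matrix (Fin n) (Fin n) ℝ)ˣ) *ᵥ v)
    rw [Matrix.mulVec_mulVec, hTTi, Matrix.one_mulVec] at h1
    rw [div_mul_eq_mul_div, le_div_iff₀ hlam0, mul_comm]
    exact h1
  · intro A' B' hA' hB'
    set M' := closedLoop A' B' K with hM'
    -- Data at distance ε would give λ/(4h); the factor 3/2 is room for the polynomial approximants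
    -- and still stays below the critical λ/(2h).
    have hdiff : ‖M' - M‖ ≤ 3 * lam / (8 * h) := by
      have h1 : ‖(B' - B) * K‖ ≤ 3 / 2 * ε * κ :=
        (Matrix.l2_opNorm_mul _ _).trans (mul_le_mul hB' hKκ (norm_nonneg _) (by positivity))
      rw [hM', hM, closedLoop_sub_closedLoop]
      refine (norm_sub_le _ _).trans ((add_le_add hA' h1).trans ?_)
      calc 3 / 2 * ε + 3 / 2 * ε * κ = 3 / 2 * (ε * (1 + κ)) := by ring
        _ ≤ 3 / 2 * (lam / (4 * h)) := by gcongr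
        _ = 3 * lam / (8 * h) := by field_simp; ring
    have hM'μ : ‖M'‖ ≤ μ' := by
      calc ‖M'‖ = ‖M + (M' - M)‖ := by rw [add_sub_cancel]
        _ ≤ μ + 3 * lam / (8 * h) := (norm_add_le _ _).trans (add_le_add hMμ hdiff)
    set q := max (1 / 2) (1 - c / 2) with hq
    have hq0 : 0 ≤ q := le_max_of_le_left (by norm_num)
    have hqc : 1 - c ≤ q ^ 2 := by
      have h1 : 1 - c / 2 ≤ q := le_max_right _ _
      rcases le_or_gt 0 (1 - c / 2) with h2 | h2
      · nlinarith [mul_le_mul h1 h1 h2 hq0]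
      · nlinarith
    exact norm_conj_euler_step_le hTTi hq0 hqc
      (eucl_euler_step_sq_le hh hlam0 hη0 hηle hT hlyap hWlow hdiff hM'μ)

end Contraction

end PCELQR

namespace PCELQR

/-! ### Polynomial approximation of the data -/

section DataApproximation

variable {n m k l : ℕ} {a b : ℝ}

/-- Analyticity enters as smoothness of the entries; the entrywise errors are summed with the norms
of the matrix units. -/
theorem exists_matrix_polynomial_approx (hab : a < b) {F : ℝ → Matrix (Fin n) (Fin k) ℝ}
    (hF : AnalyticOn ℝ F (Set.Icc a b)) (p : ℕ) :
    ∃ C : ℝ, 0 ≤ C ∧ ∀ d : ℕ, 1 ≤ d → ∃ F' : ℝ → Matrix (Fin n) (Fin k) ℝ,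
      (∀ i j, IsPolyLE d fun ξ => F' ξ i j) ∧
      ∀ ξ ∈ Set.Icc a b, ‖F ξ - F' ξ‖ ≤ C / (d : ℝ) ^ p := by
  have hsmooth : ∀ i j, ContDiffOn ℝ (⊤ : ℕ∞) (fun ξ => F ξ i j) (Set.Icc a b) := fun i j =>
    (hF.contDiffOn (uniqueDiffOn_Icc hab)).continuousLinearMap_comp
      (LinearMap.toContinuousLinearMap (Matrix.entryLinearMap ℝ ℝ i j))
  choose C hC happ using fun i j => exists_polynomial_approx hab (hsmooth i j) p
  refine ⟨∑ i, ∑ j, C i j * ‖Matrix.single i j (1 : ℝ)‖, Finset.sum_nonneg fun i _ =>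
    Finset.sum_nonneg fun j _ => mul_nonneg (hC i j) (norm_nonneg _), fun d hd => ?_⟩
  choose P hP hPx using fun i j => happ i j d hd
  refine ⟨fun ξ => Matrix.of fun i j => (P i j).eval ξ,
    fun i j => ⟨P i j, hP i j, fun ξ => rfl⟩, fun ξ hξ => ?_⟩
  rw [Matrix.matrix_eq_sum_single (F ξ - Matrix.of fun i j => (P i j).eval ξ), Finset.sum_div]
  refine norm_sum_le_of_le _ fun i _ => ?_
  rw [Finset.sum_div]
  refine norm_sum_le_of_le _ fun j _ => ?_
  have e : Matrix.single i j ((F ξ - Matrix.of fun i j => (P i j).eval ξ) i j) =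
      (F ξ i j - (P i j).eval ξ) • Matrix.single i j (1 : ℝ) := by
    rw [Matrix.smul_single, smul_eq_mul, mul_one]
    rfl
  rw [e, norm_smul, Real.norm_eq_abs, mul_div_right_comm]
  exact mul_le_mul_of_nonneg_right (hPx i j ξ hξ) (norm_nonneg _)

/-- Polynomial approximations of nearly constant data that are themselves nearly constant. -/
theorem exists_data_approx (hab : a < b) {A : ℝ → Matrix (Fin n) (Fin n) ℝ}
    {B : ℝ → Matrix (Fin n) (Fin m) ℝ} (hA : AnalyticOn ℝ A (Set.Icc a b))
    (hB : AnalyticOn ℝ B (Set.Icc a b)) {ξ₀ ε : ℝ} (hε : 0 < ε)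
    (hAε : ∀ ξ ∈ Set.Icc a b, ‖A ξ - A ξ₀‖ ≤ ε) (hBε : ∀ ξ ∈ Set.Icc a b, ‖B ξ - B ξ₀‖ ≤ ε)
    (p : ℕ) :
    ∃ C : ℝ, 0 ≤ C ∧ ∀ d : ℕ, 1 ≤ d → ∃ A' : ℝ → Matrix (Fin n) (Fin n) ℝ,
      ∃ B' : ℝ → Matrix (Fin n) (Fin m) ℝ,
      (∀ i j, IsPolyLE d fun ξ => A' ξ i j) ∧ (∀ i j, IsPolyLE d fun ξ => B' ξ i j) ∧
      ∀ ξ ∈ Set.Icc a b, ‖A ξ - A' ξ‖ ≤ C / (d : ℝ) ^ p ∧ ‖B ξ - B' ξ‖ ≤ C / (d : ℝ) ^ p ∧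
        ‖A' ξ - A ξ₀‖ ≤ 3 / 2 * ε ∧ ‖B' ξ - B ξ₀‖ ≤ 3 / 2 * ε := by
  obtain ⟨CA, hCA, happA⟩ := exists_matrix_polynomial_approx hab hA p
  obtain ⟨CB, hCB, happB⟩ := exists_matrix_polynomial_approx hab hB p
  have hCm : 0 ≤ max CA CB := hCA.trans (le_max_left _ _)
  refine ⟨2 * max CA CB, by positivity, fun d hd => ?_⟩
  have hd0 : (0 : ℝ) < (d : ℝ) ^ p := by
    have : (0 : ℝ) < d := by exact_mod_cast hd
    positivity
  have hm0 : 0 ≤ max CA CB / (d : ℝ) ^ p := by positivity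
  rw [mul_div_assoc]
  -- An error of at most ε/2 keeps the approximants within 3ε/2 of the nominal data. A larger bound
  -- is met trivially by the constant nominal data, whose error ε is below twice that bound; hence
  -- the doubled constant.
  rcases le_or_gt (max CA CB / (d : ℝ) ^ p) (ε / 2) with h | h
  · obtain ⟨A', hA', hAA'⟩ := happA d hd
    obtain ⟨B', hB', hBB'⟩ := happB d hd
    have h1 : CA / (d : ℝ) ^ p ≤ max CA CB / (d : ℝ) ^ p := by gcongr; exact le_max_left _ _
    have h2 : CB / (d : ℝ) ^ p ≤ max CA CB / (d : ℝ) ^ p := by gcongr; exact le_max_right _ _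
    refine ⟨A', B', hA', hB', fun ξ hξ => ?_⟩
    have h3 := (hAA' ξ hξ).trans h1
    have h4 := (hBB' ξ hξ).trans h2
    refine ⟨by linarith, by linarith, ?_, ?_⟩
    · have := norm_add_le (A' ξ - A ξ) (A ξ - A ξ₀)
      rw [sub_add_sub_cancel, norm_sub_rev (A' ξ) (A ξ)] at this
      linarith [hAε ξ hξ]
    · have := norm_add_le (B' ξ - B ξ) (B ξ - B ξ₀)
      rw [sub_add_sub_cancel, norm_sub_rev (B' ξ) (B ξ)] at this
      linarith [hBε ξ hξ]
  · refine ⟨fun _ => A ξ₀, fun _ => B ξ₀, fun i j => IsPolyLE.const _ _,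
      fun i j => IsPolyLE.const _ _, fun ξ hξ => ?_⟩
    have h1 := hAε ξ hξ
    have h2 := hBε ξ hξ
    refine ⟨by linarith, by linarith, ?_, ?_⟩ <;> rw [sub_self, norm_zero] <;> positivity

theorem IsPolyLE.add {d : ℕ} {f g : ℝ → ℝ} (hf : IsPolyLE d f) (hg : IsPolyLE d g) :
    IsPolyLE d fun ξ => f ξ + g ξ := by
  obtain ⟨P, hP, hf⟩ := hf
  obtain ⟨Q, hQ, hg⟩ := hg
  exact ⟨P + Q, Polynomial.natDegree_add_le_of_degree_le hP hQ, fun ξ => by simp [hf, hg]⟩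

theorem IsPolyLE.const_mul {d : ℕ} {f : ℝ → ℝ} (c : ℝ) (hf : IsPolyLE d f) :
    IsPolyLE d fun ξ => c * f ξ := by
  simpa using (IsPolyLE.const c 0).mul hf

theorem isPolyLE_const_matrix_mul {d : ℕ} {F : ℝ → Matrix (Fin n) (Fin k) ℝ}
    (hF : ∀ i j, IsPolyLE d fun ξ => F ξ i j) (G : Matrix (Fin l) (Fin n) ℝ) :
    ∀ i j, IsPolyLE d fun ξ => (G * F ξ) i j := fun i j => by
  simp only [Matrix.mul_apply]
  exact IsPolyLE.sum _ fun x => (hF x j).const_mul _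

theorem isPolyLE_matrix_mul_const {d : ℕ} {F : ℝ → Matrix (Fin n) (Fin k) ℝ}
    (hF : ∀ i j, IsPolyLE d fun ξ => F ξ i j) (G : Matrix (Fin k) (Fin l) ℝ) :
    ∀ i j, IsPolyLE d fun ξ => (F ξ * G) i j := fun i j => by
  simp only [Matrix.mul_apply, mul_comm _ (G _ _)]
  exact IsPolyLE.sum _ fun x => (hF i x).const_mul _

theorem isPolyLE_closedLoop {d : ℕ} {A : ℝ → Matrix (Fin n) (Fin n) ℝ}
    {B : ℝ → Matrix (Fin n) (Fin m) ℝ} (hA : ∀ i j, IsPolyLE d fun ξ => A ξ i j)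
    (hB : ∀ i j, IsPolyLE d fun ξ => B ξ i j) (K : Matrix (Fin m) (Fin n) ℝ) :
    ∀ i j, IsPolyLE d fun ξ => closedLoop (A ξ) (B ξ) K i j := fun i j => by
  have e : (fun ξ => closedLoop (A ξ) (B ξ) K i j) =
      fun ξ => A ξ i j + -1 * (B ξ * K) i j := by
    funext ξ
    rw [closedLoop, Matrix.sub_apply]
    ring
  rw [e]
  exact (hA i j).add ((isPolyLE_matrix_mul_const hB K i j).const_mul _)

end DataApproximation

/-! ### The state error of the surrogate -/

section StateError

variable {n : ℕ} {a b : ℝ}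

theorem one_kronecker_mulVec {ι : Type*} [Fintype ι] [DecidableEq ι] {κ l : Type*} [Fintype κ]
    (G : Matrix l κ ℝ) (z : ι × κ → ℝ) (i : ι) (x : l) :
    (((1 : Matrix ι ι ℝ) ⊗ₖ G) *ᵥ z) (i, x) = (G *ᵥ fun y => z (i, y)) x := by
  simp only [Matrix.mulVec, dotProduct, Matrix.kroneckerMap_apply, Fintype.sum_prod_type,
    Matrix.one_apply, ite_mul, one_mul, zero_mul]
  rw [Finset.sum_comm]
  simp

theorem one_kronecker_mulVec_surrogateInit (N : ℕ) (G : Matrix (Fin n) (Fin n) ℝ) (v : Fin n → ℝ) :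
    ((1 : Matrix (Fin (N + 1)) (Fin (N + 1)) ℝ) ⊗ₖ G) *ᵥ surrogateInit N v =
      surrogateInit N (G *ᵥ v) := by
  funext ⟨i, x⟩
  rw [one_kronecker_mulVec]
  by_cases h : i = 0 <;> simp [surrogateInit, h, Matrix.mulVec, dotProduct]

theorem expand_one_kronecker_mulVec (N : ℕ) (G : Matrix (Fin n) (Fin n) ℝ)
    (z : Fin (N + 1) × Fin n → ℝ) (ξ : ℝ) :
    expand a b N (((1 : Matrix (Fin (N + 1)) (Fin (N + 1)) ℝ) ⊗ₖ G) *ᵥ z) ξ =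
      G *ᵥ expand a b N z ξ := by
  funext x
  simp only [expand, one_kronecker_mulVec]
  simp only [expand, Matrix.mulVec, dotProduct, Finset.sum_mul, Finset.mul_sum]
  rw [Finset.sum_comm]
  exact Finset.sum_congr rfl fun i _ => Finset.sum_congr rfl fun j _ => by ring

theorem expand_sub (N : ℕ) (z w : Fin (N + 1) × Fin n → ℝ) (ξ : ℝ) :
    expand a b N (z - w) ξ = expand a b N z ξ - expand a b N w ξ := by
  funext x
  simp [expand, sub_mul, Finset.sum_sub_distrib]

theorem expand_smul (N : ℕ) (c : ℝ) (z : Fin (N + 1) × Fin n → ℝ) (ξ : ℝ) :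
    expand a b N (c • z) ξ = c • expand a b N z ξ := by
  funext x
  simp [expand, Finset.mul_sum, mul_assoc]

theorem eucl_surrogateInit (N : ℕ) (v : Fin n → ℝ) : eucl (surrogateInit N v) = eucl v := by
  rw [← sq_eq_sq₀ (eucl_nonneg _) (eucl_nonneg _), eucl_sq_eq_sum, eucl_sq_eq_sum,
    Fintype.sum_prod_type]
  simp only [surrogateInit]
  rw [Finset.sum_eq_single 0] <;> simp +contextual

/-- The coordinates that contract every individual system also contract the surrogate: its Euler
step, conjugated by 1 ⊗ T, is the projection of a function of norm at most q. -/
theorem lift_conj_euler_step (hab : a < b) (N : ℕ) {M : ℝ → Matrix (Fin n) (Fin n) ℝ}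
    (hM : ContinuousOn M (Set.Icc a b)) {T Ti : Matrix (Fin n) (Fin n) ℝ} (η : ℝ) :
    lift a b N (fun ξ => T * (1 + η • M ξ) * Ti) =
      ((1 : Matrix (Fin (N + 1)) (Fin (N + 1)) ℝ) ⊗ₖ T) * (1 + η • lift a b N M) *
        ((1 : Matrix (Fin (N + 1)) (Fin (N + 1)) ℝ) ⊗ₖ Ti) := by
  have h1 : ContinuousOn (fun ξ => η • M ξ) (Set.Icc a b) := hM.const_smul η
  have h2 : ContinuousOn (fun ξ => 1 + η • M ξ) (Set.Icc a b) := continuousOn_const.add h1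
  have h3 : ContinuousOn (fun ξ => T * (1 + η • M ξ)) (Set.Icc a b) :=
    (continuous_const.matrix_mul continuous_id).comp_continuousOn h2
  rw [lift_mul_const hab N h3, lift_const_mul hab N h2, lift_add hab N continuousOn_const h1,
    lift_one hab, lift_smul]

theorem kronecker_mul_kronecker_eq_one (N : ℕ) {T Ti : Matrix (Fin n) (Fin n) ℝ} (h : T * Ti = 1) :
    ((1 : Matrix (Fin (N + 1)) (Fin (N + 1)) ℝ) ⊗ₖ T) *
      ((1 : Matrix (Fin (N + 1)) (Fin (N + 1)) ℝ) ⊗ₖ Ti) = 1 := by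
  rw [← Matrix.mul_kronecker_mul, h, one_mul, Matrix.one_kronecker_one]

/-- For polynomial data the low-order part of the exponential series commutes with the Galerkin
projection. -/
theorem expand_expPart (hab : a < b) {N d s : ℕ} {F : ℝ → Matrix (Fin n) (Fin n) ℝ}
    (hF : ∀ i j, IsPolyLE d fun ξ => F ξ i j) (hs : s * d ≤ N) (τ : ℝ) (v : Fin n → ℝ) (ξ : ℝ) :
    expand a b N (expPart (Finset.range (s + 1)) τ (lift a b N F) *ᵥ surrogateInit N v) ξ =
      expPart (Finset.range (s + 1)) τ (F ξ) *ᵥ v := by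
  simp only [expPart, Matrix.sum_mulVec, Matrix.smul_mulVec]
  rw [expand_sum]
  refine Finset.sum_congr rfl fun r hr => ?_
  rw [expand_lift_pow hab hF v r]
  rw [Finset.mem_range] at hr
  exact le_trans (by gcongr; omega) hs

/-- Truncated exponential series of contractions of norm at most `q` approximate exponentials. -/
def TruncatedExpBound (q r C : ℝ) : Prop :=
  ∀ {ι : Type} [Fintype ι] [DecidableEq ι] {S S' : Matrix ι ι ℝ} {δ τ : ℝ} (m : ℕ),
    0 ≤ τ → ‖S‖ ≤ q → ‖S'‖ ≤ q → ‖S - S'‖ ≤ δ →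
    ‖NormedSpace.exp (τ • S) - expPart (Finset.range (m + 1)) τ S'‖ ≤
      C * (δ + r ^ m) * Real.exp (τ * r)

theorem TruncatedExpBound.eucl_le {q r C : ℝ} (hC : TruncatedExpBound q r C) {ι : Type} [Fintype ι]
    [DecidableEq ι] {S S' : Matrix ι ι ℝ} {δ η t : ℝ} (s : ℕ) (hη : 0 < η) (ht : 0 ≤ t)
    (hS : ‖S‖ ≤ q) (hS' : ‖S'‖ ≤ q) (hδ : ‖S - S'‖ ≤ δ) (w : ι → ℝ) :
    eucl (Real.exp (-(t / η)) • ((NormedSpace.exp ((t / η) • S) -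
      expPart (Finset.range (s + 1)) (t / η) S') *ᵥ w)) ≤
      C * (δ + r ^ s) * Real.exp (-((1 - r) / η) * t) * eucl w := by
  have h1 := hC s (div_nonneg ht hη.le) hS hS' hδ
  rw [eucl_smul, abs_of_pos (Real.exp_pos _)]
  calc _ ≤ Real.exp (-(t / η)) * (C * (δ + r ^ s) * Real.exp (t / η * r) * eucl w) := by
        gcongr
        exact (eucl_mulVec_le _ _).trans (mul_le_mul_of_nonneg_right h1 (eucl_nonneg w))
    _ = C * (δ + r ^ s) * (Real.exp (-(t / η)) * Real.exp (t / η * r)) * eucl w := by ring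
    _ = _ := by
      rw [← Real.exp_add]
      congr 3
      field_simp
      ring

/-- The state error of the surrogate is the difference of two terms, one small in mean square and
one small uniformly. -/
theorem exists_state_error (hab : a < b) {N d s : ℕ} (hs : s * d ≤ N)
    {M M' : ℝ → Matrix (Fin n) (Fin n) ℝ} (hM : ContinuousOn M (Set.Icc a b))
    (hM' : ∀ i j, IsPolyLE d fun ξ => M' ξ i j) {T Ti : Matrix (Fin n) (Fin n) ℝ}
    (hTTi : T * Ti = 1) (hTiT : Ti * T = 1) {η q r C δ : ℝ} (hη : 0 < η)
    (hC : TruncatedExpBound q r C)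
    (hq : ∀ ξ ∈ Set.Icc a b, ‖T * (1 + η • M ξ) * Ti‖ ≤ q)
    (hq' : ∀ ξ ∈ Set.Icc a b, ‖T * (1 + η • M' ξ) * Ti‖ ≤ q)
    (hδ : ∀ ξ ∈ Set.Icc a b, ‖T * (1 + η • M ξ) * Ti - T * (1 + η • M' ξ) * Ti‖ ≤ δ)
    (v : Fin n → ℝ) :
    ∃ z : ℝ → Fin (N + 1) × Fin n → ℝ, Continuous z ∧ ∀ t, 0 ≤ t →
      eucl (z t) ≤ C * (δ + r ^ s) * Real.exp (-((1 - r) / η) * t) * eucl (T *ᵥ v) ∧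
      ∀ ξ ∈ Set.Icc a b, ∃ g : Fin n → ℝ,
        eucl g ≤ C * (δ + r ^ s) * Real.exp (-((1 - r) / η) * t) * eucl (T *ᵥ v) ∧
        expand a b N (flow (lift a b N M) t (surrogateInit N v)) ξ - flow (M ξ) t v =
          Ti *ᵥ (expand a b N (z t) ξ - g) := by
  set S : ℝ → Matrix (Fin n) (Fin n) ℝ := fun ξ => T * (1 + η • M ξ) * Ti with hS
  set S' : ℝ → Matrix (Fin n) (Fin n) ℝ := fun ξ => T * (1 + η • M' ξ) * Ti with hS'
  have hM'c : Continuous M' := continuous_of_isPolyLE hM'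
  have hSc : ContinuousOn S (Set.Icc a b) :=
    ((continuous_const.matrix_mul (continuous_const.add (continuous_id.const_smul η))).matrix_mul
      continuous_const).comp_continuousOn hM
  have hS'p : ∀ i j, IsPolyLE d fun ξ => S' ξ i j := by
    refine isPolyLE_matrix_mul_const (isPolyLE_const_matrix_mul (fun i j => ?_) T) Ti
    simp only [Matrix.add_apply, Matrix.smul_apply, smul_eq_mul]
    exact (IsPolyLE.const _ _).add ((hM' i j).const_mul _)
  have hS'c : ContinuousOn S' (Set.Icc a b) := (continuous_of_isPolyLE hS'p).continuousOn
  set w := T *ᵥ v with hw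
  set LS := lift a b N S with hLS
  set LS' := lift a b N S' with hLS'
  have h1 : ‖LS‖ ≤ q := norm_lift_le hab N hSc hq
  have h2 : ‖LS'‖ ≤ q := norm_lift_le hab N hS'c hq'
  have h3 : ‖LS - LS'‖ ≤ δ := by
    rw [hLS, hLS', ← lift_sub hab N hSc hS'c]
    exact norm_lift_le hab N (hSc.sub hS'c) hδ
  have hexpLS : Continuous fun t : ℝ => NormedSpace.exp ((t / η) • LS) :=
    (continuous_exp_smul LS).comp (continuous_id.div_const η)
  have hpart : Continuous fun t : ℝ => expPart (Finset.range (s + 1)) (t / η) LS' :=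
    continuous_finsetSum _ fun k _ =>
      (((continuous_id.div_const η).pow k).div_const _).smul continuous_const
  -- The remainder of the surrogate is kept as a coefficient vector, since Parseval controls its
  -- expansion only in mean square, not pointwise uniformly in N; the remainder g of the true system
  -- is bounded for each ξ.
  refine ⟨fun t => Real.exp (-(t / η)) • ((NormedSpace.exp ((t / η) • LS) -
    expPart (Finset.range (s + 1)) (t / η) LS') *ᵥ surrogateInit N w), ?_, fun t ht => ⟨?_, ?_⟩⟩
  · exact (Real.continuous_exp.comp (continuous_id.div_const η).neg).smul
      ((hexpLS.sub hpart).matrix_mulVec continuous_const)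
  · rw [← eucl_surrogateInit N w]
    exact hC.eucl_le s hη ht h1 h2 h3 _
  · intro ξ hξ
    refine ⟨Real.exp (-(t / η)) • ((NormedSpace.exp ((t / η) • S ξ) -
      expPart (Finset.range (s + 1)) (t / η) (S' ξ)) *ᵥ w),
      hC.eucl_le s hη ht (hq ξ hξ) (hq' ξ hξ) (hδ ξ hξ) _, ?_⟩
    have e1 : flow (M ξ) t v = Ti *ᵥ (Real.exp (-(t / η)) •
        (NormedSpace.exp ((t / η) • S ξ) *ᵥ w)) := by
      rw [flow, exp_smul_eq hTTi hTiT hη.ne', Matrix.smul_mulVec, ← Matrix.mulVec_mulVec,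
        ← Matrix.mulVec_mulVec, Matrix.mulVec_smul]
    have e2 : flow (lift a b N M) t (surrogateInit N v) =
        ((1 : Matrix (Fin (N + 1)) (Fin (N + 1)) ℝ) ⊗ₖ Ti) *ᵥ (Real.exp (-(t / η)) •
        (NormedSpace.exp ((t / η) • LS) *ᵥ surrogateInit N w)) := by
      rw [flow, exp_smul_eq (kronecker_mul_kronecker_eq_one N hTTi)
        (kronecker_mul_kronecker_eq_one N hTiT) hη.ne', Matrix.smul_mulVec, ← Matrix.mulVec_mulVec,
        ← Matrix.mulVec_mulVec, Matrix.mulVec_smul, ← lift_conj_euler_step hab N hM,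
        one_kronecker_mulVec_surrogateInit]
    -- By `expand_expPart` the two truncated series are the same function of ξ and cancel.
    rw [e1, e2, expand_one_kronecker_mulVec, ← Matrix.mulVec_sub, expand_smul, expand_smul,
      Matrix.sub_mulVec, Matrix.sub_mulVec, expand_sub, expand_expPart hab hS'p hs]
    congr 1
    module

end StateError

end PCELQR

namespace PCELQR

/-! ### The cost error of the surrogate -/

section CostError

open MeasureTheory

variable {n m : ℕ} {a b : ℝ}

theorem abs_quadForm_sub_le {ι : Type*} [Fintype ι] [DecidableEq ι] (W : Matrix ι ι ℝ)
    (x y : ι → ℝ) :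
    |quadForm W y - quadForm W x| ≤
      ‖W‖ * (eucl (y - x) ^ 2 + 2 * (eucl x * eucl (y - x))) := by
  obtain ⟨D, rfl⟩ : ∃ D, y = x + D := ⟨y - x, by rw [add_sub_cancel]⟩
  rw [add_sub_cancel_left]
  have e : quadForm W (x + D) - quadForm W x =
      x ⬝ᵥ (W *ᵥ D) + D ⬝ᵥ (W *ᵥ x) + D ⬝ᵥ (W *ᵥ D) := by
    simp only [quadForm, Matrix.mulVec_add, add_dotProduct, dotProduct_add]
    ring
  have hb : ∀ u v : ι → ℝ, |u ⬝ᵥ (W *ᵥ v)| ≤ ‖W‖ * (eucl u * eucl v) := fun u v => by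
    refine (abs_dotProduct_le _ _).trans ?_
    calc eucl u * eucl (W *ᵥ v) ≤ eucl u * (‖W‖ * eucl v) :=
          mul_le_mul_of_nonneg_left (eucl_mulVec_le _ _) (eucl_nonneg u)
      _ = _ := by ring
  rw [e]
  refine (abs_add_le _ _).trans ((add_le_add ((abs_add_le _ _).trans
    (add_le_add (hb x D) (hb D x))) (hb D D)).trans_eq ?_)
  ring

/-- Young's inequality with weight Δ splits the cross term of state and error. When the error is
O(Δ) in mean square, both Δ‖x‖² and ‖x' - x‖²/Δ are O(Δ), and only squares of y remain to be
integrated. -/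
theorem abs_quadForm_sub_le_of_error {ι : Type*} [Fintype ι] [DecidableEq ι]
    {W Ti : Matrix ι ι ℝ} {x x' y g : ι → ℝ} {ω τ Δ X G : ℝ} (hΔ : 0 < Δ) (hτ : 0 ≤ τ)
    (hW : ‖W‖ ≤ ω) (hTi : ‖Ti‖ ≤ τ) (hx : eucl x ≤ X) (hg : eucl g ≤ G)
    (he : x' - x = Ti *ᵥ (y - g)) :
    |quadForm W x' - quadForm W x| ≤
      ω * ((1 + 1 / Δ) * (2 * τ ^ 2 * (eucl y ^ 2 + G ^ 2)) + Δ * X ^ 2) := by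
  have hω : 0 ≤ ω := (norm_nonneg _).trans hW
  set D := eucl (x' - x) with hD
  have hD0 : 0 ≤ D := eucl_nonneg _
  have hx0 := eucl_nonneg x
  have hg0 := eucl_nonneg g
  have hy0 := eucl_nonneg y
  have hDle : D ^ 2 ≤ 2 * τ ^ 2 * (eucl y ^ 2 + G ^ 2) := by
    have h1 : D ≤ τ * (eucl y + G) := by
      rw [hD, he]
      refine (eucl_mulVec_le _ _).trans ?_
      have h2 := (eucl_sub_le y g).trans (add_le_add_right hg _)
      exact mul_le_mul hTi h2 (eucl_nonneg _) hτ
    calc D ^ 2 ≤ (τ * (eucl y + G)) ^ 2 := by gcongr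
      _ = τ ^ 2 * (eucl y + G) ^ 2 := by ring
      _ ≤ τ ^ 2 * (2 * (eucl y ^ 2 + G ^ 2)) := by
        gcongr
        nlinarith [sq_nonneg (eucl y - G)]
      _ = _ := by ring
  have hcross : 2 * (eucl x * D) ≤ Δ * X ^ 2 + 1 / Δ * D ^ 2 := by
    have h1 : 2 * (eucl x * D) ≤ Δ * eucl x ^ 2 + 1 / Δ * D ^ 2 := by
      have h2 : 0 ≤ 1 / Δ * (Δ * eucl x - D) ^ 2 := by positivity
      have h3 : 1 / Δ * (Δ * eucl x - D) ^ 2 =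
          Δ * eucl x ^ 2 + 1 / Δ * D ^ 2 - 2 * (eucl x * D) := by
        field_simp
        ring
      linarith
    have h4 : Δ * eucl x ^ 2 ≤ Δ * X ^ 2 := by gcongr
    linarith
  refine (abs_quadForm_sub_le W x x').trans (mul_le_mul hW ?_ (by positivity) hω)
  have h5 := mul_le_mul_of_nonneg_left hDle (by positivity : 0 ≤ 1 + 1 / Δ)
  linarith

theorem lintegral_ofReal_exp {c s : ℝ} (hc : 0 ≤ c) (hs : 0 < s) :
    ∫⁻ t in Set.Ici (0 : ℝ), ENNReal.ofReal (c * Real.exp (-s * t)) = ENNReal.ofReal (c / s) := by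
  have hint : IntegrableOn (fun t => c * Real.exp (-s * t)) (Set.Ici 0) := by
    rw [integrableOn_Ici_iff_integrableOn_Ioi]
    exact (integrableOn_exp_mul_Ioi (neg_lt_zero.2 hs) 0).const_mul c
  rw [← ofReal_integral_eq_lintegral_ofReal hint
    (Filter.Eventually.of_forall fun t => by positivity), integral_const_mul,
    integral_Ici_eq_integral_Ioi, integral_exp_mul_Ioi (neg_lt_zero.2 hs)]
  congr 1
  simp
  ring

/-- Only the error term must be measurable; the cost integrands involve data that are controlled
only on [a, b]. -/
theorem lintegral_lintegral_le_add {μ : Measure ℝ} {F G E : ℝ → ℝ → ℝ}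
    (hE : Continuous (Function.uncurry E))
    (h : ∀ᵐ ξ ∂μ, ∀ t, 0 ≤ t → F ξ t ≤ G ξ t + E ξ t) :
    ∫⁻ ξ, (∫⁻ t in Set.Ici (0 : ℝ), ENNReal.ofReal (F ξ t)) ∂μ ≤
      ∫⁻ ξ, (∫⁻ t in Set.Ici (0 : ℝ), ENNReal.ofReal (G ξ t)) ∂μ +
        ∫⁻ ξ, (∫⁻ t in Set.Ici (0 : ℝ), ENNReal.ofReal (E ξ t)) ∂μ := by
  have hm : Measurable fun p : ℝ × ℝ => ENNReal.ofReal (E p.1 p.2) :=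
    (ENNReal.continuous_ofReal.comp hE).measurable
  rw [← lintegral_add_right _ hm.lintegral_prod_right']
  refine lintegral_mono_ae ?_
  filter_upwards [h] with ξ hξ
  rw [← lintegral_add_right (fun t => ENNReal.ofReal (G ξ t))
    (g := fun t => ENNReal.ofReal (E ξ t)) (hm.comp measurable_prodMk_left)]
  refine setLIntegral_mono' measurableSet_Ici fun t ht => ?_
  exact (ENNReal.ofReal_le_ofReal (hξ t ht)).trans ENNReal.ofReal_add_le

theorem abs_toReal_sub_toReal_le {x y : ℝ≥0∞} {e : ℝ} (hx : x ≠ ⊤) (he : 0 ≤ e)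
    (hxy : x ≤ y + ENNReal.ofReal e) (hyx : y ≤ x + ENNReal.ofReal e) :
    y ≠ ⊤ ∧ |x.toReal - y.toReal| ≤ e := by
  have hy : y ≠ ⊤ :=
    (hyx.trans_lt (ENNReal.add_lt_top.2 ⟨hx.lt_top, ENNReal.ofReal_lt_top⟩)).ne
  refine ⟨hy, ?_⟩
  have h1 := ENNReal.toReal_mono (ENNReal.add_ne_top.2 ⟨hy, ENNReal.ofReal_ne_top⟩) hxy
  have h2 := ENNReal.toReal_mono (ENNReal.add_ne_top.2 ⟨hx, ENNReal.ofReal_ne_top⟩) hyx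
  rw [ENNReal.toReal_add hy ENNReal.ofReal_ne_top, ENNReal.toReal_ofReal he] at h1
  rw [ENNReal.toReal_add hx ENNReal.ofReal_ne_top, ENNReal.toReal_ofReal he] at h2
  rw [abs_le]
  constructor <;> linarith

theorem eucl_single {ι : Type*} [Fintype ι] [DecidableEq ι] (j : ι) :
    eucl (Pi.single j 1 : ι → ℝ) = 1 := by
  rw [← sq_eq_sq₀ (eucl_nonneg _) zero_le_one, eucl_sq]
  simp

theorem quadForm_le {ι : Type*} [Fintype ι] [DecidableEq ι] (W : Matrix ι ι ℝ) (x : ι → ℝ) :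
    quadForm W x ≤ ‖W‖ * eucl x ^ 2 := by
  refine (dotProduct_le _ _).trans ?_
  calc eucl x * eucl (W *ᵥ x) ≤ eucl x * (‖W‖ * eucl x) :=
        mul_le_mul_of_nonneg_left (eucl_mulVec_le _ _) (eucl_nonneg x)
    _ = _ := by ring

/-- Pointwise bound for the cost error. -/
noncomputable def errorDensity (a b : ℝ) (N : ℕ) (z : Fin n → ℝ → Fin (N + 1) × Fin n → ℝ)
    (ω τ Δ σ ξ t : ℝ) : ℝ :=
  ∑ j, ω * ((1 + 1 / Δ) * (2 * τ ^ 2 *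
        (eucl (expand a b N (z j t) ξ) ^ 2 + (Δ * τ * Real.exp (-σ * t)) ^ 2)) +
          Δ * (τ ^ 2 * Real.exp (-σ * t)) ^ 2)

theorem continuous_errorDensity (a b : ℝ) {N : ℕ} {z : Fin n → ℝ → Fin (N + 1) × Fin n → ℝ}
    (hz : ∀ j, Continuous (z j)) (ω τ Δ σ : ℝ) :
    Continuous (Function.uncurry (errorDensity a b N z ω τ Δ σ)) := by
  have hyc : ∀ j, Continuous fun p : ℝ × ℝ => eucl (expand a b N (z j p.2) p.1) := fun j =>
    continuous_eucl.comp (continuous_expand_comp a b N ((hz j).comp continuous_snd) continuous_fst)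
  have hec : Continuous fun p : ℝ × ℝ => Real.exp (-σ * p.2) := by fun_prop
  simp only [Function.uncurry_def, errorDensity]
  fun_prop

/-- Integrating the pointwise cost error bound over the parameter and time. -/
theorem lintegral_lintegral_error_le (hab : a < b) {N : ℕ}
    {z : Fin n → ℝ → Fin (N + 1) × Fin n → ℝ} (hz : ∀ j, Continuous (z j)) {ω τ Δ σ : ℝ}
    (hω : 0 ≤ ω) (hΔ : 0 < Δ) (hσ : 0 < σ)
    (hzle : ∀ j t, 0 ≤ t → eucl (z j t) ≤ Δ * τ * Real.exp (-σ * t)) :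
    ∫⁻ ξ, (∫⁻ t in Set.Ici (0 : ℝ), ENNReal.ofReal
        (errorDensity a b N z ω τ Δ σ ξ t)) ∂(unif a b) ≤
      ENNReal.ofReal (n * (ω * τ ^ 4 * (4 * Δ ^ 2 + 5 * Δ)) / (2 * σ)) := by
  have := isProbabilityMeasure_unif hab
  rw [lintegral_lintegral_swap (f := fun ξ t => ENNReal.ofReal (errorDensity a b N z ω τ Δ σ ξ t))
      (ENNReal.continuous_ofReal.comp (continuous_errorDensity a b hz ω τ Δ σ)).measurable.aemeasurable,
    ← lintegral_ofReal_exp (by positivity) (by positivity : 0 < 2 * σ)]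
  refine setLIntegral_mono' measurableSet_Ici fun t ht => ?_
  have hy2 : ∀ j, Integrable (fun ξ => eucl (expand a b N (z j t) ξ) ^ 2) (unif a b) := fun j =>
    integrable_unif hab
      ((continuous_eucl.comp (continuous_expand a b N (z j t))).pow 2).continuousOn
  have hi : ∀ j, Integrable (fun ξ => ω * ((1 + 1 / Δ) * (2 * τ ^ 2 *
        (eucl (expand a b N (z j t) ξ) ^ 2 + (Δ * τ * Real.exp (-σ * t)) ^ 2)) +
          Δ * (τ ^ 2 * Real.exp (-σ * t)) ^ 2)) (unif a b) := fun j =>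
    (((((hy2 j).add (integrable_const _)).const_mul _).const_mul _).add
      (integrable_const _)).const_mul _
  simp only [errorDensity]
  rw [← ofReal_integral_eq_lintegral_ofReal (integrable_finsetSum _ fun j _ => hi j)
    (Filter.Eventually.of_forall fun ξ => Finset.sum_nonneg fun j _ => by positivity)]
  refine ENNReal.ofReal_le_ofReal ?_
  rw [integral_finsetSum _ fun j _ => hi j]
  -- Parseval replaces the mean of the squared expansion by ‖z‖², which has the same bound as the
  -- pointwise remainder. The constant is (1 + 1/Δ)·4Δ² + Δ = 4Δ² + 5Δ.
  have hj : ∀ j, ∫ ξ, ω * ((1 + 1 / Δ) * (2 * τ ^ 2 *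
        (eucl (expand a b N (z j t) ξ) ^ 2 + (Δ * τ * Real.exp (-σ * t)) ^ 2)) +
          Δ * (τ ^ 2 * Real.exp (-σ * t)) ^ 2) ∂(unif a b) ≤
      ω * τ ^ 4 * (4 * Δ ^ 2 + 5 * Δ) * Real.exp (-(2 * σ) * t) := by
    intro j
    have e : ∀ ξ, ω * ((1 + 1 / Δ) * (2 * τ ^ 2 *
        (eucl (expand a b N (z j t) ξ) ^ 2 + (Δ * τ * Real.exp (-σ * t)) ^ 2)) +
          Δ * (τ ^ 2 * Real.exp (-σ * t)) ^ 2) =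
        ω * ((1 + 1 / Δ) * (2 * τ ^ 2)) * eucl (expand a b N (z j t) ξ) ^ 2 +
        ω * ((1 + 1 / Δ) * (2 * τ ^ 2 * (Δ * τ * Real.exp (-σ * t)) ^ 2) +
          Δ * (τ ^ 2 * Real.exp (-σ * t)) ^ 2) := fun ξ => by ring
    simp_rw [e]
    rw [integral_add ((hy2 j).const_mul _) (integrable_const _), integral_const_mul,
      integral_eucl_expand_sq hab, integral_const, probReal_univ, one_smul]
    have h1 : eucl (z j t) ^ 2 ≤ (Δ * τ * Real.exp (-σ * t)) ^ 2 :=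
      pow_le_pow_left₀ (eucl_nonneg _) (hzle j t ht) 2
    have h2 : Real.exp (-(2 * σ) * t) = Real.exp (-σ * t) ^ 2 := by
      rw [← Real.exp_nat_mul]; congr 1; push_cast; ring
    rw [h2]
    calc _ = ω * ((1 + 1 / Δ) * (2 * τ ^ 2 * (eucl (z j t) ^ 2 +
          (Δ * τ * Real.exp (-σ * t)) ^ 2)) + Δ * (τ ^ 2 * Real.exp (-σ * t)) ^ 2) := by ring
      _ ≤ ω * ((1 + 1 / Δ) * (2 * τ ^ 2 * ((Δ * τ * Real.exp (-σ * t)) ^ 2 +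
          (Δ * τ * Real.exp (-σ * t)) ^ 2)) + Δ * (τ ^ 2 * Real.exp (-σ * t)) ^ 2) := by gcongr
      _ = _ := by field_simp; ring
  refine (Finset.sum_le_sum fun j _ => hj j).trans_eq ?_
  rw [Finset.sum_const, Finset.card_univ, Fintype.card_fin, nsmul_eq_mul]
  ring

/-- Quantitative cost error from uniform contraction and polynomial approximation. -/
theorem cost_error (hab : a < b) {N d s : ℕ} (hs : s * d ≤ N)
    {A A' : ℝ → Matrix (Fin n) (Fin n) ℝ} {B B' : ℝ → Matrix (Fin n) (Fin m) ℝ}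
    (hA : ContinuousOn A (Set.Icc a b)) (hB : ContinuousOn B (Set.Icc a b))
    (hA' : ∀ i j, IsPolyLE d fun ξ => A' ξ i j) (hB' : ∀ i j, IsPolyLE d fun ξ => B' ξ i j)
    {Q : Matrix (Fin n) (Fin n) ℝ} {R : Matrix (Fin m) (Fin m) ℝ} (hQ : Q.PosDef) (hR : R.PosDef)
    {K : Matrix (Fin m) (Fin n) ℝ} {T Ti : Matrix (Fin n) (Fin n) ℝ}
    (hTTi : T * Ti = 1) (hTiT : Ti * T = 1) {η q r C δ τ ω Δ : ℝ} (hη : 0 < η) (hqr : q ≤ r)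
    (hr : r < 1) (hC : TruncatedExpBound q r C) (hT : ‖T‖ ≤ τ) (hTi : ‖Ti‖ ≤ τ)
    (hW : ‖stateWeight Q R K‖ ≤ ω) (hΔ : 0 < Δ) (hCΔ : C * (δ + r ^ s) ≤ Δ)
    (hq : ∀ ξ ∈ Set.Icc a b, ‖T * (1 + η • closedLoop (A ξ) (B ξ) K) * Ti‖ ≤ q)
    (hq' : ∀ ξ ∈ Set.Icc a b, ‖T * (1 + η • closedLoop (A' ξ) (B' ξ) K) * Ti‖ ≤ q)
    (hδ : ∀ ξ ∈ Set.Icc a b, ‖T * (1 + η • closedLoop (A ξ) (B ξ) K) * Ti -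
      T * (1 + η • closedLoop (A' ξ) (B' ξ) K) * Ti‖ ≤ δ) :
    expectedCost a b A B Q R K ≠ ⊤ ∧ surrogateCost a b A B Q R N K ≠ ⊤ ∧
      |(expectedCost a b A B Q R K).toReal - (surrogateCost a b A B Q R N K).toReal| ≤
        n * (ω * τ ^ 4 * (4 * Δ ^ 2 + 5 * Δ)) / (2 * ((1 - r) / η)) := by
  have := isProbabilityMeasure_unif hab
  set M : ℝ → Matrix (Fin n) (Fin n) ℝ := fun ξ => closedLoop (A ξ) (B ξ) K with hM
  set W := stateWeight Q R K
  set σ := (1 - r) / η with hσdef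
  have hσ : 0 < σ := div_pos (by linarith) hη
  have hτ0 : 0 ≤ τ := (norm_nonneg _).trans hT
  have hω0 : 0 ≤ ω := (norm_nonneg _).trans hW
  have hMc : ContinuousOn M (Set.Icc a b) :=
    hA.sub ((continuous_id.matrix_mul continuous_const).comp_continuousOn hB)
  choose z hzc hz using fun j : Fin n => exists_state_error hab hs hMc
    (isPolyLE_closedLoop hA' hB' K) hTTi hTiT hη hC hq hq' hδ (Pi.single j 1)
  have hsmall : ∀ j : Fin n, ∀ t, C * (δ + r ^ s) * Real.exp (-((1 - r) / η) * t) *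
      eucl (T *ᵥ Pi.single j 1) ≤ Δ * τ * Real.exp (-σ * t) := by
    intro j t
    have h1 : eucl (T *ᵥ Pi.single j 1) ≤ τ := by
      have := eucl_mulVec_le T (Pi.single j 1)
      rw [eucl_single, mul_one] at this
      exact this.trans hT
    calc _ ≤ Δ * Real.exp (-((1 - r) / η) * t) * τ :=
          mul_le_mul (mul_le_mul_of_nonneg_right hCΔ (Real.exp_pos _).le) h1 (eucl_nonneg _)
            (by positivity)
      _ = _ := by rw [hσdef]; ring
  -- The true rate (1 - q)/η is weakened to the rate σ of the remainders, using q ≤ r.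
  have hx : ∀ j : Fin n, ∀ ξ ∈ Set.Icc a b, ∀ t, 0 ≤ t →
      eucl (flow (M ξ) t (Pi.single j 1)) ≤ τ ^ 2 * Real.exp (-σ * t) := by
    intro j ξ hξ t ht
    refine (eucl_flow_le hTTi hTiT hη (hq ξ hξ) ht _).trans ?_
    rw [eucl_single, mul_one, sq]
    gcongr
    rw [hσdef]
    gcongr
  set E := errorDensity a b N z ω τ Δ σ
  have hEc : Continuous (Function.uncurry E) := continuous_errorDensity a b hzc ω τ Δ σ
  have hEle := lintegral_lintegral_error_le (ω := ω) hab hzc hω0 hΔ hσ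
    fun j t ht => ((hz j t ht).1).trans (hsmall j t)
  have hpt : ∀ ξ ∈ Set.Icc a b, ∀ t, 0 ≤ t →
      |∑ j, quadForm W (expand a b N (flow (lift a b N M) t
        (surrogateInit N (Pi.single j 1))) ξ) - ∑ j, quadForm W (flow (M ξ) t (Pi.single j 1))| ≤
        E ξ t := by
    intro ξ hξ t ht
    rw [← Finset.sum_sub_distrib]
    refine (Finset.abs_sum_le_sum_abs _ _).trans (Finset.sum_le_sum fun j _ => ?_)
    obtain ⟨g, hg, he⟩ := (hz j t ht).2 ξ hξ
    exact abs_quadForm_sub_le_of_error hΔ hτ0 hW hTi (hx j ξ hξ t ht) (hg.trans (hsmall j t)) he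
  have hJ : expectedCost a b A B Q R K = ∫⁻ ξ, (∫⁻ t in Set.Ici (0 : ℝ), ENNReal.ofReal
      (∑ j, quadForm W (flow (M ξ) t (Pi.single j 1)))) ∂(unif a b) :=
    lintegral_congr fun ξ => systemCost_eq hQ hR _ _ _
  have hJ' : surrogateCost a b A B Q R N K = ∫⁻ ξ, (∫⁻ t in Set.Ici (0 : ℝ), ENNReal.ofReal
      (∑ j, quadForm W (expand a b N (flow (lift a b N M) t
        (surrogateInit N (Pi.single j 1))) ξ))) ∂(unif a b) := by
    rw [surrogateCost_eq hQ hR, surrogateClosedLoop_eq_lift hab N hA hB]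
  -- Finiteness is proved directly for the true cost only; the surrogate inherits it from the
  -- two-sided comparison.
  have hfin : expectedCost a b A B Q R K ≠ ⊤ := by
    have hle : expectedCost a b A B Q R K ≤ ∫⁻ _ξ, (∫⁻ t in Set.Ici (0 : ℝ), ENNReal.ofReal
        (n * (ω * τ ^ 4) * Real.exp (-(2 * σ) * t))) ∂(unif a b) := by
      rw [hJ]
      refine lintegral_mono_ae ?_
      filter_upwards [ae_unif_mem a b] with ξ hξ
      refine setLIntegral_mono' measurableSet_Ici fun t ht => ENNReal.ofReal_le_ofReal ?_
      have h1 : ∀ j : Fin n, quadForm W (flow (M ξ) t (Pi.single j 1)) ≤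
          ω * τ ^ 4 * Real.exp (-(2 * σ) * t) := by
        intro j
        have h2 : Real.exp (-(2 * σ) * t) = Real.exp (-σ * t) ^ 2 := by
          rw [← Real.exp_nat_mul]; congr 1; push_cast; ring
        have h3 := hx j ξ hξ t ht
        have h4 := eucl_nonneg (flow (M ξ) t (Pi.single j 1))
        calc _ ≤ ‖W‖ * eucl (flow (M ξ) t (Pi.single j 1)) ^ 2 := quadForm_le _ _
          _ ≤ ω * (τ ^ 2 * Real.exp (-σ * t)) ^ 2 := by gcongr
          _ = _ := by rw [h2]; ring
      refine (Finset.sum_le_sum fun j _ => h1 j).trans_eq ?_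
      rw [Finset.sum_const, Finset.card_univ, Fintype.card_fin, nsmul_eq_mul]
      ring
    refine (hle.trans_lt ?_).ne
    rw [lintegral_const, measure_univ, mul_one,
      lintegral_ofReal_exp (by positivity) (by positivity)]
    exact ENNReal.ofReal_lt_top
  refine ⟨hfin, abs_toReal_sub_toReal_le hfin (by positivity) ?_ ?_⟩
  · rw [hJ, hJ']
    refine (lintegral_lintegral_le_add hEc ?_).trans (add_le_add_right hEle _)
    filter_upwards [ae_unif_mem a b] with ξ hξ t ht
    have := (abs_le.1 (hpt ξ hξ t ht)).1
    linarith
  · rw [hJ, hJ']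
    refine (lintegral_lintegral_le_add hEc ?_).trans (add_le_add_right hEle _)
    filter_upwards [ae_unif_mem a b] with ξ hξ t ht
    have := (abs_le.1 (hpt ξ hξ t ht)).2
    linarith

end CostError

end PCELQR

namespace PCELQR

/-! ### Uniform convergence over the sublevel set -/

section Convergence

variable {n m : ℕ} {a b : ℝ}

theorem mem_admissible_of_contraction {A : ℝ → Matrix (Fin n) (Fin n) ℝ}
    {B : ℝ → Matrix (Fin n) (Fin m) ℝ} {K : Matrix (Fin m) (Fin n) ℝ}
    {T Ti : Matrix (Fin n) (Fin n) ℝ} (hTTi : T * Ti = 1) (hTiT : Ti * T = 1) {η q τ : ℝ}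
    (hη : 0 < η) (hq1 : q < 1) (hτ : 0 < τ) (hT : ‖T‖ ≤ τ) (hTi : ‖Ti‖ ≤ τ)
    (hq : ∀ ξ ∈ Set.Icc a b, ‖T * (1 + η • closedLoop (A ξ) (B ξ) K) * Ti‖ ≤ q) :
    K ∈ admissible a b A B := by
  refine ⟨τ * τ, by positivity, (1 - q) / η, div_pos (by linarith) hη, fun x₀ ξ hξ t ht => ?_⟩
  refine (eucl_flow_le hTTi hTiT hη (hq ξ hξ) ht x₀.ofLp).trans ?_
  have : eucl x₀.ofLp = ‖x₀‖ := rfl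
  rw [this]
  gcongr

/-- Projection cannot increase the norm of the conjugated Euler step, so a contraction uniform in ξ
gives stability at every order N. -/
theorem mem_surrogateAdmissible_of_contraction (hab : a < b) {A : ℝ → Matrix (Fin n) (Fin n) ℝ}
    {B : ℝ → Matrix (Fin n) (Fin m) ℝ} (hA : ContinuousOn A (Set.Icc a b))
    (hB : ContinuousOn B (Set.Icc a b)) (N : ℕ) {K : Matrix (Fin m) (Fin n) ℝ}
    {T Ti : Matrix (Fin n) (Fin n) ℝ} (hTiT : Ti * T = 1) {η q : ℝ} (hη : 0 < η) (hq1 : q < 1)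
    (hq : ∀ ξ ∈ Set.Icc a b, ‖T * (1 + η • closedLoop (A ξ) (B ξ) K) * Ti‖ ≤ q) :
    K ∈ surrogateAdmissible a b A B N := by
  have hMc : ContinuousOn (fun ξ => closedLoop (A ξ) (B ξ) K) (Set.Icc a b) :=
    hA.sub ((continuous_id.matrix_mul continuous_const).comp_continuousOn hB)
  have hSc : ContinuousOn (fun ξ => T * (1 + η • closedLoop (A ξ) (B ξ) K) * Ti) (Set.Icc a b) :=
    ((continuous_const.matrix_mul (continuous_const.add (continuous_id.const_smul η))).matrix_mul
      continuous_const).comp_continuousOn hMc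
  refine isHurwitz_of_norm_lt_one (kronecker_mul_kronecker_eq_one N hTiT) hη hq1 ?_
  rw [surrogateClosedLoop_eq_lift hab N hA hB, ← lift_conj_euler_step hab N hMc]
  exact norm_lift_le hab N hSc hq

theorem norm_euler_step_sub_le {T Ti A A' : Matrix (Fin n) (Fin n) ℝ}
    {B B' : Matrix (Fin n) (Fin m) ℝ} {K : Matrix (Fin m) (Fin n) ℝ} {η τ κ e : ℝ} (hη : 0 ≤ η)
    (hT : ‖T‖ ≤ τ) (hTi : ‖Ti‖ ≤ τ) (hK : ‖K‖ ≤ κ) (hA : ‖A - A'‖ ≤ e) (hB : ‖B - B'‖ ≤ e) :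
    ‖T * (1 + η • closedLoop A B K) * Ti - T * (1 + η • closedLoop A' B' K) * Ti‖ ≤
      τ ^ 2 * η * (1 + κ) * e := by
  have hτ : 0 ≤ τ := (norm_nonneg _).trans hT
  have he : 0 ≤ e := (norm_nonneg _).trans hA
  have e1 : T * (1 + η • closedLoop A B K) * Ti - T * (1 + η • closedLoop A' B' K) * Ti =
      T * (η • ((A - A') - (B - B') * K)) * Ti := by
    rw [← closedLoop_sub_closedLoop, ← sub_mul, ← mul_sub, add_sub_add_left_eq_sub, smul_sub]
  have h1 : ‖(A - A') - (B - B') * K‖ ≤ e + e * κ :=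
    (norm_sub_le _ _).trans (add_le_add hA ((Matrix.l2_opNorm_mul _ _).trans
      (mul_le_mul hB hK (norm_nonneg _) he)))
  have h2 : ‖η • ((A - A') - (B - B') * K)‖ ≤ η * (e + e * κ) := by
    rw [norm_smul, Real.norm_of_nonneg hη]
    gcongr
  rw [e1]
  calc _ ≤ ‖T‖ * ‖η • ((A - A') - (B - B') * K)‖ * ‖Ti‖ :=
        (Matrix.l2_opNorm_mul _ _).trans
          (mul_le_mul_of_nonneg_right (Matrix.l2_opNorm_mul _ _) (norm_nonneg _))
    _ ≤ τ * (η * (e + e * κ)) * τ := by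
        have : 0 ≤ η * (e + e * κ) := (norm_nonneg _).trans h2
        gcongr
    _ = _ := by ring

theorem norm_stateWeight_le (Q : Matrix (Fin n) (Fin n) ℝ) (R : Matrix (Fin m) (Fin m) ℝ)
    {K : Matrix (Fin m) (Fin n) ℝ} {κ : ℝ} (hK : ‖K‖ ≤ κ) :
    ‖stateWeight Q R K‖ ≤ ‖Q‖ + κ * ‖R‖ * κ := by
  have hκ : 0 ≤ κ := (norm_nonneg _).trans hK
  have hKt : ‖Kᵀ‖ ≤ κ := by
    rw [← Matrix.conjTranspose_eq_transpose_of_trivial, Matrix.l2_opNorm_conjTranspose]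
    exact hK
  refine (norm_add_le _ _).trans (add_le_add_right ?_ _)
  refine (Matrix.l2_opNorm_mul _ _).trans (mul_le_mul ?_ hK (norm_nonneg _) (by positivity))
  exact (Matrix.l2_opNorm_mul _ _).trans (mul_le_mul_of_nonneg_right hKt (norm_nonneg _))

/-- With truncation order and degree about `√N`, superalgebraic rates in the degree become
superalgebraic rates in `N`. -/
theorem exists_sqrt_rate {r : ℝ} (hr0 : 0 ≤ r) (hr1 : r < 1) (c : ℝ) (p : ℕ) :
    ∃ C : ℝ, ∀ N : ℕ, 1 ≤ N →
      c / (Nat.sqrt N : ℝ) ^ (2 * p) + r ^ Nat.sqrt N ≤ C / (N : ℝ) ^ p := by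
  obtain ⟨C, hC⟩ := (tendsto_pow_const_mul_const_pow_of_lt_one (2 * p) hr0 hr1).bddAbove_range
  refine ⟨(|c| + |C|) * 4 ^ p, fun N hN => ?_⟩
  set s := Nat.sqrt N
  have hs : 1 ≤ s := Nat.le_sqrt'.2 (by simpa using hN)
  have hs0 : (0 : ℝ) < s := by exact_mod_cast hs
  have hN0 : (0 : ℝ) < N := by exact_mod_cast hN
  have h1 : r ^ s ≤ |C| / (s : ℝ) ^ (2 * p) := by
    rw [le_div_iff₀ (by positivity), mul_comm]
    exact (hC ⟨s, rfl⟩).trans (le_abs_self C)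
  have h2 : (N : ℝ) ^ p ≤ 4 ^ p * (s : ℝ) ^ (2 * p) := by
    -- From N ≤ s² + 2s and s ≥ 1.
    have h3 : N ≤ 4 * s ^ 2 := by
      have := Nat.sqrt_le_add N
      nlinarith
    have h4 : (N : ℝ) ≤ 4 * (s : ℝ) ^ 2 := by exact_mod_cast h3
    calc (N : ℝ) ^ p ≤ (4 * (s : ℝ) ^ 2) ^ p := by gcongr
      _ = _ := by rw [mul_pow, pow_mul]
  calc c / (s : ℝ) ^ (2 * p) + r ^ s ≤ |c| / (s : ℝ) ^ (2 * p) + |C| / (s : ℝ) ^ (2 * p) := by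
        gcongr
        exact le_abs_self c
    _ = (|c| + |C|) / (s : ℝ) ^ (2 * p) := by ring
    _ ≤ (|c| + |C|) * 4 ^ p / (N : ℝ) ^ p := by
        rw [div_le_div_iff₀ (by positivity) (by positivity), mul_assoc]
        gcongr

/-- In state dimension 0 the value `lambdaMin Q` is 0, so the contraction argument is unavailable;
every cost is then an integral of an empty sum. -/
theorem surrogate_convergence_of_isEmpty (A : ℝ → Matrix (Fin 0) (Fin 0) ℝ)
    (B : ℝ → Matrix (Fin 0) (Fin m) ℝ) {Q : Matrix (Fin 0) (Fin 0) ℝ}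
    {R : Matrix (Fin m) (Fin m) ℝ} (hQ : Q.PosDef) (hR : R.PosDef) (K : Matrix (Fin m) (Fin 0) ℝ)
    (N : ℕ) :
    K ∈ admissible a b A B ∧ K ∈ surrogateAdmissible a b A B N ∧
      expectedCost a b A B Q R K = 0 ∧ surrogateCost a b A B Q R N K = 0 := by
  refine ⟨⟨1, one_pos, 1, one_pos, fun x₀ ξ _ t _ => ?_⟩, fun z hz => ?_, ?_, ?_⟩
  · rw [Subsingleton.elim (WithLp.toLp 2 (flow (closedLoop (A ξ) (B ξ) K) t x₀.ofLp)) 0, norm_zero]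
    positivity
  · rw [spectrum.of_subsingleton] at hz
    exact hz.elim
  · simp only [expectedCost, systemCost_eq hQ hR]
    simp
  · rw [surrogateCost_eq hQ hR]
    simp

end Convergence

end PCELQR

/-- The polynomial chaos surrogate cost converges to the expected LQR cost faster than every power
of `1 / N`, with a constant uniform over the sublevel set of the nominal cost. -/
theorem theorem2 (n m : ℕ) (a b : ℝ) (hab : a < b)
    (A : ℝ → Matrix (Fin n) (Fin n) ℝ) (B : ℝ → Matrix (Fin n) (Fin m) ℝ)
    (hA : AnalyticOn ℝ A (Set.Icc a b)) (hB : AnalyticOn ℝ B (Set.Icc a b))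
    (Q : Matrix (Fin n) (Fin n) ℝ) (R : Matrix (Fin m) (Fin m) ℝ)
    (hQ : Q.PosDef) (hR : R.PosDef)
    (ξbar : ℝ) (hξbar : ξbar ∈ Set.Icc a b)
    (h : ℝ) (hh : 0 < h) (ε₁ : ℝ) (hε₁ : ε₁ ∈ Set.Ioo (0 : ℝ) 1)
    (hhet : PCELQR.SmallHeterogeneity a b A B Q R ξbar h ε₁) (p : ℕ) :
    ∃ C₁ : ℝ, 0 < C₁ ∧
      ∀ K ∈ PCELQR.sublevel (A ξbar) (B ξbar) Q R h, ∀ N : ℕ, 1 ≤ N →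
        K ∈ PCELQR.admissible a b A B ∧
        K ∈ PCELQR.surrogateAdmissible a b A B N ∧
        PCELQR.expectedCost a b A B Q R K ≠ ⊤ ∧
        PCELQR.surrogateCost a b A B Q R N K ≠ ⊤ ∧
        |(PCELQR.expectedCost a b A B Q R K).toReal -
            (PCELQR.surrogateCost a b A B Q R N K).toReal| ≤ C₁ * (N : ℝ) ^ (-(p : ℤ)) := by
  rcases Nat.eq_zero_or_pos n with rfl | hn
  · refine ⟨1, one_pos, fun K _ N _ => ?_⟩
    obtain ⟨h1, h2, h3, h4⟩ :=
      PCELQR.surrogate_convergence_of_isEmpty (a := a) (b := b) A B hQ hR K N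
    refine ⟨h1, h2, by simp [h3], by simp [h4], ?_⟩
    rw [h3, h4, sub_self, abs_zero]
    positivity
  obtain ⟨hε, hε'⟩ := PCELQR.heterogeneityLevel_le (A := A ξbar) (B := B ξbar) hn hQ hR hh hε₁.1
  set ε := PCELQR.heterogeneityLevel (A ξbar) (B ξbar) Q R h ε₁
  obtain ⟨κ, τ, η, q, hκ, hτ, hη, hq0, hq1, hcontr⟩ :=
    PCELQR.exists_contraction hn hQ hR hh hε hε'
  obtain ⟨r, hqr, hr1, C, hC0, hC⟩ := PCELQR.exists_norm_exp_sub_expPart_le hq0 hq1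
  have hAε : ∀ ξ ∈ Set.Icc a b, ‖A ξ - A ξbar‖ ≤ ε := fun ξ hξ => (hhet ξ hξ ξbar hξbar).1
  have hBε : ∀ ξ ∈ Set.Icc a b, ‖B ξ - B ξbar‖ ≤ ε := fun ξ hξ => (hhet ξ hξ ξbar hξbar).2
  -- The degree will be about √N, so the order 2p in the degree is order p in N.
  obtain ⟨Ca, hCa, happ⟩ := PCELQR.exists_data_approx hab hA hB hε hAε hBε (2 * p)
  obtain ⟨Cs, hCs⟩ :=
    PCELQR.exists_sqrt_rate (hq0.le.trans hqr) hr1 (τ ^ 2 * η * (1 + κ) * Ca) p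
  -- The added 1 keeps Δ = D/Nᵖ positive, as Young's inequality divides by it.
  set D := |C * Cs| + 1 with hD
  have hD0 : 0 < D := by positivity
  set ω := ‖Q‖ + κ * ‖R‖ * κ
  set σ := (1 - r) / η
  have hσ : 0 < σ := div_pos (by linarith) hη
  -- Since Δ ≤ D, the error factor 4Δ² + 5Δ is at most (4D + 5)Δ, linear in N⁻ᵖ; the final 1 makes
  -- the constant positive.
  refine ⟨n * (ω * τ ^ 4 * ((4 * D + 5) * D)) / (2 * σ) + 1, by positivity, fun K hK N hN => ?_⟩
  obtain ⟨hKκ, T, Ti, hTTi, hTiT, hT, hTi, hq⟩ := hcontr K hK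
  have hqA : ∀ ξ ∈ Set.Icc a b,
      ‖T * (1 + η • PCELQR.closedLoop (A ξ) (B ξ) K) * Ti‖ ≤ q := fun ξ hξ =>
    hq _ _ ((hAε ξ hξ).trans (by linarith)) ((hBε ξ hξ).trans (by linarith))
  have hs : 1 ≤ Nat.sqrt N := Nat.le_sqrt'.2 (by simpa using hN)
  obtain ⟨A', B', hA', hB', hAB⟩ := happ (Nat.sqrt N) hs
  have hNp : (1 : ℝ) ≤ (N : ℝ) ^ p := one_le_pow₀ (by exact_mod_cast hN)
  have hΔ : 0 < D / (N : ℝ) ^ p := by positivity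
  have hCΔ : C * (τ ^ 2 * η * (1 + κ) * (Ca / (Nat.sqrt N : ℝ) ^ (2 * p)) + r ^ Nat.sqrt N) ≤
      D / (N : ℝ) ^ p := by
    have h1 := mul_le_mul_of_nonneg_left (hCs N hN) hC0
    rw [mul_div_assoc, ← mul_div_assoc C] at h1
    refine h1.trans ?_
    gcongr
    have := le_abs_self (C * Cs)
    linarith
  -- Truncation order and degree are both ⌊√N⌋, whose product is at most N.
  obtain ⟨h1, h2, h3⟩ := PCELQR.cost_error hab (Nat.sqrt_le N) hA.continuousOn hB.continuousOn
    hA' hB' hQ hR hTTi hTiT hη hqr hr1 hC hT hTi (PCELQR.norm_stateWeight_le Q R hKκ) hΔ hCΔ hqA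
    (fun ξ hξ => hq _ _ (hAB ξ hξ).2.2.1 (hAB ξ hξ).2.2.2)
    (fun ξ hξ => PCELQR.norm_euler_step_sub_le hη.le hT hTi hKκ (hAB ξ hξ).1 (hAB ξ hξ).2.1)
  refine ⟨PCELQR.mem_admissible_of_contraction hTTi hTiT hη hq1 hτ hT hTi hqA,
    PCELQR.mem_surrogateAdmissible_of_contraction hab hA.continuousOn hB.continuousOn N hTiT hη
      hq1 hqA, h1, h2, h3.trans ?_⟩
  rw [zpow_neg, zpow_natCast, ← div_eq_mul_inv]
  have hDle : D / (N : ℝ) ^ p ≤ D := div_le_self hD0.le hNp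
  calc n * (ω * τ ^ 4 * (4 * (D / (N : ℝ) ^ p) ^ 2 + 5 * (D / (N : ℝ) ^ p))) / (2 * σ)
      ≤ n * (ω * τ ^ 4 * ((4 * D + 5) * (D / (N : ℝ) ^ p))) / (2 * σ) := by
        gcongr
        nlinarith
    _ = n * (ω * τ ^ 4 * ((4 * D + 5) * D)) / (2 * σ) / (N : ℝ) ^ p := by ring
    _ ≤ (n * (ω * τ ^ 4 * ((4 * D + 5) * D)) / (2 * σ) + 1) / (N : ℝ) ^ p := by
        gcongr
        linarith
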